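/- Setting. Let $P\subset\mathbb R^2$ be finite with no three points collinear, let $\gamma>0$, and consider the grid of half-open square cells of side $\gamma3^{i-1}$. For a cell $C$ let $N(C)$ be the $3\times3$ block of cells centred at $C$; for a point $u$ in the cell $C_u$ put $N(u)=N(C_u)$, $\Gamma^0(u)=\{C_u\}$, $\Gamma^{r}(u)=\bigcup_{C\in\Gamma^{r-1}(u)}N(C)$; $u$ and $v$ are $k$ cells apart if $C_v\in\Gamma^{k-1}(u)$. Let $\mathcal A$ be a plane straight-line graph on $P$ that is maximal (under inclusion of edge sets) among those all of whose edges $uv$ satisfy $v\in N(u)$. Let $f$ be a face of $\mathcal A$ that is not the interior of a triangle with vertices in $P$, and let $\sigma=\langle v_0,\dots,v_{m-1}\rangle$ be the closed walk, with $f$ on its right, along a component of the boundary of $f$ that contains an edge (indices mod $m$; a vertex met several times has several positions). A position of $\sigma$ is convex if its interior angle in $f$ is less than $\pi$, and reflex otherwise. Visibility. A point $x$ is visible from a position $a$ if the open segment $v_ax$ lies in $f$ and leaves $v_a$ through the corner of position $a$; two vertices (positions) are visible to each other if each is visible from the other. A boundary edge $v_av_{a+1}$ is visible to a vertex if some point of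 its relative interior is visible from it, on the right-hand side of the edge directed from $v_a$ to $v_{a+1}$. Chains. The chain $\mathbb C(v_a,v_b)$ is the part of $\sigma$ from $v_a$ to $v_b$. It is a $1$-chain if it has exactly one convex vertex $v'$ in its interior, all its vertices lie in $N(v')$, and $v_a,v_b$ are visible to each other. It is a $2$-chain if it has exactly two convex vertices in its interior, these are consecutive, say $v_c,v_{c+1}$, and $\mathbb C(v_a,v_{c+1})$ and $\mathbb C(v_c,v_b)$ are $1$-chains. Support vertices. The forward convex vertex of a vertex is the first convex vertex after it, and the forward support vertex is the successor of that one. The backward convex vertex is the last convex vertex before it, and the backward support vertex is the predecessor of that one. A vertex $v$ satisfies the forward (backward) condition if its forward (backward) convex vertex $c$ lies in $N(v)$, its forward (backward) support vertex $d$ is visible to $v$, and the boundary edge between $c$ and $d$ is visible to $v$. Phase 1 on $\sigma$. The start vertex $v_j$ is a backward support vertex of some reflex vertex, or $v_0$ if there is none. The vertices are taken up in order, beginning with $v_j$, for at most one round. Let $v$ be the current vertex, $v_{l-1}$ its forward convex and $v_l$ its forward support vertex. If the forward condition holds for $v$, then $v$ is processed (Step 1), and a chain $\mathbb C(v)$ is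 generated, as follows. (a) If $v_{l-1}$ has not been visited yet, $v_{l+1}$ is reflex and the backward condition holds for $v_{l+1}$, then $\mathbb C(v)=\mathbb C(v,v_s)$, where $v_s$ is the last vertex that satisfies the backward condition in the run of consecutive reflex vertices beginning with $v_{l+1}$. (b) If $v_{l-1}$ has not been visited yet and (a) does not apply, then $\mathbb C(v)=\mathbb C(v,v_l)$. In cases (a) and (b) the algorithm continues with the last vertex of $\mathbb C(v)$. (c) If $v_{l-1}$ was visited before (in the previous round; this includes the start vertex), then $\mathbb C(v)=\mathbb C(v,v_{j'})$, where $v_{j'}$ is the vertex the algorithm took up immediately after $v_j$, and the algorithm stops. If the forward condition fails for $v$, no edge is added and the algorithm continues with the next vertex (Step 2). For every generated chain, the edges added join vertices of that chain: they triangulate the region between the chain and the segment joining its end points. Claim. For every vertex $v$ processed, the generated chain $\mathbb C(v)$ is a $1$-chain or a $2$-chain. If the start vertex $v_j$ is processed, $\mathbb C(v_j)$ is a $1$-chain. Any two vertices of a generated chain are at most $4$ cells apart; in particular every added edge joins vertices that are at most $4$ cells apart. -/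

import Mathlib

namespace RingPhase

/-! The plane is `ℂ`; the input is a finite set `P` of points of the plane. -/

/-! ### The grid -/

/-- A grid cell, named by the integer coordinates of its lower left corner. -/
abbrev Cell : Type := ℤ × ℤ

/-- The (half-open) cell of the grid of side length `s` that contains `z`. -/
noncomputable def cellOf (s : ℝ) (z : ℂ) : Cell := (⌊z.re / s⌋, ⌊z.im / s⌋)

/-- `N(C)`: the `3 × 3` block of cells centred at `C`. -/
def nbhd (C : Cell) : Set Cell := {D | |D.1 - C.1| ≤ 1 ∧ |D.2 - C.2| ≤ 1}

/-- `Near s u v`: the point `v` lies in `N(u)`, the block around the cell of `u`. -/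
def Near (s : ℝ) (u v : ℂ) : Prop := cellOf s v ∈ nbhd (cellOf s u)

/-- `Γ⁰(u) = {C_u}` and `Γʲ⁺¹(u) = ⋃ N(C)` over `C ∈ Γʲ(u)`. -/
noncomputable def cellRing (s : ℝ) (u : ℂ) : ℕ → Set Cell
  | 0 => {cellOf s u}
  | j + 1 => ⋃ C ∈ cellRing s u j, nbhd C

/-- `u` and `v` are `k` cells apart: `k ≥ 1` and `C_v ∈ Γᵏ⁻¹(u)`. -/
def CellsApart (s : ℝ) (k : ℕ) (u v : ℂ) : Prop :=
  ∃ r : ℕ, k = r + 1 ∧ cellOf s v ∈ cellRing s u r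

/-- `u` and `v` are at most `n` cells apart. -/
def AtMostCellsApart (s : ℝ) (n : ℕ) (u v : ℂ) : Prop :=
  ∃ k : ℕ, k ≤ n ∧ CellsApart s k u v

/-! ### Plane straight-line graphs and faces -/

/-- No three points of `P` are collinear. -/
def GeneralPosition (P : Finset ℂ) : Prop :=
  ∀ a ∈ P, ∀ b ∈ P, ∀ c ∈ P, a ≠ b → a ≠ c → b ≠ c → ¬ Collinear ℝ ({a, b, c} : Set ℂ)

/-- The graph on `P` joining any two points that lie in the same or in neighbouring cells. -/
def adjGraph (P : Finset ℂ) (s : ℝ) : SimpleGraph P where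
  Adj u v := u ≠ v ∧ Near s u v
  symm := ⟨fun u v h => by
    refine ⟨h.1.symm, ?_, ?_⟩
    · have := h.2.1
      rwa [abs_sub_comm] at this
    · have := h.2.2
      rwa [abs_sub_comm] at this⟩
  loopless := ⟨fun _ h => h.1 rfl⟩

/-- A plane straight-line graph: no vertex lies inside an edge, and two distinct edges
meet at most in a common end point. -/
def IsPSLG {P : Finset ℂ} (A : SimpleGraph P) : Prop :=
  (∀ a b x : P, A.Adj a b → (x : ℂ) ∉ openSegment ℝ (a : ℂ) b) ∧
  (∀ a b c d : P, A.Adj a b → A.Adj c d → s(a, b) ≠ s(c, d) →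
    Disjoint (openSegment ℝ (a : ℂ) b) (segment ℝ (c : ℂ) d))

/-- `A` is a maximal plane straight-line graph with respect to the adjacency graph. -/
def IsMaximalPSLG {P : Finset ℂ} (s : ℝ) (A : SimpleGraph P) : Prop :=
  Maximal (fun B : SimpleGraph P => IsPSLG B ∧ B ≤ adjGraph P s) A

/-- The points of the plane covered by the vertices and the edges. -/
def drawing {P : Finset ℂ} (A : SimpleGraph P) : Set ℂ :=
  {z | z ∈ P} ∪ {z | ∃ a b : P, A.Adj a b ∧ z ∈ segment ℝ (a : ℂ) b}

/-- A face: a connected component of the complement of the drawing. -/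
def IsFace {P : Finset ℂ} (A : SimpleGraph P) (f : Set ℂ) : Prop :=
  ∃ z ∈ (drawing A)ᶜ, f = connectedComponentIn (drawing A)ᶜ z

/-- A face is triangulated when it is the inside of a triangle spanned by three vertices. -/
def IsTriangulated (P : Finset ℂ) (f : Set ℂ) : Prop :=
  ∃ a ∈ P, ∃ b ∈ P, ∃ c ∈ P, f = interior (convexHull ℝ ({a, b, c} : Set ℂ))

/-! ### Boundary vertex sequences

A boundary vertex sequence is a periodic sequence `σ : ℤ → P`; the position `i` stands for one
visit of the walk to the vertex `σ i`, so a vertex that is met several times has several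
positions. -/

/-- The counterclockwise angle, in `(0, 2π]`, from the direction `a` to the direction `b`. -/
noncomputable def ccwAngle (a b : ℂ) : ℝ :=
  toIocMod Real.two_pi_pos 0 (Complex.arg (b / a))

section Walk

variable {P : Finset ℂ}

/-- The interior angle at position `i` of a walk that has its face on the right. -/
noncomputable def cornerAngle (σ : ℤ → P) (i : ℤ) : ℝ :=
  ccwAngle ((σ (i - 1) : ℂ) - σ i) ((σ (i + 1) : ℂ) - σ i)

/-- `σ`, of period `m`, is the closed walk along one connected component of the boundary of the
face `f` of `A`, with `f` on the right-hand side of every edge that is traversed. -/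
structure IsBoundaryWalk (A : SimpleGraph P) (f : Set ℂ) (m : ℕ) (σ : ℤ → P) : Prop where
  pos : 0 < m
  periodic : ∀ i, σ (i + m) = σ i
  adj : ∀ i, A.Adj (σ i) (σ (i + 1))
  /-- the walk leaves `σ i` by the first edge counterclockwise after the one it came by -/
  next : ∀ i x, A.Adj (σ i) x →
    cornerAngle σ i ≤ ccwAngle ((σ (i - 1) : ℂ) - σ i) ((x : ℂ) - σ i)
  /-- within a period no edge is traversed twice in the same direction -/
  simple : ∀ i k : ℤ, 0 < k → k < m → ¬ (σ (i + k) = σ i ∧ σ (i + k + 1) = σ (i + 1))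
  /-- points just to the right of the midpoint of an edge lie in `f` -/
  right : ∀ i, ∀ᶠ t : ℝ in nhdsWithin 0 (Set.Ioi 0),
    midpoint ℝ (σ i : ℂ) (σ (i + 1)) - t * (Complex.I * ((σ (i + 1) : ℂ) - σ i)) ∈ f

/-- Convex position: the interior angle is less than `π`. -/
def IsConvex (σ : ℤ → P) (i : ℤ) : Prop := cornerAngle σ i < Real.pi

/-- Reflex position: not convex. -/
def IsReflex (σ : ℤ → P) (i : ℤ) : Prop := ¬ IsConvex σ i

/-- The point `x` is visible from position `i`: the open segment from `σ i` to `x` runs in `f`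
and leaves `σ i` through the corner of position `i`. -/
def SeesPoint (f : Set ℂ) (σ : ℤ → P) (i : ℤ) (x : ℂ) : Prop :=
  openSegment ℝ (σ i : ℂ) x ⊆ f ∧
    ccwAngle ((σ (i - 1) : ℂ) - σ i) (x - σ i) < cornerAngle σ i

/-- The vertices at positions `i` and `k` are visible to each other. -/
def SeesVertex (f : Set ℂ) (σ : ℤ → P) (i k : ℤ) : Prop :=
  SeesPoint f σ i (σ k) ∧ SeesPoint f σ k (σ i)

/-- The boundary edge from `σ k` to `σ (k + 1)` is visible from position `i`: some point `p`
inside the edge is visible, and it is seen on the right-hand side of the edge, the side on which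
the walk has `f` when it traverses the edge from position `k` to position `k + 1`. -/
def SeesEdge (f : Set ℂ) (σ : ℤ → P) (i k : ℤ) : Prop :=
  ∃ p ∈ openSegment ℝ (σ k : ℂ) (σ (k + 1)), SeesPoint f σ i p ∧
    ccwAngle ((σ k : ℂ) - p) ((σ i : ℂ) - p) < Real.pi

/-! ### Chains -/

/-- The chain from position `a` to position `b` is a `1`-chain: it has exactly one convex vertex
in its interior, all its vertices lie in the neighbourhood of that vertex, and its two end points
are visible to each other. -/
def IsOneChain (s : ℝ) (f : Set ℂ) (σ : ℤ → P) (a b : ℤ) : Prop :=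
  SeesVertex f σ a b ∧
  ∃ c, a < c ∧ c < b ∧ IsConvex σ c ∧
    (∀ i, a < i → i < b → IsConvex σ i → i = c) ∧
    (∀ i, a ≤ i → i ≤ b → Near s (σ c) (σ i))

/-- The chain from position `a` to position `b` is a `2`-chain: it has exactly two convex vertices
`σ c`, `σ (c + 1)` in its interior, these are consecutive, and the chains from `a` to `c + 1` and
from `c` to `b` are `1`-chains. -/
def IsTwoChain (s : ℝ) (f : Set ℂ) (σ : ℤ → P) (a b : ℤ) : Prop :=
  ∃ c, a < c ∧ c + 1 < b ∧ IsConvex σ c ∧ IsConvex σ (c + 1) ∧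
    (∀ i, a < i → i < b → IsConvex σ i → i = c ∨ i = c + 1) ∧
    IsOneChain s f σ a (c + 1) ∧ IsOneChain s f σ c b

/-! ### Phase 1 on one boundary vertex sequence -/

/-- `c` is the forward convex vertex of `k`; its successor `c + 1` is the forward support
vertex. -/
def IsForwardConvex (σ : ℤ → P) (k c : ℤ) : Prop := IsLeast {i | k < i ∧ IsConvex σ i} c

/-- `b` is the backward convex vertex of `k`; its predecessor `b - 1` is the backward support
vertex. -/
def IsBackwardConvex (σ : ℤ → P) (k b : ℤ) : Prop := IsGreatest {i | i < k ∧ IsConvex σ i} b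

/-- `q` is the backward support vertex of some reflex vertex. -/
def IsBackwardSupport (σ : ℤ → P) (q : ℤ) : Prop :=
  ∃ k, IsReflex σ k ∧ IsBackwardConvex σ k (q + 1)

/-- Start vertex: a backward support vertex if there is one, otherwise the vertex `σ 0`. -/
def IsStart (σ : ℤ → P) (j : ℤ) : Prop :=
  IsBackwardSupport σ j ∨ ((∀ q, ¬ IsBackwardSupport σ q) ∧ j = 0)

/-- With `c` the forward convex vertex of `k`: it lies in the neighbourhood of `σ k`, and the
forward support vertex and the edge from `c` to it are visible to `σ k`. -/
def ForwardCond (s : ℝ) (f : Set ℂ) (σ : ℤ → P) (k c : ℤ) : Prop :=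
  Near s (σ k) (σ c) ∧ SeesVertex f σ k (c + 1) ∧ SeesEdge f σ k c

/-- The mirror image, for a backward convex vertex `b` and backward support vertex `b - 1`. -/
def BackwardCond (s : ℝ) (f : Set ℂ) (σ : ℤ → P) (k b : ℤ) : Prop :=
  Near s (σ k) (σ b) ∧ SeesVertex f σ k (b - 1) ∧ SeesEdge f σ k (b - 1)

/-- The precondition of Step 1 at the vertex `k`, whose forward convex vertex is `c`. -/
def StepOne (s : ℝ) (f : Set ℂ) (σ : ℤ → P) (k c : ℤ) : Prop :=
  IsForwardConvex σ k c ∧ ForwardCond s f σ k c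

/-- The precondition of Step 1(a) for the forward support vertex `l`: the vertex `l + 1` is reflex
and satisfies the backward condition for its own backward convex vertex `b`. -/
def StepOneA (s : ℝ) (f : Set ℂ) (σ : ℤ → P) (l b : ℤ) : Prop :=
  IsReflex σ (l + 1) ∧ IsBackwardConvex σ (l + 1) b ∧ BackwardCond s f σ (l + 1) b

/-- `e` is the last vertex of the run of reflex vertices beginning at `l + 1` that satisfies the
backward condition for `b`. -/
def IsLastOfRun (s : ℝ) (f : Set ℂ) (σ : ℤ → P) (l b e : ℤ) : Prop :=
  IsGreatest {t | l + 1 ≤ t ∧ (∀ i, l + 1 ≤ i → i ≤ t → IsReflex σ i) ∧ BackwardCond s f σ t b} e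

/-- Step 1 at `k`, apart from 1(c), generates the chain from `k` to `e`. The start vertex is `j`
and `m` is the length of the sequence; the position `c` is still unvisited when `c < j + m`. -/
def OrdinaryChain (s : ℝ) (f : Set ℂ) (m : ℕ) (σ : ℤ → P) (j k e : ℤ) : Prop :=
  ∃ c, StepOne s f σ k c ∧ c < j + m ∧
    ((∃ b, StepOneA s f σ (c + 1) b ∧ IsLastOfRun s f σ (c + 1) b e) ∨
      ((∀ b, ¬ StepOneA s f σ (c + 1) b) ∧ e = c + 1))

/-- `j'` is the end of the (possibly trivial) chain generated at the start vertex `j`. -/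
def IsStartEnd (s : ℝ) (f : Set ℂ) (m : ℕ) (σ : ℤ → P) (j j' : ℤ) : Prop :=
  OrdinaryChain s f m σ j j j' ∨ ((∀ c, ¬ StepOne s f σ j c) ∧ j' = j + 1)

/-- Step 1(c) at `k`: the forward convex vertex has been visited before (its position is at least
`j + m`), and the chain is closed up to the end `j'` of the chain of the start vertex. -/
def ClosingChain (s : ℝ) (f : Set ℂ) (m : ℕ) (σ : ℤ → P) (j k e : ℤ) : Prop :=
  ∃ c j', StepOne s f σ k c ∧ j + m ≤ c ∧ IsStartEnd s f m σ j j' ∧ e = j' + m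

/-- The positions that the algorithm takes up one after another, beginning with the start
vertex `j`; it is finished when one round is completed or Step 1(c) has been executed. -/
inductive Reaches (s : ℝ) (f : Set ℂ) (m : ℕ) (σ : ℤ → P) (j : ℤ) : ℤ → Prop
  | start : Reaches s f m σ j j
  /-- after Step 1 the algorithm continues with the last vertex of the chain -/
  | stepOne {k e : ℤ} : Reaches s f m σ j k → k < j + m → OrdinaryChain s f m σ j k e →
      Reaches s f m σ j e
  /-- Step 2: no edge is added and the algorithm continues with the next vertex -/
  | stepTwo {k : ℤ} : Reaches s f m σ j k → k < j + m → (∀ c, ¬ StepOne s f σ k c) →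
      Reaches s f m σ j (k + 1)

/-- The vertex `k` is processed (Step 1 is executed for it) in the run with start vertex `j`, and
the chain generated is the one from `k` to `e`. -/
def Generates (s : ℝ) (f : Set ℂ) (m : ℕ) (σ : ℤ → P) (j k e : ℤ) : Prop :=
  Reaches s f m σ j k ∧ k < j + m ∧
    (OrdinaryChain s f m σ j k e ∨ ClosingChain s f m σ j k e)

/-- `u` and `v` are two vertices of one generated chain. The edges added for a chain triangulate
the region between the chain and the segment joining its end points without using further
vertices, so every added edge, whichever triangulation is taken, is such a pair. -/
def InGeneratedChain (s : ℝ) (f : Set ℂ) (m : ℕ) (σ : ℤ → P) (j : ℤ) (u v : P) : Prop :=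
  ∃ k e, Generates s f m σ j k e ∧
    ∃ p q, k ≤ p ∧ p ≤ e ∧ k ≤ q ∧ q ≤ e ∧ σ p = u ∧ σ q = v

end Walk

end RingPhase

namespace RingPhase

/-! ### Oriented area -/

/-! Let `c` be a convex position with successor `d`, and let `k` satisfy the forward condition: `k`
lies in `N(c)` and sees `d` and a point `p` of the edge `c d`. Turn a ray at `k` from `p` towards
`c` up to the first vertex `w` of the triangle `k p c` (`exists_fan`). The claim is that `k w` is an
edge (`IsFan.adj`). If not, `k` sees `w`, so maximality keeps `w` out of `N(k)`
(`not_near_of_free`). Since `w` lies in the triangle `k c d`, it lies in `N(c)` by convexity and in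
`N(d)` by the grid lemma `near_or_near_of_mem_hull`. Now sweep at `w` from `p` towards `d`: the
first vertex `v` lies in `N(w)`, so `w v` is an edge, and it must cross the free segment `k p`
(`IsFan.not_near_ends`). This is for `w ≠ c`; the vertex `c` is in `N(k)` anyway.

The swept triangle `k p w` is empty, so `w` again sees `p`, and `k w` is the first edge after the
visible direction `p`, that is, the next edge of the walk. Iterating along the reflex run
(`chain_isFan`), the walk from `k` to `c` consists of sweep vertices. They stay in the triangle `k p
c`, hence in `N(c)`, and inherit the forward condition. So the chain from `k` to `d` is a `1`-chain.
The backward condition is the mirror image, and the sign `ε` of the orientation lets one argument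
serve both.

Suppose a forward view from `k` and a backward view from `e` share the convex position `c`. What is
left to show is that `k` and `e` see each other. In the nondegenerate case the segments from `k` to
the successor of `c` and from `e` to its predecessor cross in a point `x`. If the sweep at `k` from
`x` towards `e` met a vertex `w ≠ e` first, then `w` would lie in `N(k)` or `N(e)`. In the first
case `w` sees the neighbour `u` of `k` on the chain and lies in `N(u)`, against maximality
(`Funnel.free_next`, `Funnel.not_near_fan`). In the second case the first vertex of the mirror sweep
at `e` lies in the triangle `w c e`, hence in `N(e)`, which is excluded in the same way
(`Funnel.fan_eq`).

The rest is bookkeeping on positions. If the support vertex `c + 1` in Step 1(a) is reflex, both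
conditions concern `c` and the funnel gives a `1`-chain; if it is convex, two `1`-chains overlap in
a `2`-chain. The choice of the start vertex `j` makes `j + 1` convex and gives `j` a `1`-chain. A
closing chain has its forward convex position at `j + m` or `j + 1 + m`, and is completed by the
start chain shifted by one period. -/

/-- `ε` times the doubled oriented area of the triangle `a b c`. -/
def D (ε : ℝ) (a b c : ℂ) : ℝ :=
  ε * ((b.re - a.re) * (c.im - a.im) - (b.im - a.im) * (c.re - a.re))

/-- The point `z` lies in the closed triangle `a b c`, which has orientation `ε`. -/
def InTri (ε : ℝ) (a b c z : ℂ) : Prop := 0 ≤ D ε a b z ∧ 0 ≤ D ε b c z ∧ 0 ≤ D ε c a z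

theorem D_rot (ε : ℝ) (a b c : ℂ) : D ε a b c = D ε b c a := by simp only [D]; ring

theorem D_swap (ε : ℝ) (a b c : ℂ) : D ε a b c = - D ε b a c := by simp only [D]; ring

theorem D_swap' (ε : ℝ) (a b c : ℂ) : D ε a b c = - D ε a c b := by simp only [D]; ring

theorem D_neg (ε : ℝ) (a b c : ℂ) : D (-ε) a b c = - D ε a b c := by simp only [D]; ring

theorem D_left (ε : ℝ) (a b : ℂ) : D ε a b a = 0 := by simp only [D]; ring

theorem D_right (ε : ℝ) (a b : ℂ) : D ε a b b = 0 := by simp only [D]; ring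

theorem D_self (ε : ℝ) (a b : ℂ) : D ε a a b = 0 := by simp only [D]; ring

theorem D_one (ε : ℝ) (a b c : ℂ) : D ε a b c = ε * D 1 a b c := by simp only [D]; ring

theorem D_one_eq_zero {ε : ℝ} {a b c : ℂ} (hε : ε ≠ 0) : D 1 a b c = 0 ↔ D ε a b c = 0 := by
  rw [D_one ε]; simp [hε]

theorem ne_zero_of_D_pos {ε : ℝ} {a b c : ℂ} (h : 0 < D ε a b c) : ε ≠ 0 := by
  rintro rfl; simp [D] at h

/-- The Plücker relation for the directions from `o` to four points. -/
theorem D_pluecker (ε : ℝ) (o a b c d : ℂ) :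
    D ε o a b * D ε o c d - D ε o a c * D ε o b d + D ε o a d * D ε o b c = 0 := by
  simp only [D]; ring

theorem D_sum (ε : ℝ) (u v w z : ℂ) : D ε u v z + D ε v w z + D ε w u z = D ε u v w := by
  simp only [D]; ring

/-- Barycentric interpolation of the affine function `D ε p q`. -/
theorem D_bary (ε : ℝ) (u v w p q z : ℂ) :
    D ε u v w * D ε p q z =
      D ε v w z * D ε p q u + D ε w u z * D ε p q v + D ε u v z * D ε p q w := by
  simp only [D]; ring

theorem re_bary (ε : ℝ) (u v w z : ℂ) :
    D ε u v w * z.re = D ε v w z * u.re + D ε w u z * v.re + D ε u v z * w.re := by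
  simp only [D]; ring

theorem im_bary (ε : ℝ) (u v w z : ℂ) :
    D ε u v w * z.im = D ε v w z * u.im + D ε w u z * v.im + D ε u v z * w.im := by
  simp only [D]; ring

/-- An affine function that is nonnegative at the corners is nonnegative on the triangle. The
orientation `δ` of the line may differ from that of the triangle. -/
theorem D_nonneg_of_inTri {ε : ℝ} {u v w p q z : ℂ} (h : 0 < D ε u v w) (hz : InTri ε u v w z)
    {δ : ℝ} (hu : 0 ≤ D δ p q u) (hv : 0 ≤ D δ p q v) (hw : 0 ≤ D δ p q w) : 0 ≤ D δ p q z := by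
  have e : D ε u v w * D δ p q z =
      D ε v w z * D δ p q u + D ε w u z * D δ p q v + D ε u v z * D δ p q w := by
    simp only [D]; ring
  have : 0 ≤ D ε u v w * D δ p q z := by
    rw [e]
    have := mul_nonneg hz.1 hw
    have := mul_nonneg hz.2.1 hu
    have := mul_nonneg hz.2.2 hv
    linarith
  exact nonneg_of_mul_nonneg_right this h

theorem mem_convexHull_of_inTri {ε : ℝ} {u v w z : ℂ} (h : 0 < D ε u v w)
    (hz : InTri ε u v w z) : z ∈ convexHull ℝ ({u, v, w} : Set ℂ) := by
  have hu : u ∈ convexHull ℝ ({u, v, w} : Set ℂ) := subset_convexHull ℝ _ (by simp)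
  have hv : v ∈ convexHull ℝ ({u, v, w} : Set ℂ) := subset_convexHull ℝ _ (by simp)
  have hw : w ∈ convexHull ℝ ({u, v, w} : Set ℂ) := subset_convexHull ℝ _ (by simp)
  have hs := D_sum ε u v w z
  have key := (convex_convexHull ℝ ({u, v, w} : Set ℂ)).sum_mem (t := Finset.univ)
    (w := ![D ε v w z / D ε u v w, D ε w u z / D ε u v w, D ε u v z / D ε u v w])
    (z := ![u, v, w]) (by
      intro i _
      fin_cases i
      · exact div_nonneg hz.2.1 h.le
      · exact div_nonneg hz.2.2 h.le
      · exact div_nonneg hz.1 h.le) (by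
      simp only [Fin.sum_univ_three, Matrix.cons_val_zero, Matrix.cons_val_one, Matrix.cons_val]
      field_simp
      linarith) (by
      intro i _
      fin_cases i
      · exact hu
      · exact hv
      · exact hw)
  convert key using 1
  simp only [Fin.sum_univ_three, Matrix.cons_val_zero, Matrix.cons_val_one, Matrix.cons_val]
  apply Complex.ext
  · simp only [Complex.add_re, Complex.real_smul, Complex.mul_re, Complex.ofReal_re,
      Complex.ofReal_im, zero_mul, sub_zero]
    have := re_bary ε u v w z
    field_simp
    linarith
  · simp only [Complex.add_im, Complex.real_smul, Complex.mul_im, Complex.ofReal_re,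
      Complex.ofReal_im, zero_mul, add_zero]
    have := im_bary ε u v w z
    field_simp
    linarith

/-! ### Points of segments -/

theorem exists_of_mem_openSegment {a b z : ℂ} (h : z ∈ openSegment ℝ a b) :
    ∃ t : ℝ, 0 < t ∧ t < 1 ∧ z.re = a.re + t * (b.re - a.re) ∧ z.im = a.im + t * (b.im - a.im) := by
  obtain ⟨x, y, hx, hy, hxy, rfl⟩ := h
  refine ⟨y, hy, by linarith, ?_, ?_⟩
  · simp; rw [← eq_sub_iff_add_eq] at hxy; rw [hxy]; ring
  · simp; rw [← eq_sub_iff_add_eq] at hxy; rw [hxy]; ring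

theorem mem_openSegment_of {a b z : ℂ} {t : ℝ} (h0 : 0 < t) (h1 : t < 1)
    (hre : z.re = a.re + t * (b.re - a.re)) (him : z.im = a.im + t * (b.im - a.im)) :
    z ∈ openSegment ℝ a b := by
  refine ⟨1 - t, t, by linarith, h0, by ring, Complex.ext ?_ ?_⟩
  · simp; rw [hre]; ring
  · simp; rw [him]; ring

theorem D_interp {a b z : ℂ} {t : ℝ} (hre : z.re = a.re + t * (b.re - a.re))
    (him : z.im = a.im + t * (b.im - a.im)) (ε : ℝ) (u v : ℂ) :
    D ε u v z = (1 - t) * D ε u v a + t * D ε u v b := by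
  simp only [D]; rw [hre, him]; ring

/-- The point of the line `a b` with parameter `t`. -/
def lineAt (a b : ℂ) (t : ℝ) : ℂ := ⟨a.re + t * (b.re - a.re), a.im + t * (b.im - a.im)⟩

theorem D_lineAt (ε : ℝ) (u v a b : ℂ) (t : ℝ) :
    D ε u v (lineAt a b t) = (1 - t) * D ε u v a + t * D ε u v b :=
  D_interp rfl rfl ε u v

theorem lineAt_mem {a b : ℂ} {t : ℝ} (h0 : 0 < t) (h1 : t < 1) :
    lineAt a b t ∈ openSegment ℝ a b := mem_openSegment_of h0 h1 rfl rfl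

theorem lineAt_one (a b : ℂ) : lineAt a b 1 = b := by
  apply Complex.ext <;> simp [lineAt]

theorem ne_of_mem_openSegment_left {a b z : ℂ} (hab : a ≠ b) (h : z ∈ openSegment ℝ a b) :
    z ≠ a := by
  rintro rfl
  exact hab (left_mem_openSegment_iff.1 h)

theorem ne_of_mem_openSegment_right {a b z : ℂ} (hab : a ≠ b) (h : z ∈ openSegment ℝ a b) :
    z ≠ b := by
  rintro rfl
  exact hab (right_mem_openSegment_iff.1 h)

theorem D_eq_zero_of_mem_openSegment {a b z : ℂ} (ε : ℝ) (h : z ∈ openSegment ℝ a b) :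
    D ε a b z = 0 := by
  obtain ⟨t, -, -, hre, him⟩ := exists_of_mem_openSegment h
  rw [D_interp hre him, D_left, D_right]; ring

/-- A point on the line `u v`, inside a triangle `u v w`, off `u`. -/
theorem eq_or_mem_openSegment {ε : ℝ} {u v w y : ℂ} (h : 0 < D ε u v w) (h0 : D ε u v y = 0)
    (h1 : 0 < D ε w u y) (h2 : 0 ≤ D ε v w y) :
    (y = v ∧ D ε v w y = 0) ∨ (y ∈ openSegment ℝ u v ∧ 0 < D ε v w y) := by
  have hs := D_sum ε u v w y
  have hr := re_bary ε u v w y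
  have hi := im_bary ε u v w y
  rw [h0] at hs hr hi
  rcases h2.eq_or_lt with h2 | h2
  · left
    rw [← h2] at hs hr hi
    have e : D ε w u y = D ε u v w := by linarith
    rw [e] at hr hi
    refine ⟨Complex.ext ?_ ?_, h2.symm⟩
    · have : D ε u v w * y.re = D ε u v w * v.re := by linarith
      exact mul_left_cancel₀ h.ne' this
    · have : D ε u v w * y.im = D ε u v w * v.im := by linarith
      exact mul_left_cancel₀ h.ne' this
  · right
    refine ⟨mem_openSegment_of (t := D ε w u y / D ε u v w) (div_pos h1 h) ?_ ?_ ?_, h2⟩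
    · rw [div_lt_one h]; linarith
    · have e : D ε v w y = D ε u v w - D ε w u y := by linarith
      rw [e] at hr
      field_simp
      linarith
    · have e : D ε v w y = D ε u v w - D ε w u y := by linarith
      rw [e] at hi
      field_simp
      linarith

theorem eq_or_mem_openSegment' {ε : ℝ} {u v w y : ℂ} (h : 0 < D ε u v w) (h0 : D ε v w y = 0)
    (h1 : 0 < D ε w u y) (h2 : 0 ≤ D ε u v y) :
    (y = v ∧ D ε u v y = 0) ∨ (y ∈ openSegment ℝ v w ∧ 0 < D ε u v y) := by
  have hs := D_sum ε u v w y
  have key := eq_or_mem_openSegment (ε := -ε) (u := w) (v := v) (w := u) (y := y)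
    (by rw [D_neg, D_swap, neg_neg, ← D_rot]; rwa [← D_rot, ← D_rot] at *)
    (by rw [D_neg, D_swap, neg_neg]; exact h0) (by rw [D_neg, D_swap, neg_neg]; exact h1)
    (by rw [D_neg, D_swap, neg_neg]; exact h2)
  rw [D_neg, D_swap, neg_neg] at key
  rwa [openSegment_symm] at key

/-- Two segments whose end points are separated by each other's lines cross. -/
theorem exists_crossing {ε : ℝ} {a b c d : ℂ} (ha : 0 < D ε c d a) (hb : D ε c d b < 0)
    (hc : 0 < D ε a b d) (hd : D ε a b c < 0) :
    ∃ x, x ∈ openSegment ℝ a b ∧ x ∈ openSegment ℝ c d := by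
  have hs : D ε c d a - D ε c d b = D ε a b d - D ε a b c := by simp only [D]; ring
  have hp : 0 < D ε c d a - D ε c d b := by linarith
  refine ⟨lineAt a b (D ε c d a / (D ε c d a - D ε c d b)), lineAt_mem (div_pos ha hp) ?_,
    mem_openSegment_of (t := - D ε a b c / (D ε c d a - D ε c d b)) (div_pos (by linarith) hp)
      ?_ ?_ ?_⟩
  · rw [div_lt_one hp]; linarith
  · rw [div_lt_one hp]; linarith
  · simp only [lineAt]
    have hp' := hp.ne'
    field_simp
    simp only [D]; ring
  · simp only [lineAt]
    have hp' := hp.ne'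
    field_simp
    simp only [D]; ring

end RingPhase

namespace RingPhase

/-! ### Cells -/

theorem near_iff {s : ℝ} {u v : ℂ} : Near s u v ↔
    |⌊v.re / s⌋ - ⌊u.re / s⌋| ≤ 1 ∧ |⌊v.im / s⌋ - ⌊u.im / s⌋| ≤ 1 := Iff.rfl

theorem Near.symm {s : ℝ} {u v : ℂ} (h : Near s u v) : Near s v u := by
  rw [near_iff] at *
  rwa [abs_sub_comm, abs_sub_comm ⌊u.im / s⌋]

theorem near_refl (s : ℝ) (u : ℂ) : Near s u u := by
  rw [near_iff]; simp

theorem convex_setOf_le_floor_re (s : ℝ) (n : ℤ) : Convex ℝ {z : ℂ | n ≤ ⌊z.re / s⌋} := by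
  have : {z : ℂ | n ≤ ⌊z.re / s⌋} = {z : ℂ | (n : ℝ) ≤ z.re / s} := by
    ext z; simp [Int.le_floor]
  rw [this]
  intro x hx y hy a b ha hb hab
  simp only [Set.mem_ofPred_eq, Complex.add_re, Complex.real_smul, Complex.mul_re,
    Complex.ofReal_re, Complex.ofReal_im, zero_mul, sub_zero] at *
  have : (a * x.re + b * y.re) / s = a * (x.re / s) + b * (y.re / s) := by ring
  rw [this]
  have e : (n : ℝ) = a * n + b * n := by rw [← add_mul, hab, one_mul]
  rw [e]
  gcongr

theorem convex_setOf_floor_re_le (s : ℝ) (n : ℤ) : Convex ℝ {z : ℂ | ⌊z.re / s⌋ ≤ n} := by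
  have : {z : ℂ | ⌊z.re / s⌋ ≤ n} = {z : ℂ | z.re / s < (n : ℝ) + 1} := by
    ext z
    simp only [Set.mem_ofPred_eq]
    rw [← Int.lt_add_one_iff, Int.floor_lt]
    push_cast; rfl
  rw [this]
  intro x hx y hy a b ha hb hab
  simp only [Set.mem_ofPred_eq, Complex.add_re, Complex.real_smul, Complex.mul_re,
    Complex.ofReal_re, Complex.ofReal_im, zero_mul, sub_zero] at *
  have : (a * x.re + b * y.re) / s = a * (x.re / s) + b * (y.re / s) := by ring
  rw [this]
  have e : (n : ℝ) + 1 = a * (n + 1) + b * (n + 1) := by rw [← add_mul, hab, one_mul]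
  rw [e]
  rcases ha.eq_or_lt with rfl | ha
  · have : b = 1 := by linarith
    subst this; linarith
  · nlinarith [mul_lt_mul_of_pos_left hx ha, mul_le_mul_of_nonneg_left hy.le hb]

theorem convex_setOf_le_floor_im (s : ℝ) (n : ℤ) : Convex ℝ {z : ℂ | n ≤ ⌊z.im / s⌋} := by
  have : {z : ℂ | n ≤ ⌊z.im / s⌋} = {z : ℂ | (n : ℝ) ≤ z.im / s} := by
    ext z; simp [Int.le_floor]
  rw [this]
  intro x hx y hy a b ha hb hab
  simp only [Set.mem_ofPred_eq, Complex.add_im, Complex.real_smul, Complex.mul_im,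
    Complex.ofReal_re, Complex.ofReal_im, zero_mul, add_zero] at *
  have : (a * x.im + b * y.im) / s = a * (x.im / s) + b * (y.im / s) := by ring
  rw [this]
  have e : (n : ℝ) = a * n + b * n := by rw [← add_mul, hab, one_mul]
  rw [e]
  gcongr

theorem convex_setOf_floor_im_le (s : ℝ) (n : ℤ) : Convex ℝ {z : ℂ | ⌊z.im / s⌋ ≤ n} := by
  have : {z : ℂ | ⌊z.im / s⌋ ≤ n} = {z : ℂ | z.im / s < (n : ℝ) + 1} := by
    ext z
    simp only [Set.mem_ofPred_eq]
    rw [← Int.lt_add_one_iff, Int.floor_lt]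
    push_cast; rfl
  rw [this]
  intro x hx y hy a b ha hb hab
  simp only [Set.mem_ofPred_eq, Complex.add_im, Complex.real_smul, Complex.mul_im,
    Complex.ofReal_re, Complex.ofReal_im, zero_mul, add_zero] at *
  have : (a * x.im + b * y.im) / s = a * (x.im / s) + b * (y.im / s) := by ring
  rw [this]
  have e : (n : ℝ) + 1 = a * (n + 1) + b * (n + 1) := by rw [← add_mul, hab, one_mul]
  rw [e]
  rcases ha.eq_or_lt with rfl | ha
  · have : b = 1 := by linarith
    subst this; linarith
  · nlinarith [mul_lt_mul_of_pos_left hx ha, mul_le_mul_of_nonneg_left hy.le hb]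

theorem convex_near (s : ℝ) (u : ℂ) : Convex ℝ {z : ℂ | Near s u z} := by
  have : {z : ℂ | Near s u z} =
      ({z : ℂ | ⌊u.re / s⌋ - 1 ≤ ⌊z.re / s⌋} ∩ {z : ℂ | ⌊z.re / s⌋ ≤ ⌊u.re / s⌋ + 1}) ∩
      ({z : ℂ | ⌊u.im / s⌋ - 1 ≤ ⌊z.im / s⌋} ∩ {z : ℂ | ⌊z.im / s⌋ ≤ ⌊u.im / s⌋ + 1}) := by
    ext z
    simp only [Set.mem_ofPred_eq, near_iff, Set.mem_inter_iff, abs_le]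
    constructor
    · rintro ⟨⟨h1, h2⟩, h3, h4⟩; refine ⟨⟨?_, ?_⟩, ?_, ?_⟩ <;> linarith
    · rintro ⟨⟨h1, h2⟩, h3, h4⟩; refine ⟨⟨?_, ?_⟩, ?_, ?_⟩ <;> linarith
  rw [this]
  exact ((convex_setOf_le_floor_re s _).inter (convex_setOf_floor_re_le s _)).inter
    ((convex_setOf_le_floor_im s _).inter (convex_setOf_floor_im_le s _))

theorem convexHull_triple_subset {a b c : ℂ} {S : Set ℂ} (hS : Convex ℝ S) (ha : a ∈ S)
    (hb : b ∈ S) (hc : c ∈ S) : convexHull ℝ ({a, b, c} : Set ℂ) ⊆ S := by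
  apply convexHull_min _ hS
  rintro x (rfl | rfl | rfl) <;> assumption

theorem near_of_mem_hull {s : ℝ} {u a b c z : ℂ} (ha : Near s u a) (hb : Near s u b)
    (hc : Near s u c) (hz : z ∈ convexHull ℝ ({a, b, c} : Set ℂ)) : Near s u z :=
  convexHull_triple_subset (convex_near s u) ha hb hc hz

theorem floor_bounds_of_mem_hull (s : ℝ) {a b c z : ℂ}
    (hz : z ∈ convexHull ℝ ({a, b, c} : Set ℂ)) :
    (min (min ⌊a.re / s⌋ ⌊b.re / s⌋) ⌊c.re / s⌋ ≤ ⌊z.re / s⌋ ∧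
      ⌊z.re / s⌋ ≤ max (max ⌊a.re / s⌋ ⌊b.re / s⌋) ⌊c.re / s⌋) ∧
    (min (min ⌊a.im / s⌋ ⌊b.im / s⌋) ⌊c.im / s⌋ ≤ ⌊z.im / s⌋ ∧
      ⌊z.im / s⌋ ≤ max (max ⌊a.im / s⌋ ⌊b.im / s⌋) ⌊c.im / s⌋) := by
  refine ⟨⟨convexHull_triple_subset (convex_setOf_le_floor_re s _) ?_ ?_ ?_ hz,
    convexHull_triple_subset (convex_setOf_floor_re_le s _) ?_ ?_ ?_ hz⟩,
    convexHull_triple_subset (convex_setOf_le_floor_im s _) ?_ ?_ ?_ hz,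
    convexHull_triple_subset (convex_setOf_floor_im_le s _) ?_ ?_ ?_ hz⟩ <;>
  simp

/-- In each coordinate the hull spans cells between those of `k`, `c`, `e`. The part of this range
within distance one of `k` has at most two consecutive values, since `k` and `e` are within one of
`c`. -/
theorem near_of_near_of_mem_hull {s : ℝ} {k c e u w : ℂ} (hk : Near s c k) (he : Near s c e)
    (hu : u ∈ convexHull ℝ ({k, c, e} : Set ℂ)) (hw : w ∈ convexHull ℝ ({k, c, e} : Set ℂ))
    (hku : Near s k u) (hkw : Near s k w) : Near s u w := by
  have h1 := floor_bounds_of_mem_hull s hu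
  have h2 := floor_bounds_of_mem_hull s hw
  simp only [near_iff, abs_le] at *
  generalize ⌊k.re / s⌋ = k1 at *
  generalize ⌊k.im / s⌋ = k2 at *
  generalize ⌊c.re / s⌋ = c1 at *
  generalize ⌊c.im / s⌋ = c2 at *
  generalize ⌊e.re / s⌋ = e1 at *
  generalize ⌊e.im / s⌋ = e2 at *
  generalize ⌊u.re / s⌋ = u1 at *
  generalize ⌊u.im / s⌋ = u2 at *
  generalize ⌊w.re / s⌋ = w1 at *
  generalize ⌊w.im / s⌋ = w2 at *
  omega

theorem sign_lt_of_mem_hull {a b c z : ℂ} (x y t : ℝ) (ha : x * a.re + y * a.im < t)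
    (hb : x * b.re + y * b.im < t) (hc : x * c.re + y * c.im < t)
    (hz : z ∈ convexHull ℝ ({a, b, c} : Set ℂ)) : x * z.re + y * z.im < t := by
  have hS : Convex ℝ {z : ℂ | x * z.re + y * z.im < t} := by
    refine convex_halfSpace_lt ⟨?_, ?_⟩ t
    · intro u v; simp; ring
    · intro r u; simp; ring
  exact convexHull_triple_subset hS ha hb hc hz

/-- Both `k` and `q` are within one of `c`, so a gap of two puts them at opposite extremes, and only
`e` can have stretched the range to `q`. -/
theorem opposite_of_not_close {c k e q : ℤ} (h1 : -1 ≤ k - c) (h2 : k - c ≤ 1) (h3 : -1 ≤ e - c)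
    (h4 : e - c ≤ 1) (h5 : min (min k c) e ≤ q) (h6 : q ≤ max (max k c) e)
    (h : ¬ (-1 ≤ q - k ∧ q - k ≤ 1)) :
    ∃ x : ℤ, (x = 1 ∨ x = -1) ∧ q = c + x ∧ k = c - x ∧ e = c + x := by
  by_cases hx : q = c + 1
  · exact ⟨1, by omega, by omega, by omega, by omega⟩
  · exact ⟨-1, by omega, by omega, by omega, by omega⟩

/-- A point far from both `k` and `e` is opposite to `k` in one coordinate and to `e` in the other.
It then sits in a corner cell of the block around `c`, and a diagonal line separates it from `k`,
`c` and `e`. -/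
theorem near_or_near_of_mem_hull {s : ℝ} {k c e q : ℂ} (hk : Near s c k)
    (he : Near s c e) (hq : q ∈ convexHull ℝ ({k, c, e} : Set ℂ)) :
    Near s k q ∨ Near s e q := by
  by_contra hcon
  have h1 := floor_bounds_of_mem_hull s hq
  have L : ∀ (x y : ℝ), (x * (k.re / s) + y * (k.im / s) < x * (q.re / s) + y * (q.im / s)) →
      (x * (c.re / s) + y * (c.im / s) < x * (q.re / s) + y * (q.im / s)) →
      (x * (e.re / s) + y * (e.im / s) < x * (q.re / s) + y * (q.im / s)) → False := by
    intro x y hk hc he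
    have := sign_lt_of_mem_hull (x / s) (y / s) (x * (q.re / s) + y * (q.im / s))
      (by convert hk using 1; ring) (by convert hc using 1; ring) (by convert he using 1; ring) hq
    apply this.ne
    ring
  simp only [near_iff, abs_le] at *
  have fl : ∀ x : ℝ, (⌊x⌋ : ℝ) ≤ x ∧ x < ⌊x⌋ + 1 := fun x => ⟨Int.floor_le x, Int.lt_floor_add_one x⟩
  have hk1 := fl (k.re / s)
  have hk2 := fl (k.im / s)
  have hc1 := fl (c.re / s)
  have hc2 := fl (c.im / s)
  have he1 := fl (e.re / s)
  have he2 := fl (e.im / s)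
  have hq1 := fl (q.re / s)
  have hq2 := fl (q.im / s)
  generalize ⌊k.re / s⌋ = k1 at *
  generalize ⌊k.im / s⌋ = k2 at *
  generalize ⌊c.re / s⌋ = c1 at *
  generalize ⌊c.im / s⌋ = c2 at *
  generalize ⌊e.re / s⌋ = e1 at *
  generalize ⌊e.im / s⌋ = e2 at *
  generalize ⌊q.re / s⌋ = q1 at *
  generalize ⌊q.im / s⌋ = q2 at *
  have fin : ∀ x y : ℤ, (x = 1 ∨ x = -1) → (y = 1 ∨ y = -1) → q1 = c1 + x → q2 = c2 + y →
      (k1 = c1 - x ∨ k2 = c2 - y) → (e1 = c1 - x ∨ e2 = c2 - y) →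
      (k1 = c1 + x ∨ k2 = c2 + y) → (e1 = c1 + x ∨ e2 = c2 + y) → False := by
    rintro x y hx hy rfl rfl hk he hk' he'
    clear h1 hcon
    have hx' : (x : ℝ) = 1 ∨ (x : ℝ) = -1 := by rcases hx with rfl | rfl <;> simp
    have hy' : (y : ℝ) = 1 ∨ (y : ℝ) = -1 := by rcases hy with rfl | rfl <;> simp
    have K : (k1 = c1 - x ∧ k2 = c2 + y) ∨ (k2 = c2 - y ∧ k1 = c1 + x) := by omega
    have E : (e1 = c1 - x ∧ e2 = c2 + y) ∨ (e2 = c2 - y ∧ e1 = c1 + x) := by omega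
    clear hk he hk' he'
    -- The functional pointing to the corner cell `c + (x, y)` is strictly larger at `q`; strictness
    -- comes from the half-open cells, whichever signs `x` and `y` have.
    apply L x y <;>
    rcases hx' with hx | hx <;> rcases hy' with hy | hy <;> rw [hx, hy] <;>
    push_cast [hx, hy] at hq1 hq2 <;>
    first
    | linarith
    | (rcases K with ⟨rfl, rfl⟩ | ⟨rfl, rfl⟩ <;> push_cast [hx, hy] at hk1 hk2 <;> linarith)
    | (rcases E with ⟨rfl, rfl⟩ | ⟨rfl, rfl⟩ <;> push_cast [hx, hy] at he1 he2 <;> linarith)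
  clear L fl hk1 hk2 hc1 hc2 he1 he2 hq1 hq2 hq
  obtain ⟨⟨a1, a2⟩, a3, a4⟩ := h1
  obtain ⟨⟨a5, a6⟩, a7, a8⟩ := hk
  obtain ⟨⟨a9, a10⟩, a11, a12⟩ := he
  rw [not_or] at hcon
  obtain ⟨n1, n2⟩ := hcon
  have F1 := opposite_of_not_close (c := c1) (k := k1) (e := e1) (q := q1) a5 a6 a9 a10 a1 a2
  have F2 := opposite_of_not_close (c := c2) (k := k2) (e := e2) (q := q2) a7 a8 a11 a12 a3 a4
  have G1 := opposite_of_not_close (c := c1) (k := e1) (e := k1) (q := q1) a9 a10 a5 a6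
    (by clear F1 F2; omega) (by clear F1 F2; omega)
  have G2 := opposite_of_not_close (c := c2) (k := e2) (e := k2) (q := q2) a11 a12 a7 a8
    (by clear F1 F2 G1; omega) (by clear F1 F2 G1; omega)
  -- Where `q` is far from `k`, the cell of `e` agrees with that of `q`. So `k` and `e` fail in
  -- different coordinates.
  by_cases b1 : -1 ≤ q1 - k1 ∧ q1 - k1 ≤ 1
  · have b2 : ¬ (-1 ≤ q2 - k2 ∧ q2 - k2 ≤ 1) := fun h => n1 ⟨b1, h⟩
    obtain ⟨y, hy, y1, y2, y3⟩ := F2 b2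
    have b3 : ¬ (-1 ≤ q1 - e1 ∧ q1 - e1 ≤ 1) := fun h => n2 ⟨h, by omega⟩
    obtain ⟨x, hx, x1, x2, x3⟩ := G1 b3
    exact fin x y hx hy x1 y1 (Or.inr y2) (Or.inl x2) (Or.inl x3) (Or.inr y3)
  · obtain ⟨x, hx, x1, x2, x3⟩ := F1 b1
    have b4 : ¬ (-1 ≤ q2 - e2 ∧ q2 - e2 ≤ 1) := fun h => n2 ⟨by omega, h⟩
    obtain ⟨y, hy, y1, y2, y3⟩ := G2 b4
    exact fin x y hx hy x1 y1 (Or.inl x2) (Or.inr y2) (Or.inr y3) (Or.inl x3)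

theorem mem_cellRing_of_near {s : ℝ} {u a v : ℂ} {r : ℕ} (h : cellOf s a ∈ cellRing s u r)
    (hav : Near s a v) : cellOf s v ∈ cellRing s u (r + 1) :=
  Set.mem_biUnion h hav

/-! ### Plane graphs -/

section Graph

variable {P : Finset ℂ}

/-- The open segment from `x` to `y` avoids the drawing. -/
def Free (A : SimpleGraph P) (x y : ℂ) : Prop := ∀ z ∈ openSegment ℝ x y, z ∉ drawing A

/-- An edge that meets the open segment from `x` to `y` in its inside lies on the line `x y`. -/
def Bar (A : SimpleGraph P) (x y : ℂ) : Prop :=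
  ∀ a b : P, A.Adj a b → ∀ z ∈ openSegment ℝ (a : ℂ) b, z ∈ openSegment ℝ x y →
    D 1 x y a = 0 ∧ D 1 x y b = 0

theorem Free.symm {A : SimpleGraph P} {x y : ℂ} (h : Free A x y) : Free A y x := by
  intro z hz; rw [openSegment_symm] at hz; exact h z hz

theorem vertex_mem_drawing (A : SimpleGraph P) (v : P) : (v : ℂ) ∈ drawing A := Or.inl v.2

theorem segment_subset_drawing {A : SimpleGraph P} {a b : P} (h : A.Adj a b) {z : ℂ}
    (hz : z ∈ segment ℝ (a : ℂ) b) : z ∈ drawing A := Or.inr ⟨a, b, h, hz⟩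

theorem openSegment_subset_drawing {A : SimpleGraph P} {a b : P} (h : A.Adj a b) {z : ℂ}
    (hz : z ∈ openSegment ℝ (a : ℂ) b) : z ∈ drawing A :=
  segment_subset_drawing h (openSegment_subset_segment ℝ _ _ hz)

theorem coe_ne_of_adj {A : SimpleGraph P} {a b : P} (h : A.Adj a b) : (a : ℂ) ≠ b :=
  fun e => h.ne (Subtype.ext e)

theorem Free.not_adj {A : SimpleGraph P} {a b : P} (h : Free A (a : ℂ) b) : ¬ A.Adj a b := by
  intro hab
  have := lineAt_mem (a := (a : ℂ)) (b := b) (t := 1 / 2) (by norm_num) (by norm_num)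
  exact h _ this (openSegment_subset_drawing hab this)

theorem vertex_or_edge_of_mem_drawing {A : SimpleGraph P} {z : ℂ} (hz : z ∈ drawing A) :
    (∃ v : P, z = v) ∨ ∃ a b : P, A.Adj a b ∧ z ∈ openSegment ℝ (a : ℂ) b := by
  rcases hz with hz | ⟨a, b, hab, hz⟩
  · exact Or.inl ⟨⟨z, hz⟩, rfl⟩
  · by_cases ha : z = a
    · exact Or.inl ⟨a, ha⟩
    by_cases hb : z = b
    · exact Or.inl ⟨b, hb⟩
    · exact Or.inr ⟨a, b, hab, mem_openSegment_of_ne_left_right (Ne.symm ha) (Ne.symm hb) hz⟩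

theorem Free.bar {A : SimpleGraph P} {x y : ℂ} (h : Free A x y) : Bar A x y :=
  fun _ _ hab z hz hz' => absurd (openSegment_subset_drawing hab hz) (h z hz')

/-- Two edges that cross coincide. -/
theorem edge_eq_of_mem {A : SimpleGraph P} (hA : IsPSLG A) {a b c d : P} (hab : A.Adj a b)
    (hcd : A.Adj c d) {z : ℂ} (h1 : z ∈ openSegment ℝ (a : ℂ) b)
    (h2 : z ∈ openSegment ℝ (c : ℂ) d) : (a = c ∧ b = d) ∨ (a = d ∧ b = c) := by
  by_contra h
  have hne : s(a, b) ≠ s(c, d) := by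
    intro e; rw [Sym2.eq_iff] at e; exact h e
  exact Set.disjoint_left.1 (hA.2 a b c d hab hcd hne) h1 (openSegment_subset_segment ℝ _ _ h2)

theorem bar_of_adj {A : SimpleGraph P} (hA : IsPSLG A) {c d : P} (h : A.Adj c d) :
    Bar A c d := by
  intro a b hab z h1 h2
  rcases edge_eq_of_mem hA hab h h1 h2 with ⟨rfl, rfl⟩ | ⟨rfl, rfl⟩
  · exact ⟨D_left _ _ _, D_right _ _ _⟩
  · exact ⟨D_right _ _ _, D_left _ _ _⟩

theorem collinear_of_D_eq_zero {a b c : ℂ} (h : D 1 a b c = 0) (hab : a ≠ b) :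
    Collinear ℝ ({a, b, c} : Set ℂ) := by
  rw [collinear_iff_of_mem (p₀ := a) (by simp)]
  refine ⟨b - a, ?_⟩
  rintro p (rfl | rfl | rfl)
  · exact ⟨0, by simp⟩
  · exact ⟨1, by simp⟩
  · simp only [D, one_mul] at h
    have hn : (b.re - a.re) ^ 2 + (b.im - a.im) ^ 2 ≠ 0 := by
      intro h0
      apply hab
      have h1 : b.re - a.re = 0 := by nlinarith [sq_nonneg (b.re - a.re), sq_nonneg (b.im - a.im)]
      have h2 : b.im - a.im = 0 := by nlinarith [sq_nonneg (b.re - a.re), sq_nonneg (b.im - a.im)]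
      apply Complex.ext <;> linarith
    obtain ⟨r, hr⟩ : ∃ r : ℝ, r * ((b.re - a.re) ^ 2 + (b.im - a.im) ^ 2) =
        (b.re - a.re) * (p.re - a.re) + (b.im - a.im) * (p.im - a.im) :=
      ⟨_, div_mul_cancel₀ _ hn⟩
    refine ⟨r, Complex.ext ?_ ?_⟩
    · simp
      apply mul_right_cancel₀ hn
      linear_combination (b.im - a.im) * (-h) - (b.re - a.re) * hr
    · simp
      apply mul_right_cancel₀ hn
      linear_combination (b.re - a.re) * h - (b.im - a.im) * hr

theorem D_ne_zero (hP : GeneralPosition P) {ε : ℝ} (hε : ε ≠ 0) {a b c : P} (hab : a ≠ b)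
    (hac : a ≠ c) (hbc : b ≠ c) : D ε (a : ℂ) b c ≠ 0 := by
  intro h
  rw [← D_one_eq_zero hε] at h
  have hne : ∀ {x y : P}, x ≠ y → (x : ℂ) ≠ y := fun h e => h (Subtype.ext e)
  exact hP a a.2 b b.2 c c.2 (hne hab) (hne hac) (hne hbc)
    (collinear_of_D_eq_zero h (hne hab))

/-- An edge on the line through the vertices `a` and `b` joins `a` and `b`. -/
theorem edge_eq_of_collinear (hP : GeneralPosition P) {A : SimpleGraph P} {a b x y : P}
    (hab : a ≠ b) (hxy : A.Adj x y) (hx : D 1 (a : ℂ) b x = 0) (hy : D 1 (a : ℂ) b y = 0) :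
    A.Adj a b := by
  have h1 : x = a ∨ x = b := by
    by_contra h; push Not at h
    exact D_ne_zero hP one_ne_zero hab h.1.symm h.2.symm hx
  have h2 : y = a ∨ y = b := by
    by_contra h; push Not at h
    exact D_ne_zero hP one_ne_zero hab h.1.symm h.2.symm hy
  rcases h1 with rfl | rfl <;> rcases h2 with rfl | rfl
  · exact absurd rfl hxy.ne
  · exact hxy
  · exact hxy.symm
  · exact absurd rfl hxy.ne

/-- In a maximal plane graph, two distinct vertices in neighbouring cells never see each
other. -/
theorem not_near_of_free {s : ℝ} {A : SimpleGraph P} (hA : IsMaximalPSLG s A) {u v : P}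
    (huv : u ≠ v) (h : Free A (u : ℂ) v) : ¬ Near s (u : ℂ) v := by
  intro hn
  let B : SimpleGraph P := A ⊔ SimpleGraph.edge u v
  have hB : ∀ {a b : P}, B.Adj a b → A.Adj a b ∨ (a = u ∧ b = v) ∨ (a = v ∧ b = u) := by
    intro a b hab
    rcases hab with hab | hab
    · exact Or.inl hab
    · rw [SimpleGraph.edge_adj] at hab
      right; tauto
  have hPS := hA.1.1
  have hvert : ∀ x : P, (x : ℂ) ∉ openSegment ℝ (u : ℂ) v := fun x hx =>
    h _ hx (vertex_mem_drawing A x)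
  have hold : ∀ {a b : P}, A.Adj a b → Disjoint (openSegment ℝ (a : ℂ) b) (segment ℝ (u : ℂ) v) := by
    intro a b hab
    rw [Set.disjoint_left]
    intro z hz hz'
    by_cases h1 : z = u
    · subst h1; exact hPS.1 a b u hab hz
    by_cases h2 : z = v
    · subst h2; exact hPS.1 a b v hab hz
    exact h z (mem_openSegment_of_ne_left_right (Ne.symm h1) (Ne.symm h2) hz')
      (openSegment_subset_drawing hab hz)
  have hnew : ∀ {a b : P}, A.Adj a b → Disjoint (openSegment ℝ (u : ℂ) v) (segment ℝ (a : ℂ) b) := by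
    intro a b hab
    rw [Set.disjoint_left]
    intro z hz hz'
    exact h z hz (segment_subset_drawing hab hz')
  -- The graph with the edge `u v` added is still admissible, so maximality forces that edge into
  -- `A`, although the open segment is free.
  have key : B ≤ A := by
    apply hA.2 _ le_sup_left
    refine ⟨⟨?_, ?_⟩, ?_⟩
    · intro a b x hab
      rcases hB hab with h | ⟨rfl, rfl⟩ | ⟨rfl, rfl⟩
      · exact hPS.1 a b x h
      · exact hvert x
      · rw [openSegment_symm]; exact hvert x
    · intro a b c d hab hcd hne
      rcases hB hab with h1 | ⟨rfl, rfl⟩ | ⟨rfl, rfl⟩ <;>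
      rcases hB hcd with h2 | ⟨rfl, rfl⟩ | ⟨rfl, rfl⟩
      · exact hPS.2 a b c d h1 h2 hne
      · exact hold h1
      · rw [segment_symm]; exact hold h1
      · exact hnew h2
      · exact absurd rfl hne
      · exact absurd Sym2.eq_swap hne
      · rw [openSegment_symm]; exact hnew h2
      · exact absurd Sym2.eq_swap hne
      · exact absurd rfl hne
    · refine sup_le hA.1.2 ?_
      rw [SimpleGraph.edge_le_iff]
      right
      exact ⟨huv, hn⟩
  refine h.not_adj (key ?_)
  right
  rw [SimpleGraph.edge_adj]
  exact ⟨Or.inl ⟨rfl, rfl⟩, huv⟩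

theorem near_of_adj {s : ℝ} {A : SimpleGraph P} (hA : IsMaximalPSLG s A) {u v : P}
    (h : A.Adj u v) : Near s (u : ℂ) v := (hA.1.2 h).2

/-! ### Faces -/

theorem IsFace.subset_compl {A : SimpleGraph P} {f : Set ℂ} (hf : IsFace A f) :
    f ⊆ (drawing A)ᶜ := by
  obtain ⟨z, -, rfl⟩ := hf
  exact connectedComponentIn_subset _ _

theorem IsFace.free {A : SimpleGraph P} {f : Set ℂ} (hf : IsFace A f) {x y : ℂ}
    (h : openSegment ℝ x y ⊆ f) : Free A x y := fun _ hz => hf.subset_compl (h hz)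

theorem IsFace.subset_of_convex {A : SimpleGraph P} {f S : Set ℂ} (hf : IsFace A f)
    (hS : Convex ℝ S) (hd : ∀ z ∈ S, z ∉ drawing A) {x : ℂ} (hx : x ∈ S) (hxf : x ∈ f) :
    S ⊆ f := by
  obtain ⟨z, hz, rfl⟩ := hf
  rw [connectedComponentIn_eq hxf]
  exact hS.isPreconnected.subset_connectedComponentIn hx hd

/-- If the inside of the triangle `u v w` avoids the drawing, the face passes from one side
to another. -/
theorem IsFace.side_subset {A : SimpleGraph P} {f : Set ℂ} (hf : IsFace A f) {ε : ℝ}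
    {u v w : ℂ} (h : 0 < D ε u v w)
    (hin : ∀ z, 0 < D ε u v z → 0 < D ε v w z → 0 < D ε w u z → z ∉ drawing A)
    (huv : openSegment ℝ u v ⊆ f) (hw : Free A w u) : openSegment ℝ w u ⊆ f := by
  -- The segment joining the midpoints of two sides runs through the inside of the triangle and
  -- links the two open sides.
  set m := lineAt u v (1 / 2) with hm
  set m' := lineAt w u (1 / 2) with hm'
  have mm : m ∈ openSegment ℝ u v := lineAt_mem (by norm_num) (by norm_num)
  have mm' : m' ∈ openSegment ℝ w u := lineAt_mem (by norm_num) (by norm_num)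
  have h1 : m' ∈ f := by
    refine hf.subset_of_convex (convex_segment m m') ?_ (left_mem_segment ℝ m m') (huv mm)
      (right_mem_segment ℝ m m')
    intro z hz
    by_cases e1 : z = m
    · rw [e1]; exact hf.subset_compl (huv mm)
    by_cases e2 : z = m'
    · rw [e2]; exact hw m' mm'
    obtain ⟨t, t0, t1, hre, him⟩ := exists_of_mem_openSegment
      (mem_openSegment_of_ne_left_right (Ne.symm e1) (Ne.symm e2) hz)
    have hv : 0 < D ε v w u := by rwa [← D_rot]
    have hw : 0 < D ε w u v := by rwa [D_rot]
    apply hin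
    · rw [D_interp hre him, hm, hm', D_lineAt, D_lineAt, D_left, D_right]
      nlinarith [mul_pos t0 h]
    · rw [D_interp hre him, hm, hm', D_lineAt, D_lineAt, D_left, D_right]
      nlinarith [mul_pos t0 hv, mul_pos (sub_pos.2 t1) hv]
    · rw [D_interp hre him, hm, hm', D_lineAt, D_lineAt, D_left, D_right]
      nlinarith [mul_pos (sub_pos.2 t1) hw]
  exact hf.subset_of_convex (convex_openSegment w u) hw mm' h1

end Graph

end RingPhase

namespace RingPhase

/-! ### Rotational sweeps and their first vertex -/

section Fan

variable {P : Finset ℂ}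

/-- Where a segment that leaves a wedge crosses its boundary. -/
theorem exists_exit {fz gz fa ga : ℝ} (hf : 0 < fz) (hg : 0 < gz) (h : fa < 0 ∨ ga < 0) :
    ∃ t : ℝ, 0 < t ∧ t < 1 ∧
      (((1 - t) * fz + t * fa = 0 ∧ 0 ≤ (1 - t) * gz + t * ga) ∨
        ((1 - t) * gz + t * ga = 0 ∧ 0 ≤ (1 - t) * fz + t * fa)) := by
  wlog hfg : fa * gz ≤ ga * fz generalizing fz gz fa ga
  · obtain ⟨t, h0, h1, h2⟩ := this hg hf h.symm (le_of_not_ge hfg)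
    exact ⟨t, h0, h1, h2.symm⟩
  have hfa : fa < 0 := by
    rcases h with h | h
    · exact h
    · by_contra hc
      push Not at hc
      nlinarith [mul_nonneg hc hg.le, mul_pos (neg_pos.2 h) hf]
  have hd : 0 < fz - fa := by linarith
  refine ⟨fz / (fz - fa), div_pos hf hd, by rw [div_lt_one hd]; linarith, Or.inl ⟨?_, ?_⟩⟩
  · field_simp; ring
  · have : (1 - fz / (fz - fa)) * gz + fz / (fz - fa) * ga = (ga * fz - fa * gz) / (fz - fa) := by
      field_simp; ring
    rw [this]
    exact div_nonneg (by linarith) hd.le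

theorem openSegment_trans {a b z y : ℂ} (hz : z ∈ openSegment ℝ a b) {t : ℝ} (h0 : 0 < t)
    (h1 : t < 1) (hy : y = lineAt z a t) : y ∈ openSegment ℝ a b := by
  obtain ⟨r, r0, r1, hre, him⟩ := exists_of_mem_openSegment hz
  refine mem_openSegment_of (t := (1 - t) * r) (mul_pos (by linarith) r0) (by nlinarith) ?_ ?_
  · rw [hy]; simp only [lineAt]; rw [hre]; ring
  · rw [hy]; simp only [lineAt]; rw [him]; ring

/-- An edge that enters the triangle `u v w`, cannot leave it through `u v` or `v w` and does
not end in it runs along the side `w u`. -/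
theorem tri_cross {A : SimpleGraph P} {ε : ℝ} {u v w z : ℂ} (h : 0 < D ε u v w)
    (huv : Bar A u v) (hvw : Bar A v w)
    (hv : ∀ a b : P, A.Adj a b → v ∈ openSegment ℝ (a : ℂ) b →
      (D 1 u v a = 0 ∧ D 1 u v b = 0) ∨ (D 1 v w a = 0 ∧ D 1 v w b = 0))
    (h1 : 0 < D ε u v z) (h2 : 0 < D ε v w z) (h3 : 0 ≤ D ε w u z)
    (hE : ∀ a b : P, A.Adj a b → z ∈ openSegment ℝ (a : ℂ) b → InTri ε u v w a →
      0 < D ε w u a → False)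
    {a b : P} (hab : A.Adj a b) (hz : z ∈ openSegment ℝ (a : ℂ) b) :
    D ε w u a = 0 ∧ D ε w u b = 0 := by
  -- Let `a` be the end lying farther to the inner side of `w u`. If it is not strictly on that
  -- side, the edge lies on the line `w u`.
  wlog hle : D ε w u b ≤ D ε w u a generalizing a b
  · rw [openSegment_symm] at hz
    exact (this hab.symm hz (le_of_not_ge hle)).symm
  have hε := ne_zero_of_D_pos h
  obtain ⟨r, r0, r1, hre, him⟩ := exists_of_mem_openSegment hz
  have ez : ∀ p q, D ε p q z = (1 - r) * D ε p q a + r * D ε p q b := D_interp hre him ε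
  rcases le_or_gt (D ε w u a) 0 with ha | ha
  · have := ez w u
    have e1 : D ε w u a = 0 := by nlinarith
    rw [e1] at this
    refine ⟨e1, ?_⟩
    have : 0 ≤ r * D ε w u b := by linarith
    have := nonneg_of_mul_nonneg_right this r0
    linarith
  · exfalso
    have hout : D ε u v a < 0 ∨ D ε v w a < 0 := by
      by_contra hc
      push Not at hc
      exact hE a b hab hz ⟨hc.1, hc.2, ha.le⟩ ha
    have notuv : ¬ (D 1 u v a = 0 ∧ D 1 u v b = 0) := by
      rintro ⟨e1, e2⟩
      rw [D_one_eq_zero hε] at e1 e2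
      have := ez u v
      rw [e1, e2] at this
      linarith
    have notvw : ¬ (D 1 v w a = 0 ∧ D 1 v w b = 0) := by
      rintro ⟨e1, e2⟩
      rw [D_one_eq_zero hε] at e1 e2
      have := ez v w
      rw [e1, e2] at this
      linarith
    have notv : v ∉ openSegment ℝ (a : ℂ) b := by
      intro hc
      rcases hv a b hab hc with hc | hc
      · exact notuv hc
      · exact notvw hc
    -- On the way from `z` to the outside end `a` the edge stays strictly on the inner side of `w
    -- u`, so it leaves through `u v`, through `v w` or at `v`, all of which are barred.
    obtain ⟨t, t0, t1, ht⟩ := exists_exit h1 h2 hout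
    have hy := openSegment_trans hz t0 t1 rfl
    have hy3 : 0 < D ε w u (lineAt z a t) := by
      rw [D_lineAt]
      nlinarith [mul_pos t0 ha, mul_nonneg (sub_nonneg.2 t1.le) h3]
    rw [← D_lineAt, ← D_lineAt] at ht
    rcases ht with ⟨e1, e2⟩ | ⟨e1, e2⟩
    · rcases eq_or_mem_openSegment h e1 hy3 e2 with ⟨e, -⟩ | ⟨e, -⟩
      · rw [e] at hy; exact notv hy
      · exact notuv (huv a b hab _ hy e)
    · rcases eq_or_mem_openSegment' h e1 hy3 e2 with ⟨e, -⟩ | ⟨e, -⟩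
      · rw [e] at hy; exact notv hy
      · exact notvw (hvw a b hab _ hy e)

/-- `w` is the first vertex met when a ray at the vertex `k` sweeps the triangle `k x y`
beginning at `x`. -/
structure IsFan (A : SimpleGraph P) (ε : ℝ) (k : P) (x : ℂ) (y : P) (w : P) : Prop where
  pos : 0 < D ε k x w
  le_end : 0 ≤ D ε y k w
  inside : 0 ≤ D ε x y w
  min : ∀ v : P, InTri ε k x y v → 0 < D ε k x v → 0 ≤ D ε k w v
  adj_or_free : A.Adj k w ∨ Free A (k : ℂ) w
  no_edge : ∀ b : P, A.Adj k b → 0 < D ε k x b → 0 < D ε k b w → False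
  interior : ∀ z, 0 < D ε k x z → 0 < D ε x w z → 0 < D ε w k z → z ∉ drawing A
  free : 0 < D ε x y w → Free A (w : ℂ) x

theorem IsFan.inTri {A : SimpleGraph P} {ε : ℝ} {k y w : P} {x : ℂ} (h : IsFan A ε k x y w) :
    InTri ε k x y w := ⟨h.pos.le, h.inside, h.le_end⟩

/-- Such a vertex would be `x` itself or would block the free segment `k x`; this excludes vertices
in the starting direction of a sweep. -/
theorem Free.eq_of_collinear {A : SimpleGraph P} {k x y : ℂ} {ε : ℝ} (hkx : Free A k x)
    (h : 0 < D ε k x y) (hxP : ∀ v : P, (v : ℂ) ≠ x) {v : P} (h0 : D ε k x v = 0)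
    (h1 : 0 < D ε y k v) (h2 : 0 ≤ D ε x y v) : False := by
  rcases eq_or_mem_openSegment h h0 h1 h2 with ⟨e, -⟩ | ⟨e, -⟩
  · exact hxP v e
  · exact hkx _ e (vertex_mem_drawing A v)

/-- The first vertex of the sweep exists. -/
theorem exists_first {ε : ℝ} {k y : P} {x : ℂ} (h : 0 < D ε k x y) :
    ∃ w : P, 0 < D ε k x w ∧ 0 ≤ D ε y k w ∧ 0 ≤ D ε x y w ∧
      ∀ v : P, InTri ε k x y v → 0 < D ε k x v → 0 ≤ D ε k w v := by
  classical
  let S : Finset P := Finset.univ.filter fun v => InTri ε k x y v ∧ 0 < D ε k x v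
  have hne : S.Nonempty := ⟨y, by
    simp only [S, Finset.mem_filter, Finset.mem_univ, true_and]
    exact ⟨⟨h.le, (D_right _ _ _).ge, (D_left _ _ _).ge⟩, h⟩⟩
  -- The quotient decreases as the direction turns from `x` to `y`, so its maximum is the first
  -- direction met; the identity `pl` below turns the comparison into a sign.
  obtain ⟨w, hw, hmax⟩ := S.exists_max_image (fun v => D ε y k v / D ε k x v) hne
  simp only [S, Finset.mem_filter, Finset.mem_univ, true_and] at hw hmax
  refine ⟨w, hw.2, hw.1.2.2, hw.1.2.1, fun v hv hv' => ?_⟩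
  have := hmax v ⟨hv, hv'⟩
  rw [div_le_div_iff₀ hv' hw.2] at this
  have pl : D ε k x y * D ε k w v = D ε k x v * D ε y k w - D ε k x w * D ε y k v := by
    simp only [D]; ring
  have : 0 ≤ D ε k x y * D ε k w v := by rw [pl]; linarith
  exact nonneg_of_mul_nonneg_right this h

/-- Two points of a ray that both lie beyond a common point. -/
theorem mem_trichotomy {w x b z : ℂ} (hx : z ∈ openSegment ℝ w x) (hb : z ∈ openSegment ℝ w b) :
    b ∈ openSegment ℝ w x ∨ b = x ∨ x ∈ openSegment ℝ w b := by
  obtain ⟨r, r0, r1, hre, him⟩ := exists_of_mem_openSegment hx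
  obtain ⟨r', r0', r1', hre', him'⟩ := exists_of_mem_openSegment hb
  have d1 : r * (x.re - w.re) = r' * (b.re - w.re) := by linarith
  have d2 : r * (x.im - w.im) = r' * (b.im - w.im) := by linarith
  rcases lt_trichotomy r r' with hlt | heq | hgt
  · left
    refine mem_openSegment_of (t := r / r') (div_pos r0 r0') ((div_lt_one r0').2 hlt) ?_ ?_
    · field_simp; linarith
    · field_simp; linarith
  · subst heq
    right; left
    apply Complex.ext
    · have := mul_left_cancel₀ r0.ne' d1; linarith
    · have := mul_left_cancel₀ r0.ne' d2; linarith
  · right; right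
    refine mem_openSegment_of (t := r' / r) (div_pos r0' r0) ((div_lt_one r0).2 hgt) ?_ ?_
    · field_simp; linarith
    · field_simp; linarith

/-- No vertex comes before `w`, so an edge meeting `w x` from inside the swept triangle would have
to cross `k w` or `k x` or start at `k`. Hence it runs along the line `w x`, and general position
makes `w` one of its ends. Its other end would lie between `w` and `x`, at `x`, or beyond `x`; in
the last case the edge passes through `x` and thus follows `x y`, which misses `w`. -/
theorem fan_free (hP : GeneralPosition P) {A : SimpleGraph P} (hA : IsPSLG A) {ε : ℝ} {k y w : P}
    {x : ℂ} (h : 0 < D ε k x y) (hkx : Free A (k : ℂ) x)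
    (hxP : ∀ v : P, (v : ℂ) ≠ x)
    (hx : ∀ a b : P, A.Adj a b → x ∈ openSegment ℝ (a : ℂ) b → D 1 x y a = 0 ∧ D 1 x y b = 0)
    (hw1 : 0 < D ε k x w) (hw2 : 0 ≤ D ε y k w) (hw3 : 0 ≤ D ε x y w)
    (hmin : ∀ v : P, InTri ε k x y v → 0 < D ε k x v → 0 ≤ D ε k w v)
    (hadj : A.Adj k w ∨ Free A (k : ℂ) w)
    (hno : ∀ b : P, A.Adj k b → 0 < D ε k x b → 0 < D ε k b w → False) :
    0 < D ε x y w → Free A (w : ℂ) x := by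
  have hε := ne_zero_of_D_pos h
  have hkw : k ≠ w := by rintro rfl; rw [D_left] at hw1; exact lt_irrefl _ hw1
  have hyx : 0 < D ε x y k := by rwa [← D_rot]
  have hyk : 0 < D ε y k x := by rwa [← D_rot, ← D_rot]
  intro hpos z hz hzd
  obtain ⟨r, r0, r1, hre, him⟩ := exists_of_mem_openSegment hz
  have hwx : 0 < D ε w k x := by rwa [D_rot]
  have hxw' : 0 < D ε x w k := by rwa [← D_rot]
  have z1 : 0 < D ε k x z := by
    rw [D_interp hre him, D_right]; nlinarith [mul_pos (sub_pos.2 r1) hw1]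
  have z2 : 0 < D ε w k z := by
    rw [D_interp hre him, D_left]; nlinarith [mul_pos r0 hwx]
  have z3 : D ε x w z = 0 := by rw [D_interp hre him, D_left, D_right]; ring
  have z4 : D ε k w z < 0 := by rw [D_swap]; linarith
  have zT : InTri ε k x w z := ⟨z1.le, z3.ge, z2.le⟩
  have sub : ∀ z, InTri ε k x w z → 0 ≤ D ε x y z ∧ 0 ≤ D ε y k z := fun z hz =>
    ⟨D_nonneg_of_inTri hw1 hz hyx.le (D_left _ _ _).ge hw3,
      D_nonneg_of_inTri hw1 hz (D_right _ _ _).ge hyk.le hw2⟩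
  have hnv : ∀ v : P, InTri ε k x w v → 0 < D ε k x v → ¬ 0 < D ε w k v := by
    intro v hv hv1 hv2
    have := hmin v ⟨hv.1, (sub v hv).1, (sub v hv).2⟩ hv1
    rw [D_swap] at this
    linarith
  rcases vertex_or_edge_of_mem_drawing hzd with ⟨v, rfl⟩ | ⟨a, b, hab, hab'⟩
  · exact hnv v zT z1 z2
  · have hbw : Bar A w k := by
      rcases hadj with hadj | hadj
      · exact bar_of_adj hA hadj.symm
      · exact hadj.symm.bar
    obtain ⟨a0, b0⟩ := tri_cross (u := w) (v := k) (w := x) hwx hbw hkx.bar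
      (fun a b hab hm => absurd hm (hA.1 a b k hab)) z2 z1 z3.ge (fun a b hab hz ha ha' => by
        have haT : InTri ε k x w a := ⟨ha.2.1, ha.2.2, ha.1⟩
        have hak : a = k := by
          by_contra hak
          rcases ha.2.1.eq_or_lt with e | e
          · rcases eq_or_mem_openSegment' hwx e.symm ha' ha.1 with ⟨e, -⟩ | ⟨e, -⟩
            · exact hak (Subtype.ext e)
            · exact hkx _ e (vertex_mem_drawing A a)
          · rcases ha.1.eq_or_lt with e' | e'
            · refine D_ne_zero hP hε hkw.symm ?_ (Ne.symm hak) e'.symm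
              rintro rfl
              rw [D_right] at ha'
              exact lt_irrefl _ ha'
            · exact hnv a haT e e'
        subst hak
        obtain ⟨r, r0, r1, hre, him⟩ := exists_of_mem_openSegment hz
        refine hno b hab ?_ ?_
        · rw [D_interp hre him, D_left] at z1
          have : 0 < r * D ε a x b := by linarith
          exact pos_of_mul_pos_right this r0.le
        · rw [D_interp hre him, D_right] at z2
          have : 0 < r * D ε w a b := by linarith
          rw [← D_rot]
          exact pos_of_mul_pos_right this r0.le) hab hab'
    have main : ∀ b : P, A.Adj w b → z ∈ openSegment ℝ (w : ℂ) b → False := by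
      intro b hb hm
      rcases mem_trichotomy hz hm with hbm | heq | hxm
      · obtain ⟨q, q0, q1, hre2, him2⟩ := exists_of_mem_openSegment hbm
        have b1 : 0 < D ε k x b := by
          rw [D_interp hre2 him2, D_right, mul_zero, add_zero]
          exact mul_pos (sub_pos.2 q1) hw1
        have b2 : 0 < D ε w k b := by
          rw [D_interp hre2 him2, D_left, mul_zero, zero_add]; exact mul_pos q0 hwx
        have b3 : D ε x w b = 0 := by rw [D_interp hre2 him2, D_left, D_right]; ring
        exact hnv b ⟨b1.le, b3.ge, b2.le⟩ b1 b2
      · exact hxP b heq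
      · have := (hx w b hb hxm).1
        rw [D_one_eq_zero hε] at this
        linarith
    have hor : a = w ∨ b = w := by
      by_contra hc
      push Not at hc
      have hwab : D ε w a b = 0 := by
        have hp : D ε x w k * D ε w a b = 0 := by
          have e : D ε x w k * D ε w a b = D ε x w a * D ε w k b - D ε x w b * D ε w k a := by
            simp only [D]; ring
          rw [e, a0, b0]; ring
        rcases mul_eq_zero.1 hp with e | e
        · linarith
        · exact e
      exact D_ne_zero hP hε (Ne.symm hc.1) (Ne.symm hc.2) hab.ne hwab
    rcases hor with rfl | rfl
    · exact main b hab hab'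
    · rw [openSegment_symm] at hab'
      exact main a hab.symm hab'

/-- Take a vertex of least angle. The swept region holds no vertex before `w`, and edges cannot
enter it through `k x` or `x y`; an edge that meets it can only run along the line `k w`. -/
theorem exists_fan (hP : GeneralPosition P) {A : SimpleGraph P} (hA : IsPSLG A) {ε : ℝ} {k y : P}
    {x : ℂ} (h : 0 < D ε k x y) (hkx : Free A (k : ℂ) x) (hxy : Bar A x y)
    (hxP : ∀ v : P, (v : ℂ) ≠ x)
    (hx : ∀ a b : P, A.Adj a b → x ∈ openSegment ℝ (a : ℂ) b → D 1 x y a = 0 ∧ D 1 x y b = 0) :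
    ∃ w, IsFan A ε k x y w := by
  have hε := ne_zero_of_D_pos h
  obtain ⟨w, hw1, hw2, hw3, hmin⟩ := exists_first h
  have hkw : k ≠ w := by rintro rfl; rw [D_left] at hw1; exact lt_irrefl _ hw1
  have hyx : 0 < D ε x y k := by rwa [← D_rot]
  have hyk : 0 < D ε y k x := by rwa [← D_rot, ← D_rot]
  -- the point where the ray from `k` through `w` meets the opposite side
  have hsum := D_sum ε k x y w
  obtain ⟨l, hl1, hl⟩ : ∃ l : ℝ, 1 ≤ l ∧ l * (D ε k x y - D ε x y w) = D ε k x y := by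
    have hp : 0 < D ε k x y - D ε x y w := by linarith
    refine ⟨D ε k x y / (D ε k x y - D ε x y w), ?_, div_mul_cancel₀ _ hp.ne'⟩
    rw [le_div_iff₀ hp]; linarith
  have hl0 : 0 < l := by linarith
  set w' := lineAt k w l with hw'
  have e1 : D ε x y w' = 0 := by rw [hw', D_lineAt, ← D_rot]; linarith
  have e2 : D ε k x w' = l * D ε k x w := by rw [hw', D_lineAt, D_left]; ring
  have e3 : ∀ z, D ε w' k z = - (l * D ε k w z) := by
    intro z; simp only [hw', lineAt, D]; ring
  have h' : 0 < D ε k x w' := by rw [e2]; positivity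
  have e4 : 0 ≤ D ε y k w' := by
    rw [hw', D_lineAt, D_right]
    nlinarith [mul_nonneg hl0.le hw2]
  obtain ⟨t, t0, t1, ew⟩ : ∃ t : ℝ, 0 < t ∧ t ≤ 1 ∧ w' = lineAt x y t := by
    rcases eq_or_mem_openSegment (u := x) (v := y) (w := k) hyx e1 h' e4 with ⟨e, -⟩ | ⟨e, -⟩
    · exact ⟨1, one_pos, le_rfl, by rw [lineAt_one]; exact e⟩
    · obtain ⟨t, t0, t1, hre, him⟩ := exists_of_mem_openSegment e
      exact ⟨t, t0, t1.le, Complex.ext hre him⟩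
  have e5 : ∀ δ z, D δ x w' z = t * D δ x y z := by
    intro δ z; rw [ew]; simp only [lineAt, D]; ring
  have hxw : Bar A x w' := by
    intro a b hab z hz hz'
    have hz2 : z ∈ openSegment ℝ x (y : ℂ) := by
      obtain ⟨r, r0, r1, hre, him⟩ := exists_of_mem_openSegment hz'
      refine mem_openSegment_of (t := r * t) (mul_pos r0 t0) (by nlinarith) ?_ ?_
      · rw [hre, ew]; simp only [lineAt]; ring
      · rw [him, ew]; simp only [lineAt]; ring
    obtain ⟨h1, h2⟩ := hxy a b hab z hz hz2
    rw [e5, e5, h1, h2]; simp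
  have hx' : ∀ a b : P, A.Adj a b → x ∈ openSegment ℝ (a : ℂ) b →
      D 1 x w' a = 0 ∧ D 1 x w' b = 0 := by
    intro a b hab hm
    obtain ⟨h1, h2⟩ := hx a b hab hm
    rw [e5, e5, h1, h2]; simp
  -- The region swept up to `w` is the triangle `k x w'`. Its sides `k x` and `x w'` are barred and
  -- no vertex lies strictly before the ray `k w'`, so `tri_cross` leaves only edges along that ray.
  have key : ∀ z, 0 < D ε k x z → 0 < D ε x y z → D ε k w z ≤ 0 → ∀ a b : P, A.Adj a b →
      z ∈ openSegment ℝ (a : ℂ) b → D ε k w a = 0 ∧ D ε k w b = 0 := by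
    intro z z1 z2 z3 a b hab hz
    have := tri_cross h' hkx.bar hxw (fun a b hab hm => Or.inr (hx' a b hab hm)) z1
      (by rw [e5]; exact mul_pos t0 z2) (by rw [e3]; nlinarith) (fun a b _ _ ha ha' => by
        rw [e3] at ha'
        have ha3 : D ε k w a < 0 := by
          by_contra hc; push Not at hc; nlinarith [mul_nonneg hl0.le hc]
        rcases ha.1.eq_or_lt with e | e
        · refine hkx.eq_of_collinear h' hxP e.symm (v := a) ?_ ha.2.1
          rw [e3]; exact ha'
        · refine absurd (hmin a ⟨ha.1, ?_, ?_⟩ e) (not_le.2 ha3)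
          · have := ha.2.1
            rw [e5] at this
            exact nonneg_of_mul_nonneg_right this t0
          · exact D_nonneg_of_inTri h' ha (D_right _ _ _).ge hyk.le e4) hab hz
    rw [e3, e3] at this
    constructor
    · have := this.1; simpa [hl0.ne'] using this
    · have := this.2; simpa [hl0.ne'] using this
  have hadj : A.Adj k w ∨ Free A (k : ℂ) w := by
    by_cases hc : A.Adj k w
    · exact Or.inl hc
    right
    intro z hz hzd
    obtain ⟨r, r0, r1, hre, him⟩ := exists_of_mem_openSegment hz
    have z0 := D_eq_zero_of_mem_openSegment ε hz
    have hkw' : (k : ℂ) ≠ w := fun e => hkw (Subtype.ext e)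
    rcases vertex_or_edge_of_mem_drawing hzd with ⟨v, rfl⟩ | ⟨a, b, hab, hab'⟩
    · exact D_ne_zero hP hε hkw
        (fun e => ne_of_mem_openSegment_left hkw' hz (congrArg Subtype.val e).symm)
        (fun e => ne_of_mem_openSegment_right hkw' hz (congrArg Subtype.val e).symm) z0
    · have := key z (by rw [D_interp hre him, D_left]; nlinarith [mul_pos r0 hw1])
        (by rw [D_interp hre him]; nlinarith [mul_pos (sub_pos.2 r1) hyx, mul_nonneg r0.le hw3])
        z0.le a b hab hab'
      rw [← D_one_eq_zero hε, ← D_one_eq_zero hε] at this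
      exact hc (edge_eq_of_collinear hP hkw hab this.1 this.2)
  have hno : ∀ b : P, A.Adj k b → 0 < D ε k x b → 0 < D ε k b w → False := by
    intro b hb b1 b2
    have b3 : 0 < D ε y k b := by
      have pl : D ε k x w * D ε y k b = D ε k x b * D ε y k w + D ε k x y * D ε k b w := by
        simp only [D]; ring
      have : 0 < D ε k x w * D ε y k b := by
        rw [pl]; nlinarith [mul_nonneg b1.le hw2, mul_pos h b2]
      exact pos_of_mul_pos_right this hw1.le
    -- The direction of `b` precedes that of `w`, so `b` lies outside the triangle, beyond `x y`,
    -- and the edge `k b` has to cross that side.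
    have b4 : D ε x y b < 0 := by
      by_contra hc
      push Not at hc
      have := hmin b ⟨b1.le, hc, b3.le⟩ b1
      rw [D_swap'] at this
      linarith
    have hd : 0 < D ε x y k - D ε x y b := by linarith
    have r0 : 0 < D ε x y k / (D ε x y k - D ε x y b) := div_pos hyx hd
    have r1 : D ε x y k / (D ε x y k - D ε x y b) < 1 := by rw [div_lt_one hd]; linarith
    have hm := lineAt_mem (a := (k : ℂ)) (b := b) r0 r1
    set m := lineAt k b (D ε x y k / (D ε x y k - D ε x y b)) with hmdef
    have m1 : D ε x y m = 0 := by rw [hmdef, D_lineAt]; field_simp; ring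
    have m2 : 0 < D ε k x m := by rw [hmdef, D_lineAt, D_left]; nlinarith [mul_pos r0 b1]
    have m3 : 0 < D ε y k m := by rw [hmdef, D_lineAt, D_right]; nlinarith [mul_pos r0 b3]
    rcases eq_or_mem_openSegment (u := x) (v := y) (w := k) hyx m1 m2 m3.le with ⟨-, e⟩ | ⟨e, -⟩
    · linarith
    · have := (hxy k b hb m hm e).1
      rw [D_one_eq_zero hε] at this
      linarith
  refine ⟨w, hw1, hw2, hw3, hmin, hadj, hno, ?_, ?_⟩
  · intro z z1 z2 z3 hz
    have z4 : D ε k w z < 0 := by rw [D_swap]; linarith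
    have z5 : 0 < D ε x y z := by
      have : 0 < D ε k x w * D ε x y z := by
        rw [D_bary ε k x w x y z, D_left]
        nlinarith [mul_pos z2 hyx, mul_nonneg z1.le hw3]
      exact pos_of_mul_pos_right this hw1.le
    have z6 : 0 ≤ D ε y k z :=
      D_nonneg_of_inTri hw1 ⟨z1.le, z2.le, z3.le⟩ (D_right _ _ _).ge hyk.le hw2
    rcases vertex_or_edge_of_mem_drawing hz with ⟨v, rfl⟩ | ⟨a, b, hab, hab'⟩
    · exact absurd (hmin v ⟨z1.le, z5.le, z6⟩ z1) (not_le.2 z4)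
    · obtain ⟨a0, b0⟩ := key z z1 z5 z4.le a b hab hab'
      obtain ⟨r, r0, r1, hre, him⟩ := exists_of_mem_openSegment hab'
      rw [D_interp hre him, a0, b0] at z4
      simp at z4
  · exact fan_free hP hA h hkx hxP hx hw1 hw2 hw3 hmin hadj hno

end Fan

end RingPhase

namespace RingPhase

/-! ### Sweeps towards an end of an edge -/

section Far

variable {P : Finset ℂ}

theorem D_pos_edge {δ : ℝ} {p y y' z : ℂ} (hp : p ∈ openSegment ℝ y y') (h : 0 < D δ p y z) :
    0 < D δ y' y z ∧ 0 < D δ z p y ∧ 0 < D (-δ) z p y' := by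
  obtain ⟨t, t0, t1, hre, him⟩ := exists_of_mem_openSegment hp
  have e1 : D δ p y z = t * D δ y' y z := by simp only [D]; rw [hre, him]; ring
  have e2 : D (-δ) z p y' = (1 - t) * D δ y' y z := by simp only [D]; rw [hre, him]; ring
  have h1 : 0 < D δ y' y z := by
    rw [e1] at h; exact pos_of_mul_pos_right h t0.le
  refine ⟨h1, by rwa [D_rot], ?_⟩
  rw [e2]
  exact mul_pos (by linarith) h1

theorem D_edge {p y y' : ℂ} (hp : p ∈ openSegment ℝ y y') :
    ∃ t : ℝ, 0 < t ∧ t < 1 ∧ (∀ δ z, D δ p y z = t * D δ y' y z) ∧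
      (∀ δ u v, D δ u v p = (1 - t) * D δ u v y + t * D δ u v y') := by
  obtain ⟨t, t0, t1, hre, him⟩ := exists_of_mem_openSegment hp
  refine ⟨t, t0, t1, fun δ z => ?_, D_interp hre him⟩
  simp only [D]; rw [hre, him]; ring

/-- A point inside an edge meets the requirements on the initial point of a sweep: it is no vertex,
and planarity allows only the edge itself to pass through it. -/
theorem bar_edge {A : SimpleGraph P} (hA : IsPSLG A) {y y' : P} (h : A.Adj y y') {p : ℂ}
    (hp : p ∈ openSegment ℝ (y : ℂ) y') :
    Bar A p y ∧ (∀ v : P, (v : ℂ) ≠ p) ∧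
      (∀ a b : P, A.Adj a b → p ∈ openSegment ℝ (a : ℂ) b → D 1 p y a = 0 ∧ D 1 p y b = 0) := by
  obtain ⟨t, t0, t1, ht, -⟩ := D_edge hp
  have e : ∀ z, D 1 y y' z = 0 → D 1 p y z = 0 := by
    intro z hz; rw [ht, D_swap, hz]; ring
  refine ⟨fun a b hab z hz hz' => ?_, fun v hv => hA.1 y y' v h (hv ▸ hp), fun a b hab hm => ?_⟩
  · have : z ∈ openSegment ℝ (y : ℂ) y' := by
      obtain ⟨r, r0, r1, hre, him⟩ := exists_of_mem_openSegment hz'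
      obtain ⟨t, t0, t1, hre', him'⟩ := exists_of_mem_openSegment hp
      refine mem_openSegment_of (t := (1 - r) * t) (mul_pos (by linarith) t0) (by nlinarith) ?_ ?_
      · rw [hre, hre']; ring
      · rw [him, him']; ring
    have := bar_of_adj hA h a b hab z hz this
    exact ⟨e _ this.1, e _ this.2⟩
  · have := bar_of_adj hA h a b hab p hm hp
    exact ⟨e _ this.1, e _ this.2⟩

theorem exists_fan_edge (hP : GeneralPosition P) {A : SimpleGraph P} (hA : IsPSLG A) {ε : ℝ}
    {k y y' : P} {p : ℂ} (h : 0 < D ε k p y) (hkp : Free A (k : ℂ) p) (hy : A.Adj y y')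
    (hp : p ∈ openSegment ℝ (y : ℂ) y') : ∃ w, IsFan A ε k p y w := by
  obtain ⟨h1, h2, h3⟩ := bar_edge hA hy hp
  exact exists_fan hP hA h hkp h1 h2 h3

theorem IsFan.mem_hull {A : SimpleGraph P} {ε : ℝ} {k y y' w : P} {p : ℂ}
    (hp : p ∈ openSegment ℝ (y : ℂ) y') (h : 0 < D ε k p y) (hw : IsFan A ε k p y w) :
    (w : ℂ) ∈ convexHull ℝ ({(k : ℂ), (y : ℂ), (y' : ℂ)} : Set ℂ) := by
  refine convexHull_triple_subset (convex_convexHull ℝ _) ?_ ?_ ?_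
    (mem_convexHull_of_inTri h hw.inTri)
  · exact subset_convexHull ℝ _ (by simp)
  · exact (convex_convexHull ℝ _).segment_subset (subset_convexHull ℝ _ (by simp))
      (subset_convexHull ℝ _ (by simp)) (openSegment_subset_segment ℝ _ _ hp)
  · exact subset_convexHull ℝ _ (by simp)

theorem IsFan.ne {A : SimpleGraph P} {ε : ℝ} {k y w : P} {x : ℂ} (h : IsFan A ε k x y w) :
    k ≠ w := by
  rintro rfl
  have := h.pos
  rw [D_left] at this
  exact lt_irrefl _ this

/-- The first vertex of a sweep towards an edge is not close to both ends of the edge. -/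
theorem IsFan.not_near_ends (hP : GeneralPosition P) {s : ℝ} {A : SimpleGraph P}
    (hA : IsMaximalPSLG s A) {ε : ℝ} {k y y' w : P} {p : ℂ} (hy : A.Adj y y')
    (hp : p ∈ openSegment ℝ (y : ℂ) y') (h : 0 < D ε k p y) (hkp : Free A (k : ℂ) p)
    (hw : IsFan A ε k p y w) (hpos : 0 < D ε p y w) (n1 : Near s (w : ℂ) y)
    (n2 : Near s (w : ℂ) y') : False := by
  have hA' := hA.1.1
  have hp' : p ∈ openSegment ℝ (y' : ℂ) y := by rwa [openSegment_symm]
  have hpP := (bar_edge hA' hy hp).2.1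
  obtain ⟨g1, g2, g3⟩ := D_pos_edge hp hpos
  obtain ⟨t, t0, t1, ht, hi⟩ := D_edge hp
  -- The second sweep is at `w`, from `p` towards the other end `y'`, with reversed orientation.
  -- Both ends lie in `N(w)`, hence so does `v`.
  obtain ⟨v, hv⟩ := exists_fan_edge hP hA' g3 (hw.free hpos) hy.symm hp'
  have hnv : Near s (w : ℂ) v :=
    near_of_mem_hull (near_refl s w) n2 n1 (hv.mem_hull hp' g3)
  have hwv : A.Adj w v := by
    rcases hv.adj_or_free with hc | hc
    · exact hc
    · exact absurd hnv (not_near_of_free hA hv.ne hc)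
  -- signs at `y'`
  have hyk : 0 < D ε y k p := by rwa [← D_rot, ← D_rot]
  have a1 : 0 ≤ D ε y k y' := by
    have := hi ε y k
    rw [D_left, mul_zero, zero_add] at this
    rw [this] at hyk
    exact (pos_of_mul_pos_right hyk t0.le).le
  have b1 : D ε k w p < 0 := by have := hw.pos; rw [D_swap'] at this; linarith
  have b2 : 0 ≤ D ε k w y := by rw [← D_rot]; exact hw.le_end
  have b3 : D ε k w y' < 0 := by
    have := hi ε k w
    nlinarith [mul_nonneg (sub_pos.2 t1).le b2]
  have hvT := hv.inTri
  have v1 : 0 ≤ D ε y k v :=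
    D_nonneg_of_inTri g3 hvT hw.le_end hyk.le a1
  have v2 : 0 ≤ D ε p y v := by
    have h1 := hv.inside
    rw [D_neg] at h1
    have h2 : D ε p y v = - (t * D ε y y' v) := by rw [ht, D_swap]; ring
    have h3 : D ε p y' v = (1 - t) * D ε y y' v := by
      have : ∀ δ z, D δ p y' z = (1 - t) * D δ y y' z := by
        intro δ z
        have e1 := D_sum δ p y' z y
        have e2 := hi δ y y'
        have e3 := hi δ y' z
        have e4 := ht δ z
        have e5 := hi δ z y
        have e6 := D_rot δ p y' z
        have e7 := D_rot δ z p y'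
        rw [e6, e3, D_left]
        simp only [D]; ring
      exact this _ _
    rw [h3] at h1
    rw [h2]
    have : 0 ≤ (1 - t) * (- D ε y y' v) := by linarith
    have := nonneg_of_mul_nonneg_right this (sub_pos.2 t1)
    nlinarith
  have v3 : D ε k w v < 0 := by
    have e := D_bary (-ε) w p y' k w v
    rw [D_neg ε k w v, D_neg ε k w w, D_neg ε k w p, D_neg ε k w y', D_right] at e
    have hv1 := hv.pos
    have hv2 := hv.le_end
    have : 0 < D (-ε) w p y' * (- D ε k w v) := by
      rw [e]; nlinarith [mul_pos hv1 (neg_pos.2 b3), mul_nonneg hv2 (neg_pos.2 b1).le]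
    have := pos_of_mul_pos_right this g3.le
    linarith
  -- On the side of `y`, the vertex `v` would lie in the triangle `k p y` and, by `v3`, be met
  -- before `w`.
  have v4 : D ε k p v ≤ 0 := by
    by_contra hc
    push Not at hc
    exact absurd (hw.min v ⟨hc.le, v2, v1⟩ hc) (not_le.2 v3)
  -- the edge `w v` crosses the segment `k p`
  have hd : 0 < D ε k p w - D ε k p v := by have := hw.pos; linarith
  set r := D ε k p w / (D ε k p w - D ε k p v) with hr
  have r0 : 0 < r := div_pos hw.pos hd
  have r1 : r ≤ 1 := by rw [hr, div_le_one hd]; linarith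
  set z := lineAt w v r with hz
  have z0 : D ε k p z = 0 := by rw [hz, D_lineAt, hr]; field_simp; ring
  have z1 : D ε k w z < 0 := by
    rw [hz, D_lineAt, D_right]; nlinarith [mul_pos r0 (neg_pos.2 v3)]
  have z2 : 0 ≤ D ε p y z := by
    rw [hz, D_lineAt]
    nlinarith [mul_nonneg (sub_nonneg.2 r1) hpos.le, mul_nonneg r0.le v2]
  have z3 : 0 < D ε y k z := by
    have pl : D ε k p w * D ε y k z = D ε k p y * (- D ε k w z) + D ε k p z * D ε k w y := by
      simp only [D]; ring
    have : 0 < D ε k p w * D ε y k z := by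
      rw [pl, z0]; nlinarith [mul_pos h (neg_pos.2 z1)]
    exact pos_of_mul_pos_right this hw.pos.le
  have hzd : z ∈ drawing A := by
    rcases r1.eq_or_lt with e | e
    · rw [hz, e, lineAt_one]; exact vertex_mem_drawing A v
    · exact openSegment_subset_drawing hwv (lineAt_mem r0 e)
  rcases eq_or_mem_openSegment h z0 z3 z2 with ⟨e, e'⟩ | ⟨e, -⟩
  · rw [hz, D_lineAt] at e'
    have h1 : r = 1 := by
      by_contra hne
      have : 0 < 1 - r := by
        rcases r1.eq_or_lt with e | e
        · exact absurd e hne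
        · linarith
      nlinarith [mul_pos this hpos, mul_nonneg r0.le v2]
    rw [hz, h1, lineAt_one] at e
    exact hpP v e
  · exact hkp z e hzd

/-- A vertex `k` close to `y` that sees the point `p` of the edge `y y'`: the first vertex of the
sweep from `p` to either end of the edge is that end or a neighbour of `k`. -/
theorem IsFan.adj (hP : GeneralPosition P) {s : ℝ} {A : SimpleGraph P}
    (hA : IsMaximalPSLG s A) {ε : ℝ} {k c d y y' w : P} {p : ℂ} (hy : A.Adj y y')
    (hp : p ∈ openSegment ℝ (y : ℂ) y') (h : 0 < D ε k p y) (hkp : Free A (k : ℂ) p)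
    (hw : IsFan A ε k p y w) (hpos : 0 < D ε p y w)
    (hcd : (c = y ∧ d = y') ∨ (c = y' ∧ d = y)) (hck : Near s (c : ℂ) k) : A.Adj k w := by
  rcases hw.adj_or_free with hc | hc
  · exact hc
  exfalso
  have hne := not_near_of_free hA hw.ne hc
  have hcd' : Near s (c : ℂ) d := by
    rcases hcd with ⟨rfl, rfl⟩ | ⟨rfl, rfl⟩
    · exact near_of_adj hA hy
    · exact near_of_adj hA hy.symm
  have hull : (w : ℂ) ∈ convexHull ℝ ({(k : ℂ), (c : ℂ), (d : ℂ)} : Set ℂ) := by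
    have := hw.mem_hull hp h
    rcases hcd with ⟨rfl, rfl⟩ | ⟨rfl, rfl⟩
    · exact this
    · convert this using 2; ext; simp; tauto
  have n1 : Near s (w : ℂ) c := (near_of_mem_hull hck (near_refl s c) hcd' hull).symm
  -- The vertex `k` sees `w` but is not joined to it, so the alternative `N(k)` of the grid lemma is
  -- excluded by maximality.
  have n2 : Near s (w : ℂ) d :=
    ((near_or_near_of_mem_hull hck hcd' hull).resolve_left hne).symm
  rcases hcd with ⟨rfl, rfl⟩ | ⟨rfl, rfl⟩
  · exact hw.not_near_ends hP hA hy hp h hkp hpos n1 n2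
  · exact hw.not_near_ends hP hA hy hp h hkp hpos n2 n1

/-- If the first vertex of a sweep lies on the far side, it is the end of that side. -/
theorem IsFan.eq_end (hP : GeneralPosition P) {A : SimpleGraph P} {ε : ℝ}
    {k y y' w : P} {p : ℂ} (hy : A.Adj y y') (hp : p ∈ openSegment ℝ (y : ℂ) y')
    (h : 0 < D ε k p y) (hw : IsFan A ε k p y w) (h0 : D ε p y w = 0) : w = y := by
  have hε := ne_zero_of_D_pos h
  obtain ⟨t, t0, t1, ht, hi⟩ := D_edge hp
  rw [ht, D_swap] at h0
  have h1 : D ε y y' w = 0 := by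
    rcases mul_eq_zero.1 h0 with e | e
    · exact absurd e t0.ne'
    · linarith
  by_contra hne
  by_cases hy' : w = y'
  · subst hy'
    have := (D_pos_edge hp (z := (k : ℂ)) (δ := ε) (by rw [← D_rot]; exact h)).2.2
    rw [D_neg] at this
    have := hw.pos
    linarith
  · exact D_ne_zero hP hε hy.ne (Ne.symm hne) (Ne.symm hy') h1

end Far

end RingPhase

namespace RingPhase

/-! ### Reflex chains followed by sweeps -/

section Chain

variable {P : Finset ℂ}

theorem IsFan.openSegment_subset {A : SimpleGraph P} {f : Set ℂ} (hf : IsFace A f) {ε : ℝ}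
    {k y w : P} {x : ℂ} (hw : IsFan A ε k x y w) (hpos : 0 < D ε x y w)
    (hkx : openSegment ℝ (k : ℂ) x ⊆ f) : openSegment ℝ (w : ℂ) x ⊆ f := by
  refine hf.side_subset (ε := -ε) (u := x) (v := k) (w := w) ?_ ?_ ?_ (hw.free hpos)
  · rw [D_neg, D_swap, neg_neg]; exact hw.pos
  · intro z z1 z2 z3
    refine hw.interior z ?_ ?_ ?_
    · rwa [D_neg, D_swap, neg_neg] at z1
    · rwa [D_neg, D_swap, neg_neg] at z3
    · rwa [D_neg, D_swap, neg_neg] at z2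
  · rwa [openSegment_symm]

theorem IsFan.openSegment_subset' {A : SimpleGraph P} {f : Set ℂ} (hf : IsFace A f) {ε : ℝ}
    {k y w : P} {x : ℂ} (hw : IsFan A ε k x y w) (hkw : Free A (k : ℂ) w)
    (hkx : openSegment ℝ (k : ℂ) x ⊆ f) : openSegment ℝ (k : ℂ) w ⊆ f := by
  rw [openSegment_symm]
  exact hf.side_subset hw.pos hw.interior hkx hkw.symm

/-- What holds at the vertex `k` of a reflex chain that ends in `c`, when the point `p` of the
edge `c d` is visible. -/
structure ChainView (A : SimpleGraph P) (s : ℝ) (f : Set ℂ) (ε : ℝ) (c : P) (p : ℂ) (k : P) :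
    Prop where
  seg : openSegment ℝ (k : ℂ) p ⊆ f
  pos : 0 < D ε k p c
  near : Near s (c : ℂ) k

/-- One step along the chain: the first vertex is joined to `k`, stays in `N(c)` by convexity, and
sees `p` across the empty swept triangle, unless it is `c`. -/
theorem ChainView.exists_next (hP : GeneralPosition P) {s : ℝ} {A : SimpleGraph P}
    (hA : IsMaximalPSLG s A) {f : Set ℂ} (hf : IsFace A f) {ε : ℝ} {c d k : P} {p : ℂ}
    (hcd : A.Adj c d) (hp : p ∈ openSegment ℝ (c : ℂ) d) (h : ChainView A s f ε c p k) :
    ∃ w, IsFan A ε k p c w ∧ A.Adj k w ∧ (w = c ∨ ChainView A s f ε c p w) := by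
  obtain ⟨w, hw⟩ := exists_fan_edge hP hA.1.1 h.pos (hf.free h.seg) hcd hp
  refine ⟨w, hw, ?_⟩
  have hn : Near s (c : ℂ) w := near_of_mem_hull h.near (near_refl s c) (near_of_adj hA hcd)
    (hw.mem_hull hp h.pos)
  rcases hw.inside.eq_or_lt with h0 | h0
  · have e := hw.eq_end hP hcd hp h.pos h0.symm
    refine ⟨?_, Or.inl e⟩
    rcases hw.adj_or_free with hc | hc
    · exact hc
    · exact absurd (e ▸ h.near.symm) (not_near_of_free hA hw.ne hc)
  · exact ⟨hw.adj hP hA hcd hp h.pos (hf.free h.seg) h0 (Or.inl ⟨rfl, rfl⟩) h.near,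
      Or.inr ⟨hw.openSegment_subset hf h0 h.seg, by rwa [D_rot], hn⟩⟩

/-- A chain of vertices that follows the boundary of the face as long as it can is the chain of
first vertices of the sweeps beginning at `p`. -/
theorem chain_isFan (hP : GeneralPosition P) {s : ℝ} {A : SimpleGraph P}
    (hA : IsMaximalPSLG s A) {f : Set ℂ} (hf : IsFace A f) {ε : ℝ} {c d : P} {p : ℂ}
    (hcd : A.Adj c d) (hp : p ∈ openSegment ℝ (c : ℂ) d) (q : ℕ → P) (n : ℕ)
    (InC : ℕ → ℂ → Prop) (h0 : ChainView A s f ε c p (q 0)) (h0C : InC 0 p)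
    (hS : ∀ t < n, InC t p → ∀ w, A.Adj (q t) w → 0 < D ε (q t) p w →
      (∀ b, A.Adj (q t) b → 0 < D ε (q t) p b → 0 < D ε (q t) b w → False) → q (t + 1) = w)
    (hC : ∀ t, t + 1 < n → ∀ x, 0 < D ε (q (t + 1)) (q t) x → InC (t + 1) x)
    (hR : ∀ t, t + 1 < n → ∀ x, A.Adj (q (t + 1)) x → ¬ 0 < D ε (q (t + 1)) (q t) x) :
    ∀ t < n, InC t p ∧ ChainView A s f ε c p (q t) ∧ IsFan A ε (q t) p c (q (t + 1)) ∧
      (q (t + 1) = c ∨ ChainView A s f ε c p (q (t + 1))) := by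
  have step : ∀ t < n, InC t p → ChainView A s f ε c p (q t) →
      IsFan A ε (q t) p c (q (t + 1)) ∧ (q (t + 1) = c ∨ ChainView A s f ε c p (q (t + 1))) := by
    intro t ht hi h
    obtain ⟨w, hw, hadj, hor⟩ := h.exists_next hP hA hf hcd hp
    have := hS t ht hi w hadj hw.pos hw.no_edge
    rw [this]
    exact ⟨hw, hor⟩
  have main : ∀ t < n, InC t p ∧ ChainView A s f ε c p (q t) := by
    intro t
    induction t with
    | zero => intro _; exact ⟨h0C, h0⟩
    | succ t ih =>
      intro ht
      obtain ⟨hi, h⟩ := ih (by omega)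
      obtain ⟨hw, hor⟩ := step t (by omega) hi h
      refine ⟨hC t ht p (by rw [D_rot]; exact hw.pos), ?_⟩
      -- The chain cannot reach `c` early: at an intermediate position the edge from `c` to `d`
      -- would enter the sector kept free by `hR`.
      rcases hor with e | hor
      · exfalso
        refine hR t ht d (e ▸ hcd) ?_
        rw [e]
        have := (D_pos_edge hp (z := (q t : ℂ)) (δ := ε) (by rw [← D_rot]; exact h.pos)).1
        rw [← D_rot]; exact this
      · exact hor
  intro t ht
  obtain ⟨hi, h⟩ := main t ht
  exact ⟨hi, h, step t ht hi h⟩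

/-- If no edge at `k` leads into the triangle `k p d`, then `k` sees `d`. -/
theorem ChainView.sees_end (hP : GeneralPosition P) {s : ℝ} {A : SimpleGraph P}
    (hA : IsMaximalPSLG s A) {f : Set ℂ} (hf : IsFace A f) {ε : ℝ} {c d k : P} {p : ℂ}
    (hcd : A.Adj c d) (hp : p ∈ openSegment ℝ (c : ℂ) d) (h : ChainView A s f ε c p k)
    (hno : ∀ w, IsFan A (-ε) k p d w → ¬ A.Adj k w) :
    IsFan A (-ε) k p d d ∧ openSegment ℝ (k : ℂ) d ⊆ f := by
  have hp' : p ∈ openSegment ℝ (d : ℂ) c := by rwa [openSegment_symm]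
  have g := (D_pos_edge hp (z := (k : ℂ)) (δ := ε) (by rw [← D_rot]; exact h.pos)).2.2
  obtain ⟨w, hw⟩ := exists_fan_edge hP hA.1.1 g (hf.free h.seg) hcd.symm hp'
  have hfree : Free A (k : ℂ) w := hw.adj_or_free.resolve_left (hno w hw)
  have e : w = d := by
    rcases hw.inside.eq_or_lt with h0 | h0
    · exact hw.eq_end hP hcd.symm hp' g h0.symm
    · exact absurd (hw.adj hP hA hcd.symm hp' g (hf.free h.seg) h0 (Or.inr ⟨rfl, rfl⟩) h.near)
        (hno w hw)
  subst e
  exact ⟨hw, hw.openSegment_subset' hf hfree h.seg⟩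

end Chain

end RingPhase

namespace RingPhase

/-! ### Angles -/

theorem ccwAngle_pos (a b : ℂ) : 0 < ccwAngle a b := (toIocMod_mem_Ioc Real.two_pi_pos 0 _).1

theorem ccwAngle_le (a b : ℂ) : ccwAngle a b ≤ 2 * Real.pi := by
  have := (toIocMod_mem_Ioc Real.two_pi_pos 0 (Complex.arg (b / a))).2
  rwa [zero_add] at this

theorem coe_ccwAngle (a b : ℂ) : (ccwAngle a b : Real.Angle) = (Complex.arg (b / a) : ℝ) := by
  rw [Real.Angle.angle_eq_iff_two_pi_dvd_sub]
  refine ⟨- toIocDiv Real.two_pi_pos 0 (Complex.arg (b / a)), ?_⟩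
  have := self_sub_toIocDiv_zsmul Real.two_pi_pos 0 (Complex.arg (b / a))
  unfold ccwAngle
  rw [← this]
  simp; ring

/-- The two sides agree modulo `2π`, and all three angles lie in `(0, 2π]`, which leaves only the
multiples `0` and `1`. -/
theorem ccwAngle_add {a b c : ℂ} (ha : a ≠ 0) (hb : b ≠ 0) (hc : c ≠ 0) :
    ccwAngle a b + ccwAngle b c = ccwAngle a c ∨
      ccwAngle a b + ccwAngle b c = ccwAngle a c + 2 * Real.pi := by
  have h : ((ccwAngle a b + ccwAngle b c : ℝ) : Real.Angle) = (ccwAngle a c : ℝ) := by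
    rw [Real.Angle.coe_add, coe_ccwAngle, coe_ccwAngle, coe_ccwAngle,
      ← Complex.arg_mul_coe_angle (div_ne_zero hb ha) (div_ne_zero hc hb)]
    congr 2
    field_simp
  rw [Real.Angle.angle_eq_iff_two_pi_dvd_sub] at h
  obtain ⟨n, hn⟩ := h
  have h1 := ccwAngle_pos a b
  have h2 := ccwAngle_pos b c
  have h3 := ccwAngle_pos a c
  have h4 := ccwAngle_le a b
  have h5 := ccwAngle_le b c
  have h6 := ccwAngle_le a c
  have hp := Real.pi_pos
  have n0 : (-1 : ℤ) < n := by
    by_contra hc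
    have : (n : ℝ) ≤ -1 := by exact_mod_cast not_lt.1 hc
    nlinarith
  have n1 : n < 2 := by
    by_contra hc
    have : (2 : ℝ) ≤ n := by exact_mod_cast not_lt.1 hc
    nlinarith
  have : n = 0 ∨ n = 1 := by omega
  rcases this with rfl | rfl
  · left; simp at hn; linarith
  · right; simp at hn; linarith

theorem sin_ccwAngle (a b : ℂ) : Real.sin (ccwAngle a b) = (b / a).im / ‖b / a‖ := by
  rw [← Complex.sin_arg, ← Real.Angle.sin_coe, coe_ccwAngle, Real.Angle.sin_coe]

/-- The bridge from angles to oriented areas: signs of `D` decide whether a counterclockwise angle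
is less than `π`. -/
theorem D_eq_sin {o a b : ℂ} (ha : a ≠ o) (hb : b ≠ o) :
    ∃ r : ℝ, 0 < r ∧ D 1 o a b = r * Real.sin (ccwAngle (a - o) (b - o)) := by
  have ha' := sub_ne_zero.2 ha
  have hb' := sub_ne_zero.2 hb
  have hn : 0 < Complex.normSq (a - o) := Complex.normSq_pos.2 ha'
  have hq : 0 < ‖(b - o) / (a - o)‖ := norm_pos_iff.2 (div_ne_zero hb' ha')
  refine ⟨Complex.normSq (a - o) * ‖(b - o) / (a - o)‖, mul_pos hn hq, ?_⟩
  rw [sin_ccwAngle, mul_assoc, mul_div_cancel₀ _ hq.ne', Complex.div_im]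
  field_simp
  simp only [D, Complex.sub_re, Complex.sub_im]
  ring

theorem ne_of_D_pos {ε : ℝ} {o a b : ℂ} (h : 0 < D ε o a b) : a ≠ o ∧ b ≠ o := by
  constructor
  · rintro rfl; rw [D_self] at h; exact lt_irrefl _ h
  · rintro rfl; rw [D_left] at h; exact lt_irrefl _ h

theorem ccwAngle_lt_pi_of_D_pos {o a b : ℂ} (h : 0 < D 1 o a b) :
    ccwAngle (a - o) (b - o) < Real.pi := by
  obtain ⟨ha, hb⟩ := ne_of_D_pos h
  obtain ⟨r, hr, e⟩ := D_eq_sin ha hb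
  by_contra hc
  push Not at hc
  have h1 := ccwAngle_le (a - o) (b - o)
  have : 0 ≤ Real.sin (ccwAngle (a - o) (b - o) - Real.pi) :=
    Real.sin_nonneg_of_nonneg_of_le_pi (by linarith) (by linarith)
  rw [Real.sin_sub_pi] at this
  nlinarith

theorem D_pos_of_ccwAngle_lt_pi {o a b : ℂ} (ha : a ≠ o) (hb : b ≠ o)
    (h : ccwAngle (a - o) (b - o) < Real.pi) : 0 < D 1 o a b := by
  obtain ⟨r, hr, e⟩ := D_eq_sin ha hb
  rw [e]
  exact mul_pos hr (Real.sin_pos_of_pos_of_lt_pi (ccwAngle_pos _ _) h)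

theorem D_eq_zero_of_ccwAngle_eq {o a b : ℂ} (ha : a ≠ o) (hb : b ≠ o)
    (h : ccwAngle (a - o) (b - o) = 2 * Real.pi) : D 1 o a b = 0 := by
  obtain ⟨r, hr, e⟩ := D_eq_sin ha hb
  rw [e, h, Real.sin_two_pi, mul_zero]

/-! ### Corners of the boundary walk -/

section Corner

variable {P : Finset ℂ}

/-- The direction from `σ i` to `x` lies in the corner of position `i`. -/
def InCorner (σ : ℤ → P) (i : ℤ) (x : ℂ) : Prop :=
  ccwAngle ((σ (i - 1) : ℂ) - σ i) (x - σ i) < cornerAngle σ i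

/-- Every edge at `σ i` stays out of the corner of position `i`. -/
structure IsCorner (A : SimpleGraph P) (σ : ℤ → P) (i : ℤ) : Prop where
  prev : A.Adj (σ i) (σ (i - 1))
  next : A.Adj (σ i) (σ (i + 1))
  outside : ∀ x, A.Adj (σ i) x → ¬ InCorner σ i x

theorem IsBoundaryWalk.isCorner {A : SimpleGraph P} {f : Set ℂ} {m : ℕ} {σ : ℤ → P}
    (h : IsBoundaryWalk A f m σ) (i : ℤ) : IsCorner A σ i := by
  refine ⟨?_, h.adj i, fun x hx => not_lt.2 (h.next i x hx)⟩
  have := (h.adj (i - 1)).symm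
  rwa [sub_add_cancel] at this

variable {A : SimpleGraph P} {σ : ℤ → P} {i : ℤ}

theorem IsCorner.prev_ne (h : IsCorner A σ i) : (σ (i - 1) : ℂ) ≠ σ i :=
  (coe_ne_of_adj h.prev).symm

theorem IsCorner.next_ne (h : IsCorner A σ i) : (σ (i + 1) : ℂ) ≠ σ i :=
  (coe_ne_of_adj h.next).symm

theorem IsCorner.add (h : IsCorner A σ i) {x y : ℂ} (hx : x ≠ σ i) (hy : y ≠ σ i) :
    ccwAngle ((σ (i - 1) : ℂ) - σ i) (x - σ i) + ccwAngle (x - σ i) (y - σ i) =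
      ccwAngle ((σ (i - 1) : ℂ) - σ i) (y - σ i) ∨
    ccwAngle ((σ (i - 1) : ℂ) - σ i) (x - σ i) + ccwAngle (x - σ i) (y - σ i) =
      ccwAngle ((σ (i - 1) : ℂ) - σ i) (y - σ i) + 2 * Real.pi :=
  ccwAngle_add (sub_ne_zero.2 h.prev_ne) (sub_ne_zero.2 hx) (sub_ne_zero.2 hy)

/-- The rest of the corner, from the direction `x` on. -/
theorem IsCorner.angle_next (h : IsCorner A σ i) {x : ℂ} (hx : x ≠ σ i) (hc : InCorner σ i x) :
    ccwAngle ((σ (i - 1) : ℂ) - σ i) (x - σ i) + ccwAngle (x - σ i) ((σ (i + 1) : ℂ) - σ i) =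
      cornerAngle σ i := by
  rcases h.add hx h.next_ne with e | e
  · exact e
  · exfalso
    have := ccwAngle_le (x - σ i) ((σ (i + 1) : ℂ) - σ i)
    have e' : ccwAngle ((σ (i - 1) : ℂ) - σ i) ((σ (i + 1) : ℂ) - σ i) = cornerAngle σ i := rfl
    rw [e'] at e
    unfold InCorner at hc
    linarith

theorem cornerAngle_le : cornerAngle σ i ≤ 2 * Real.pi := ccwAngle_le _ _

/-- A reflex corner measures at least `π`, so it contains the whole open half-plane to the left of
the direction to the predecessor. -/
theorem InCorner.of_prev (h : IsReflex σ i) {x : ℂ} (hx : 0 < D 1 (σ i : ℂ) (σ (i - 1)) x) :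
    InCorner σ i x :=
  (ccwAngle_lt_pi_of_D_pos hx).trans_le (not_lt.1 h)

theorem InCorner.of_next (hc : IsCorner A σ i) (h : IsReflex σ i) {x : ℂ}
    (hx : 0 < D 1 (σ i : ℂ) x (σ (i + 1))) : InCorner σ i x := by
  have h1 := ccwAngle_lt_pi_of_D_pos hx
  have h2 : Real.pi ≤ cornerAngle σ i := not_lt.1 h
  have h3 := ccwAngle_pos (x - σ i) ((σ (i + 1) : ℂ) - σ i)
  have h4 := ccwAngle_le ((σ (i - 1) : ℂ) - σ i) (x - σ i)
  have e' : ccwAngle ((σ (i - 1) : ℂ) - σ i) ((σ (i + 1) : ℂ) - σ i) = cornerAngle σ i := rfl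
  unfold InCorner
  rcases hc.add (ne_of_D_pos hx).1 hc.next_ne with e | e <;> rw [e'] at e <;> linarith

theorem IsCorner.no_edge_prev (hc : IsCorner A σ i) (h : IsReflex σ i) {x : P}
    (hx : A.Adj (σ i) x) : ¬ 0 < D 1 (σ i : ℂ) (σ (i - 1)) x :=
  fun hd => hc.outside x hx (InCorner.of_prev h hd)

theorem IsCorner.no_edge_next (hc : IsCorner A σ i) (h : IsReflex σ i) {x : P}
    (hx : A.Adj (σ i) x) : ¬ 0 < D 1 (σ i : ℂ) x (σ (i + 1)) :=
  fun hd => hc.outside x hx (InCorner.of_next hc h hd)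

/-- A direction between a direction of the corner and the successor lies in the corner itself, where
no edge starts; the work is to exclude wrapping past `2π`. -/
theorem IsCorner.no_edge_between_next (hc : IsCorner A σ i) {d : ℂ} {x : P} (hd : InCorner σ i d)
    (h1 : 0 < D 1 (σ i : ℂ) d x) (h2 : 0 < D 1 (σ i : ℂ) x (σ (i + 1)))
    (hx : A.Adj (σ i) x) : False := by
  have e := hc.angle_next (ne_of_D_pos h1).1 hd
  have a1 := ccwAngle_lt_pi_of_D_pos h1
  have a2 := ccwAngle_lt_pi_of_D_pos h2
  have p2 := ccwAngle_pos ((x : ℂ) - σ i) ((σ (i + 1) : ℂ) - σ i)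
  have p3 := ccwAngle_pos (d - σ i) ((σ (i + 1) : ℂ) - σ i)
  have p4 := ccwAngle_pos ((σ (i - 1) : ℂ) - σ i) ((x : ℂ) - σ i)
  have hle := cornerAngle_le (σ := σ) (i := i)
  have hout := hc.outside x hx
  unfold InCorner at hd hout
  rcases ccwAngle_add (sub_ne_zero.2 (ne_of_D_pos h1).1) (sub_ne_zero.2 (ne_of_D_pos h1).2)
    (sub_ne_zero.2 hc.next_ne) with e1 | e1
  · rcases hc.add (ne_of_D_pos h1).1 (ne_of_D_pos h1).2 with e2 | e2 <;> apply hout <;> linarith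
  · linarith

theorem IsCorner.no_edge_between_prev (hc : IsCorner A σ i) {d : ℂ} {x : P} (hd : InCorner σ i d)
    (h1 : 0 < D 1 (σ i : ℂ) (σ (i - 1)) x) (h2 : 0 < D 1 (σ i : ℂ) x d)
    (hx : A.Adj (σ i) x) : False := by
  have a1 := ccwAngle_lt_pi_of_D_pos h1
  have a2 := ccwAngle_lt_pi_of_D_pos h2
  have p2 := ccwAngle_pos ((x : ℂ) - σ i) (d - σ i)
  have p3 := ccwAngle_pos ((σ (i - 1) : ℂ) - σ i) (d - σ i)
  have hout := hc.outside x hx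
  unfold InCorner at hd hout
  rcases hc.add (ne_of_D_pos h2).1 (ne_of_D_pos h2).2 with e | e
  · apply hout; linarith
  · linarith

/-- A direction in the corner can be turned counterclockwise until it meets an edge. -/
theorem InCorner.turn_left (hP : GeneralPosition P) (hc : IsCorner A σ i) {x : ℂ} {y : P}
    (hx : InCorner σ i x) (h : 0 < D 1 (σ i : ℂ) x y)
    (hb : 0 < D 1 (σ i : ℂ) x (σ (i + 1)) → ¬ 0 < D 1 (σ i : ℂ) (σ (i + 1)) y)
    (hne : σ (i + 1) ≠ y) : InCorner σ i y := by
  obtain ⟨hx0, hy0⟩ := ne_of_D_pos h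
  have e := hc.angle_next hx0 hx
  have a1 := ccwAngle_lt_pi_of_D_pos h
  have p1 := ccwAngle_pos (x - σ i) ((σ (i + 1) : ℂ) - σ i)
  have p2 := ccwAngle_pos ((σ (i + 1) : ℂ) - σ i) ((y : ℂ) - σ i)
  have p3 := ccwAngle_pos (x - σ i) ((y : ℂ) - σ i)
  have p4 := ccwAngle_pos ((σ (i - 1) : ℂ) - σ i) ((y : ℂ) - σ i)
  have hle := cornerAngle_le (σ := σ) (i := i)
  have hxle := ccwAngle_le ((σ (i + 1) : ℂ) - σ i) ((y : ℂ) - σ i)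
  have hyi : σ i ≠ y := fun e => hy0 (by rw [e])
  rcases lt_or_ge (ccwAngle (x - σ i) ((y : ℂ) - σ i))
    (ccwAngle (x - σ i) ((σ (i + 1) : ℂ) - σ i)) with hlt | hge
  · unfold InCorner
    rcases hc.add hx0 hy0 with e2 | e2 <;> linarith
  · exfalso
    have b1 := D_pos_of_ccwAngle_lt_pi hx0 hc.next_ne (by linarith)
    rcases ccwAngle_add (sub_ne_zero.2 hx0) (sub_ne_zero.2 hc.next_ne) (sub_ne_zero.2 hy0)
      with e1 | e1
    · exact hb b1 (D_pos_of_ccwAngle_lt_pi hc.next_ne hy0 (by linarith))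
    · have : ccwAngle ((σ (i + 1) : ℂ) - σ i) ((y : ℂ) - σ i) = 2 * Real.pi := by linarith
      exact D_ne_zero hP one_ne_zero hc.next.ne hyi hne
        (D_eq_zero_of_ccwAngle_eq hc.next_ne hy0 this)

/-- A direction in the corner can be turned clockwise until it meets an edge. -/
theorem InCorner.turn_right (hP : GeneralPosition P) (hc : IsCorner A σ i) {x : ℂ} {y : P}
    (hx : InCorner σ i x) (h : 0 < D 1 (σ i : ℂ) y x)
    (hb : 0 < D 1 (σ i : ℂ) y (σ (i - 1)) → ¬ 0 < D 1 (σ i : ℂ) (σ (i - 1)) x)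
    (hne : σ (i - 1) ≠ y) : InCorner σ i y := by
  obtain ⟨hy0, hx0⟩ := ne_of_D_pos h
  have a1 := ccwAngle_lt_pi_of_D_pos h
  have p1 := ccwAngle_pos ((σ (i - 1) : ℂ) - σ i) (x - σ i)
  have p2 := ccwAngle_pos ((y : ℂ) - σ i) ((σ (i - 1) : ℂ) - σ i)
  have p3 := ccwAngle_pos ((y : ℂ) - σ i) (x - σ i)
  have p4 := ccwAngle_le ((σ (i - 1) : ℂ) - σ i) ((y : ℂ) - σ i)
  have hyi : σ i ≠ y := fun e => hy0 (by rw [e])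
  have hx' := hx
  unfold InCorner at hx' ⊢
  rcases hc.add hy0 hx0 with e | e
  · linarith
  · exfalso
    have hlt : ccwAngle ((σ (i - 1) : ℂ) - σ i) (x - σ i) ≤ ccwAngle ((y : ℂ) - σ i) (x - σ i) := by
      linarith
    have b2 := D_pos_of_ccwAngle_lt_pi hc.prev_ne hx0 (by linarith)
    rcases ccwAngle_add (sub_ne_zero.2 hy0) (sub_ne_zero.2 hc.prev_ne) (sub_ne_zero.2 hx0)
      with e1 | e1
    · exact hb (D_pos_of_ccwAngle_lt_pi hy0 hc.prev_ne (by linarith)) b2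
    · have h1 := ccwAngle_le ((y : ℂ) - σ i) ((σ (i - 1) : ℂ) - σ i)
      have : ccwAngle ((σ (i - 1) : ℂ) - σ i) ((y : ℂ) - σ i) = 2 * Real.pi := by linarith
      exact D_ne_zero hP one_ne_zero hc.prev.ne hyi hne
        (D_eq_zero_of_ccwAngle_eq hc.prev_ne hy0 this)

/-- If `w` were not the successor, turning counterclockwise from `x` to `w` would stay in the
corner, since no edge lies between. This identifies the sweep vertex with the next vertex of the
walk. -/
theorem IsCorner.next_eq (hP : GeneralPosition P) (hc : IsCorner A σ i) {x : ℂ} {w : P}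
    (hx : InCorner σ i x) (hw : A.Adj (σ i) w) (h : 0 < D 1 (σ i : ℂ) x w)
    (hb : ∀ b, A.Adj (σ i) b → 0 < D 1 (σ i : ℂ) x b → 0 < D 1 (σ i : ℂ) b w → False) :
    σ (i + 1) = w := by
  by_contra hne
  exact hc.outside w hw (hx.turn_left hP hc h (fun h1 h2 => hb _ hc.next h1 h2) hne)

theorem IsCorner.prev_eq (hP : GeneralPosition P) (hc : IsCorner A σ i) {x : ℂ} {w : P}
    (hx : InCorner σ i x) (hw : A.Adj (σ i) w) (h : 0 < D 1 (σ i : ℂ) w x)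
    (hb : ∀ b, A.Adj (σ i) b → 0 < D 1 (σ i : ℂ) w b → 0 < D 1 (σ i : ℂ) b x → False) :
    σ (i - 1) = w := by
  by_contra hne
  exact hc.outside w hw (hx.turn_right hP hc h (fun h1 h2 => hb _ hc.prev h1 h2) hne)

theorem InCorner.of_between_prev (hc : IsCorner A σ i) {x y : ℂ} (hy : InCorner σ i y)
    (h1 : 0 < D 1 (σ i : ℂ) (σ (i - 1)) x) (h2 : 0 < D 1 (σ i : ℂ) x y) : InCorner σ i x := by
  have a1 := ccwAngle_lt_pi_of_D_pos h1
  have a2 := ccwAngle_lt_pi_of_D_pos h2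
  have p2 := ccwAngle_pos (x - σ i) (y - σ i)
  have p3 := ccwAngle_pos ((σ (i - 1) : ℂ) - σ i) (y - σ i)
  unfold InCorner at hy ⊢
  rcases hc.add (ne_of_D_pos h2).1 (ne_of_D_pos h2).2 with e | e <;> linarith

end Corner

end RingPhase

namespace RingPhase

/-! ### Funnels: two reflex chains with a common apex -/

section Funnel

variable {P : Finset ℂ}

/-- The situation at the end `k` of one side of a funnel with apex `c`: `u` is the neighbour of
`k` on that side, `a` and `b` are the neighbours of `c` on this and on the other side. -/
structure FunnelSide (A : SimpleGraph P) (s ε : ℝ) (k c u a b : P) : Prop where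
  near : Near s (c : ℂ) k
  adj : A.Adj k u
  free : Free A (k : ℂ) b
  pos : 0 < D ε k b c
  below : 0 < D ε k b a
  side : 0 < D ε c k a
  next_pos : 0 < D ε k b u
  next_tri : 0 ≤ D ε b c u ∧ 0 ≤ D ε c k u
  next_below : u = a ∨ (0 ≤ D ε u b a ∧ 0 ≤ D ε c u a)
  empty : ∀ v : P, InTri ε k b c v → v ≠ k → v ≠ b → 0 ≤ D ε k u v
  no_edge : ∀ x, A.Adj k x → 0 < D ε k b x → 0 < D ε k x u → False

theorem eq_lineAt {ε : ℝ} {k b c m : ℂ} (h : 0 < D ε k b c) (h0 : D ε k b m = 0) :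
    m = lineAt k b (D ε c k m / D ε k b c) := by
  have hs := D_sum ε k b c m
  have hr := re_bary ε k b c m
  have hi := im_bary ε k b c m
  rw [h0] at hs hr hi
  have e : D ε b c m = D ε k b c - D ε c k m := by linarith
  rw [e] at hr hi
  apply Complex.ext
  · simp only [lineAt]; field_simp; linarith
  · simp only [lineAt]; field_simp; linarith

/-- In a funnel, the points of one side lie beyond the line from the other end through the first
point of that side. -/
theorem D_funnel {ε : ℝ} {c k a b e : ℂ} (hab : 0 < D ε c a b) (hka : 0 ≤ D ε c k a)
    (hk : 0 ≤ D ε k b a) (he : 0 < D (-ε) e a b) (hae : 0 < D ε c a e) :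
    0 ≤ D ε e a k ∧ (0 < D ε k b a → 0 < D ε e a k) := by
  have h1 : D ε e a k * D ε c a b = D ε c a e * D ε k b a + D ε c k a * D (-ε) e a b := by
    simp only [D]; ring
  constructor
  · have : 0 ≤ D ε e a k * D ε c a b := by
      rw [h1]; exact add_nonneg (mul_nonneg hae.le hk) (mul_nonneg hka he.le)
    exact nonneg_of_mul_nonneg_left this hab
  · intro hk'
    have : 0 < D ε e a k * D ε c a b := by
      rw [h1]; exact add_pos_of_pos_of_nonneg (mul_pos hae hk') (mul_nonneg hka he.le)
    exact pos_of_mul_pos_left this hab.le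

/-- Seen from `c`, the directions to `k`, `a`, `b`, `e` follow each other counterclockwise for `ε =
1`. That the total turn stays below `π` comes from `hk` and `he`, through the Plücker relation at
`c`. -/
theorem D_funnel_apex {ε : ℝ} {c k a b e : ℂ} (hab : 0 < D ε c a b) (hka : 0 < D ε c k a)
    (hk : 0 < D ε k b a) (he : 0 < D (-ε) e a b) (hbe : 0 < D ε c b e) :
    0 < D ε c k e := by
  have pl := D_pluecker ε c k a b e
  have h1 : D ε c k b = D ε k b a + D ε c a b + D ε c k a := by simp only [D]; ring
  have h2 : D ε c a e = D (-ε) e a b + D ε c a b + D ε c b e := by simp only [D]; ring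
  have : 0 < D ε c k e * D ε c a b := by
    have e1 : D ε c k e * D ε c a b = D ε c k b * D ε c a e - D ε c k a * D ε c b e := by
      linarith
    rw [e1, h1, h2]
    nlinarith [mul_pos hk he, mul_pos hk hab, mul_pos hk hbe, mul_pos hab he, mul_pos hab hab,
      mul_pos hab hbe, mul_pos hka he, mul_pos hka hab]
  exact pos_of_mul_pos_left this hab.le

/-- The two sides of a funnel together with the crossing point `x` of the segments from the ends
to the neighbours of the apex. -/
structure Funnel (A : SimpleGraph P) (s ε : ℝ) (k e c u v a b : P) (x : ℂ) : Prop where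
  left : FunnelSide A s ε k c u a b
  right : FunnelSide A s (-ε) e c v b a
  apex : 0 < D ε c a b
  mem_left : x ∈ openSegment ℝ (k : ℂ) b
  mem_right : x ∈ openSegment ℝ (e : ℂ) a

theorem Funnel.symm {A : SimpleGraph P} {s ε : ℝ} {k e c u v a b : P} {x : ℂ}
    (h : Funnel A s ε k e c u v a b x) : Funnel A s (-ε) e k c v u b a x :=
  ⟨h.right, by rw [neg_neg]; exact h.left, by rw [D_neg, D_swap', neg_neg]; exact h.apex,
    h.mem_right, h.mem_left⟩

section Signs

variable {A : SimpleGraph P} {s ε : ℝ} {k e c u v a b : P}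

/-- These signs make the segments `k b` and `e a` cross: each line separates the ends of the other
segment. The third one keeps the neighbour `u` of `k` on the side of `k`, or on the line. -/
theorem funnel_signs (h1 : FunnelSide A s ε k c u a b) (h2 : FunnelSide A s (-ε) e c v b a)
    (hab : 0 < D ε c a b) :
    0 < D ε c k e ∧ 0 < D ε e a k ∧ 0 ≤ D ε e a u ∧ D ε k b e < 0 := by
  have hae : 0 < D ε c a e := by
    have := h2.pos; rw [D_neg, D_rot, D_swap, neg_neg] at this; exact this
  have hbe : 0 < D ε c b e := by have := h2.side; rw [D_neg, D_swap', neg_neg] at this; exact this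
  have hkb : 0 < D ε c k b := by rw [D_rot]; exact h1.pos
  refine ⟨D_funnel_apex hab h1.side h1.below h2.below hbe,
    (D_funnel hab h1.side.le h1.below.le h2.below hae).2 h1.below, ?_, ?_⟩
  · rcases h1.next_below with e | ⟨e1, e2⟩
    · rw [e, D_right]
    · exact (D_funnel hab e2 e1 h2.below hae).1
  · have := (D_funnel (ε := -ε) (c := c) (k := e) (a := b) (b := a) (e := k)
      (by rw [D_neg, D_swap', neg_neg]; exact hab) h2.side.le h2.below.le
      (by rw [neg_neg]; exact h1.below) (by rw [D_neg, D_swap', neg_neg]; exact hkb)).2 h2.below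
    rw [D_neg] at this
    linarith

end Signs

theorem exists_funnel {A : SimpleGraph P} {s ε : ℝ} {k e c u v a b : P}
    (h1 : FunnelSide A s ε k c u a b) (h2 : FunnelSide A s (-ε) e c v b a)
    (hab : 0 < D ε c a b) : ∃ x, Funnel A s ε k e c u v a b x := by
  obtain ⟨-, s2, -, s4⟩ := funnel_signs h1 h2 hab
  have hb := h2.below
  rw [D_neg] at hb
  obtain ⟨x, hx1, hx2⟩ := exists_crossing s2 (by linarith : D ε (e : ℂ) a b < 0) h1.below s4
  exact ⟨x, h1, h2, hab, hx1, hx2⟩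

namespace Funnel

variable {A : SimpleGraph P} {s ε : ℝ} {k e c u v a b : P} {x : ℂ}

theorem signs (h : Funnel A s ε k e c u v a b x) :
    0 < D ε c k e ∧ 0 < D ε e a k ∧ 0 ≤ D ε e a u ∧ D ε k b e < 0 :=
  funnel_signs h.left h.right h.apex

theorem free_left (h : Funnel A s ε k e c u v a b x) : Free A (k : ℂ) x := by
  obtain ⟨t, t0, t1, hre, him⟩ := exists_of_mem_openSegment h.mem_left
  intro z hz
  obtain ⟨r, r0, r1, hre', him'⟩ := exists_of_mem_openSegment hz
  refine h.left.free z (mem_openSegment_of (t := r * t) (mul_pos r0 t0) (by nlinarith) ?_ ?_)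
  · rw [hre', hre]; ring
  · rw [him', him]; ring

theorem exists_left (h : Funnel A s ε k e c u v a b x) :
    ∃ t : ℝ, 0 < t ∧ t < 1 ∧ (∀ δ z, D δ k x z = t * D δ k b z) ∧
      ∀ δ p q, D δ p q x = (1 - t) * D δ p q k + t * D δ p q b := by
  obtain ⟨t, t0, t1, hre, him⟩ := exists_of_mem_openSegment h.mem_left
  refine ⟨t, t0, t1, fun δ z => ?_, D_interp hre him⟩
  simp only [D]; rw [hre, him]; ring

theorem pos (h : Funnel A s ε k e c u v a b x) : 0 < D (-ε) k x e := by
  obtain ⟨t, t0, -, ht, -⟩ := h.exists_left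
  rw [ht, D_neg]
  have := h.signs.2.2.2
  exact mul_pos t0 (by linarith)

theorem notMem (h : Funnel A s ε k e c u v a b x) : x ∉ drawing A :=
  h.left.free x h.mem_left

theorem exists_fan (hP : GeneralPosition P) (hA : IsPSLG A)
    (h : Funnel A s ε k e c u v a b x) : ∃ w, IsFan A (-ε) k x e w := by
  refine RingPhase.exists_fan hP hA h.pos h.free_left h.symm.free_left.symm.bar ?_ ?_
  · intro v hv
    exact h.notMem (hv ▸ vertex_mem_drawing A v)
  · intro a b hab hx
    exact absurd (openSegment_subset_drawing hab hx) h.notMem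

/-- The neighbour of the apex on the other side lies in the triangle of the ends and the apex. -/
theorem mem_hull (h : Funnel A s ε k e c u v a b x) :
    (b : ℂ) ∈ convexHull ℝ ({(k : ℂ), (c : ℂ), (e : ℂ)} : Set ℂ) := by
  obtain ⟨s1, s2, s3, s4⟩ := h.signs
  have hbe : 0 < D ε c b e := by
    have := h.right.side; rw [D_neg, D_swap', neg_neg] at this; exact this
  refine mem_convexHull_of_inTri (ε := -ε) ?_ ⟨?_, ?_, ?_⟩
  · rw [D_neg, D_swap, neg_neg]; exact s1
  · rw [D_neg, D_swap, neg_neg, D_rot]; exact h.left.pos.le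
  · rw [D_neg, D_swap', neg_neg]; exact hbe.le
  · rw [D_neg, D_swap, neg_neg, D_swap', Left.nonneg_neg_iff]; exact s4.le

theorem mem_hull_crossing (h : Funnel A s ε k e c u v a b x) :
    x ∈ convexHull ℝ ({(k : ℂ), (c : ℂ), (e : ℂ)} : Set ℂ) :=
  (convex_convexHull ℝ _).segment_subset (subset_convexHull ℝ _ (by simp)) h.mem_hull
    (openSegment_subset_segment ℝ _ _ h.mem_left)

theorem mem_hull_next (h : Funnel A s ε k e c u v a b x) :
    (u : ℂ) ∈ convexHull ℝ ({(k : ℂ), (c : ℂ), (e : ℂ)} : Set ℂ) :=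
  convexHull_triple_subset (convex_convexHull ℝ _) (subset_convexHull ℝ _ (by simp)) h.mem_hull
    (subset_convexHull ℝ _ (by simp)) (mem_convexHull_of_inTri h.left.pos
      ⟨h.left.next_pos.le, h.left.next_tri.1, h.left.next_tri.2⟩)

theorem mem_hull_fan (h : Funnel A s ε k e c u v a b x) {w : P} (hw : IsFan A (-ε) k x e w) :
    (w : ℂ) ∈ convexHull ℝ ({(k : ℂ), (c : ℂ), (e : ℂ)} : Set ℂ) :=
  convexHull_triple_subset (convex_convexHull ℝ _) (subset_convexHull ℝ _ (by simp))
    h.mem_hull_crossing (subset_convexHull ℝ _ (by simp))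
    (mem_convexHull_of_inTri h.pos hw.inTri)

/-- If `k e` were an edge, `N(k)` would contain the whole triangle `k c e`, in particular `b`, which
`k` sees; this contradicts maximality. -/
theorem not_adj (hA : IsMaximalPSLG s A) (h : Funnel A s ε k e c u v a b x) : ¬ A.Adj k e := by
  intro hke
  have hne : k ≠ b := by
    intro e; have := h.left.pos; rw [e, D_self] at this; exact lt_irrefl _ this
  exact not_near_of_free hA hne h.left.free
    (near_of_mem_hull (near_refl s k) h.left.near.symm (near_of_adj hA hke) h.mem_hull)

end Funnel

end Funnel

end RingPhase

namespace RingPhase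

/-! ### The pocket of a funnel is empty -/

section Funnel

variable {P : Finset ℂ}

namespace Funnel

variable {A : SimpleGraph P} {s ε : ℝ} {k e c u v a b : P} {x : ℂ}

theorem crossing_pos (h : Funnel A s ε k e c u v a b x) : 0 < D ε c k x := by
  obtain ⟨t, t0, t1, ht, hi⟩ := h.exists_left
  rw [hi, D_right, mul_zero, zero_add, D_rot]
  exact mul_pos t0 h.left.pos

theorem apex_pos (h : Funnel A s ε k e c u v a b x) {w : P} (hw : IsFan A (-ε) k x e w) :
    0 < D ε c k w := by
  have s1 := h.signs.1
  have hckx := h.crossing_pos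
  have e1 : D (-ε) k x e * D ε c k w =
      D (-ε) x e w * D ε c k k + D (-ε) e k w * D ε c k x + D (-ε) k x w * D ε c k e := by
    simp only [D]; ring
  have : 0 < D (-ε) k x e * D ε c k w := by
    rw [e1, D_right]
    have := mul_pos hw.pos s1
    have := mul_nonneg hw.le_end hckx.le
    linarith
  exact pos_of_mul_pos_right this h.pos.le

/-- The first vertex of the pocket of a funnel, seen from the end `k`, sees the neighbour of `k`
on the side of the funnel. -/
theorem free_next (hP : GeneralPosition P) (hA : IsPSLG A) (h : Funnel A s ε k e c u v a b x)
    {w : P} (hw : IsFan A (-ε) k x e w) : Free A (w : ℂ) u := by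
  have hε := ne_zero_of_D_pos h.apex
  obtain ⟨s1, s2, s3, s4⟩ := h.signs
  obtain ⟨t, t0, t1, ht, hi⟩ := h.exists_left
  have hku : k ≠ u := h.left.adj.ne
  have hkw : k ≠ w := hw.ne
  have hu := h.left.next_pos
  have hw0 : D ε k b w < 0 := by
    have := hw.pos
    rw [ht, D_neg] at this
    have := pos_of_mul_pos_right this t0.le
    linarith
  have hLw : 0 ≤ D ε e a w := by
    obtain ⟨r, r0, -, hr, -⟩ := h.symm.exists_left
    have := hw.inside
    rw [D_neg, D_swap, neg_neg, hr] at this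
    exact nonneg_of_mul_nonneg_right this r0
  have hLb : D ε e a b < 0 := by
    have := h.right.below; rw [D_neg] at this; linarith
  have hckw := h.apex_pos hw
  have hwu : 0 < D ε k w u := by
    have e1 : D ε k w u * D ε k b c =
        (- D ε k b w) * D ε c k u + D ε c k w * D ε k b u := by
      simp only [D]; ring
    have : 0 < D ε k w u * D ε k b c := by
      rw [e1]
      have := mul_pos hckw hu
      have := mul_nonneg (neg_pos.2 hw0).le h.left.next_tri.2
      linarith
    exact pos_of_mul_pos_left this h.left.pos.le
  have huw : u ≠ w := by rintro rfl; rw [D_right] at hwu; exact lt_irrefl _ hwu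
  have hukw : 0 < D ε u k w := by rwa [D_rot]
  -- the point `m` where the segment `u w` crosses the segment `k b`
  have hd : 0 < D ε k b u - D ε k b w := by linarith
  set r := D ε k b u / (D ε k b u - D ε k b w) with hr
  have r0 : 0 < r := div_pos hu hd
  have r1 : r < 1 := by rw [hr, div_lt_one hd]; linarith
  have hmuw := lineAt_mem (a := (u : ℂ)) (b := w) r0 r1
  set m := lineAt u w r with hm
  have m0 : D ε k b m = 0 := by rw [hm, D_lineAt, hr]; field_simp; ring
  have hckm : 0 < D ε c k m := by
    rw [hm, D_lineAt]
    nlinarith [mul_nonneg (sub_pos.2 r1).le h.left.next_tri.2, mul_pos r0 hckw]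
  obtain ⟨l, l0, hl⟩ : ∃ l, 0 < l ∧ m = lineAt k b l :=
    ⟨_, div_pos hckm h.left.pos, eq_lineAt h.left.pos m0⟩
  have hLm : 0 ≤ D ε e a m := by
    rw [hm, D_lineAt]
    exact add_nonneg (mul_nonneg (sub_pos.2 r1).le s3) (mul_nonneg r0.le hLw)
  -- The point `m` is not beyond the line `e a`, whereas `b` is, so `m` comes before `b` on the ray
  -- from `k`.
  have l1 : l < 1 := by
    by_contra hc
    push Not at hc
    rw [hl, D_lineAt] at hLm
    nlinarith [mul_nonneg (sub_nonneg.2 hc) s2.le, mul_pos l0 (neg_pos.2 hLb)]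
  have hmkb : m ∈ openSegment ℝ (k : ℂ) b := hl ▸ lineAt_mem l0 l1
  have em1 : ∀ z, D ε k m z = l * D ε k b z := by
    intro z; rw [hl]; simp only [lineAt, D]; ring
  have em2 : ∀ z, D ε m u z = r * D ε w u z := by
    intro z; rw [hm]; simp only [lineAt, D]; ring
  have em3 : ∀ z, D ε w m z = (1 - r) * D ε w u z := by
    intro z; rw [hm]; simp only [lineAt, D]; ring
  have hukm : 0 < D ε u k m := by
    rw [hm, D_lineAt, D_left, mul_zero, zero_add]; exact mul_pos r0 hukw
  have hkwm : 0 < D ε k w m := by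
    rw [hm, D_lineAt, D_right, mul_zero, add_zero]; exact mul_pos (sub_pos.2 r1) hwu
  -- vertices in the triangle `u k w`
  have hverts : ∀ y : P, InTri ε u k w y → 0 < D ε w u y → y = k := by
    intro y hy hy'
    by_contra hyk
    have hyu : y ≠ u := by rintro rfl; rw [D_right] at hy'; exact lt_irrefl _ hy'
    have hyw : y ≠ w := by rintro rfl; rw [D_left] at hy'; exact lt_irrefl _ hy'
    -- The segment `k m` cuts the triangle in two. Below it `y` would precede `w` in the pocket
    -- sweep, on it `y` would block the free segment `k b`, and above it `y` would contradict
    -- `empty`.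
    rcases lt_trichotomy (D ε k b y) 0 with hlt | heq | hgt
    · have hT : InTri ε k w m y := by
        refine ⟨hy.2.1, ?_, ?_⟩
        · rw [em3]; exact (mul_pos (sub_pos.2 r1) hy').le
        · rw [D_swap, em1]; nlinarith
      have hke : 0 < D (-ε) e k b := by
        rw [D_neg, ← neg_pos] at *; rw [D_rot]; linarith
      have hmin := hw.min y ⟨?_, ?_, ?_⟩ ?_
      · rw [D_neg] at hmin
        exact D_ne_zero hP hε hkw (Ne.symm hyk) (Ne.symm hyw) (le_antisymm (by linarith) hy.2.1)
      · rw [ht, D_neg]; nlinarith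
      · refine D_nonneg_of_inTri hkwm hT ?_ hw.inside ?_
        · rw [← D_rot]; exact h.pos.le
        · obtain ⟨q, q0, -, hq, -⟩ := h.symm.exists_left
          rw [D_neg, D_swap, neg_neg, hq]
          exact mul_nonneg q0.le hLm
      · refine D_nonneg_of_inTri hkwm hT (D_right _ _ _).ge hw.le_end ?_
        rw [hl, D_lineAt, D_right, mul_zero, zero_add]
        exact (mul_pos l0 hke).le
      · rw [ht, D_neg]; nlinarith
    · have : 0 < D ε m u y := by rw [em2]; exact mul_pos r0 hy'
      rcases eq_or_mem_openSegment' hukm (by rw [em1, heq, mul_zero]) this hy.1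
        with ⟨e, -⟩ | ⟨e, -⟩
      · exact hyk (Subtype.ext e)
      · obtain ⟨q, q0, q1, hre, him⟩ := exists_of_mem_openSegment e
        refine h.left.free y (mem_openSegment_of (t := q * l) (mul_pos q0 l0) (by nlinarith) ?_ ?_)
          (vertex_mem_drawing A y)
        · rw [hre, hl]; simp only [lineAt]; ring
        · rw [him, hl]; simp only [lineAt]; ring
    · have hT : InTri ε u k m y := by
        refine ⟨hy.1, ?_, ?_⟩
        · rw [em1]; exact (mul_pos l0 hgt).le
        · rw [em2]; exact (mul_pos r0 hy').le
      have hyb : y ≠ b := by rintro rfl; rw [D_right] at hgt; exact lt_irrefl _ hgt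
      have hbck : 0 < D ε b c k := by rw [← D_rot]; exact h.left.pos
      have hE := h.left.empty y ⟨hgt.le, ?_, ?_⟩ hyk hyb
      · refine D_ne_zero hP hε hku (Ne.symm hyk) (Ne.symm hyu) (le_antisymm ?_ hE)
        have := hy.1
        rw [D_swap] at this
        linarith
      · refine D_nonneg_of_inTri hukm hT h.left.next_tri.1 hbck.le ?_
        rw [hl, D_lineAt, D_left, mul_zero, add_zero]
        exact (mul_pos (sub_pos.2 l1) hbck).le
      · exact D_nonneg_of_inTri hukm hT h.left.next_tri.2 (D_right _ _ _).ge hckm.le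
  intro z hz hzd
  rw [openSegment_symm] at hz
  obtain ⟨q, q0, q1, hre, him⟩ := exists_of_mem_openSegment hz
  have z1 : 0 < D ε u k z := by
    rw [D_interp hre him, D_left, mul_zero, zero_add]; exact mul_pos q0 hukw
  have z2 : 0 < D ε k w z := by
    rw [D_interp hre him, D_right, mul_zero, add_zero]; exact mul_pos (sub_pos.2 q1) hwu
  have z3 : D ε w u z = 0 := by rw [D_interp hre him, D_left, D_right]; ring
  rcases vertex_or_edge_of_mem_drawing hzd with ⟨y, rfl⟩ | ⟨a', b', hab, hab'⟩
  · refine D_ne_zero hP hε huw.symm ?_ ?_ z3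
    · rintro rfl; rw [D_right] at z2; exact lt_irrefl _ z2
    · rintro rfl; rw [D_left] at z1; exact lt_irrefl _ z1
  · have hkwB : Bar A k w := by
      rcases hw.adj_or_free with hc | hc
      · exact bar_of_adj hA hc
      · exact hc.bar
    obtain ⟨a0, b0⟩ := tri_cross hukw (bar_of_adj hA h.left.adj.symm) hkwB
      (fun a b hab hm => absurd hm (hA.1 a b k hab)) z1 z2 z3.ge (fun a' b' hab hz' ha ha' => by
        obtain rfl := hverts a' ha ha'
        obtain ⟨p, p0, p1, hre', him'⟩ := exists_of_mem_openSegment hz'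
        have ez : ∀ y, D ε a' y z = p * D ε a' y b' := by
          intro y; rw [D_interp hre' him', D_left]; ring
        have z1' : 0 < D ε a' z u := by rw [D_rot, D_rot]; exact z1
        -- The same division for an edge at `k`: the pocket sweep excludes one side of `k b`, the
        -- side of the funnel the other, and freeness of `k b` the direction itself.
        rcases lt_trichotomy (D ε a' b b') 0 with hlt | heq | hgt
        · refine hw.no_edge b' hab ?_ ?_
          · rw [ht, D_neg]; nlinarith
          · rw [ez] at z2
            have := pos_of_mul_pos_right z2 p0.le
            rwa [D_neg, D_swap', neg_neg]
        · have hb' : b' = b := by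
            by_contra hne
            refine D_ne_zero hP hε ?_ hab.ne (Ne.symm hne) heq
            intro e; rw [e, D_self] at hu; exact lt_irrefl _ hu
          exact h.left.free.not_adj (hb' ▸ hab)
        · refine h.left.no_edge b' hab hgt ?_
          have e1 : D ε a' z u = - D ε a' u z := D_swap' _ _ _ _
          rw [ez] at e1
          rw [D_swap']
          have : 0 < p * (- D ε a' u b') := by linarith
          exact pos_of_mul_pos_right this p0.le) hab hab'
    rw [← D_one_eq_zero hε] at a0 b0
    -- Only the edge `u w` itself could lie on this line, but it would cross the free segment `k b`
    -- at `m`.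
    have hadj := edge_eq_of_collinear hP huw.symm hab a0 b0
    exact h.left.free m hmkb (openSegment_subset_drawing hadj.symm hmuw)

/-- Both `u` and `w` lie in `N(k)` and in the triangle `k c e`, so they lie in neighbouring cells;
yet they see each other. -/
theorem not_near_fan (hP : GeneralPosition P) (hA : IsMaximalPSLG s A)
    (h : Funnel A s ε k e c u v a b x) {w : P} (hw : IsFan A (-ε) k x e w)
    (hkw : Near s (k : ℂ) w) : False := by
  have hne : w ≠ u := by
    rintro rfl
    obtain ⟨t, t0, -, ht, -⟩ := h.exists_left
    have h1 := hw.pos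
    rw [ht, D_neg] at h1
    have h2 := h.left.next_pos
    nlinarith [mul_pos t0 h2]
  exact not_near_of_free hA hne (h.free_next hP hA.1.1 hw)
    (near_of_near_of_mem_hull h.left.near h.right.near (h.mem_hull_next) (h.mem_hull_fan hw)
      (near_of_adj hA h.left.adj) hkw).symm

/-- The two ends of a funnel see each other: there is no vertex in the pocket. -/
theorem fan_eq (hP : GeneralPosition P) (hA : IsMaximalPSLG s A)
    (h : Funnel A s ε k e c u v a b x) : IsFan A (-ε) k x e e := by
  have hε := ne_zero_of_D_pos h.apex
  obtain ⟨s1, s2, s3, s4⟩ := h.signs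
  obtain ⟨w, hw⟩ := h.exists_fan hP hA.1.1
  by_cases hwe : w = e
  · rwa [hwe] at hw
  exfalso
  have hkw := hw.ne
  have hke : k ≠ e := by intro e'; rw [e', D_right] at s1; exact lt_irrefl _ s1
  have hn := near_or_near_of_mem_hull h.left.near h.right.near (h.mem_hull_fan hw)
  rcases hn with hn | hn
  · exact h.not_near_fan hP hA hw hn
  -- Now `w` lies in `N(e)`. The sweep from the other end meets some `w'` first, and it suffices
  -- that `w'` lies in `N(e)`.
  obtain ⟨w', hw'⟩ := h.symm.exists_fan hP hA.1.1
  rw [neg_neg] at hw'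
  have hwek : 0 < D (-ε) e k w :=
    lt_of_le_of_ne hw.le_end (Ne.symm (D_ne_zero hP (neg_ne_zero.2 hε) hke.symm (Ne.symm hwe) hkw))
  refine h.symm.not_near_fan hP hA (w := w') (by rw [neg_neg]; exact hw') ?_
  -- `w'` lies in the triangle `w c e`
  have hpos := h.pos
  have htri : InTri ε e x k w := by
    refine ⟨?_, ?_, ?_⟩
    · have := hw.inside; rwa [D_neg, D_swap, neg_neg] at this
    · have := hw.pos.le; rwa [D_neg, D_swap, neg_neg] at this
    · have := hwek.le; rwa [D_neg, D_swap, neg_neg] at this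
  have htri' : InTri (-ε) k x e w' := by
    refine ⟨?_, ?_, ?_⟩
    · have := hw'.inside; rwa [D_neg, D_swap, neg_neg]
    · have := hw'.pos.le; rwa [D_neg, D_swap, neg_neg]
    · have := hw'.le_end; rwa [D_neg, D_swap, neg_neg]
  -- The vertex `w` is itself in the pocket, so the sweep at `e` meets it no earlier than `w'`. `c2`
  -- is the mirror statement; together they confine `w'` to the triangle `w c e`.
  have c1 : 0 ≤ D ε e w' w := by
    rcases htri.1.eq_or_lt with h0 | h0
    · exfalso
      refine h.symm.free_left.eq_of_collinear (ε := ε) (y := (k : ℂ)) (v := w) ?_ ?_ h0.symm ?_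
        htri.2.1
      · rw [D_neg, ← D_rot, D_swap', neg_neg] at hpos; exact hpos
      · intro v hv; exact h.notMem (hv ▸ vertex_mem_drawing A v)
      · have := hwek; rwa [D_neg, D_swap, neg_neg] at this
    · exact hw'.min w htri h0
  have hw'k : w' ≠ k := by
    rintro rfl
    rw [D_neg] at hwek
    linarith
  have c2 : 0 ≤ D (-ε) k w w' := by
    rcases htri'.1.eq_or_lt with h0 | h0
    · exfalso
      refine h.free_left.eq_of_collinear h.pos ?_ h0.symm
        (lt_of_le_of_ne htri'.2.2
          (Ne.symm (D_ne_zero hP (neg_ne_zero.2 hε) hke.symm hw'.ne hw'k.symm))) htri'.2.1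
      intro v hv; exact h.notMem (hv ▸ vertex_mem_drawing A v)
    · exact hw.min w' htri' h0
  have hecx : 0 < D ε e c x := by
    have := h.symm.crossing_pos
    rwa [D_neg, D_swap, neg_neg] at this
  have heck : 0 < D ε e c k := by rwa [D_rot]
  have hcwe : 0 < D ε c w e := by
    have e1 : D (-ε) k x e * D ε c w e =
        D (-ε) x e w * D ε e c k + D (-ε) e k w * D ε e c x := by
      simp only [D]; ring
    have : 0 < D (-ε) k x e * D ε c w e := by
      rw [e1]
      have := mul_pos hwek hecx
      have := mul_nonneg hw.inside heck.le
      linarith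
    exact pos_of_mul_pos_right this h.pos.le
  have hT : InTri ε c w e w' := by
    refine ⟨?_, by rw [D_rot]; exact c1,
      D_nonneg_of_inTri h.pos htri' heck.le hecx.le (D_left _ _ _).ge⟩
    have pl := D_pluecker ε w k c e w'
    have q1 : 0 < D ε w k e := by
      rw [D_neg, D_swap, neg_neg] at hwek; rwa [D_rot]
    have q2 : 0 < D ε w c k := by rw [D_rot]; exact h.apex_pos hw
    have q3 : D ε w k c = - D ε w c k := D_swap' _ _ _ _
    have q4 : 0 ≤ D ε w k w' := by
      rwa [D_neg, D_swap, neg_neg] at c2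
    have q5 : D ε w c e = - D ε c w e := D_swap _ _ _ _
    have q6 : 0 ≤ D ε w e w' := by rw [D_rot]; exact c1
    have : 0 ≤ D ε w k e * (- D ε w c w') := by
      have e1 : D ε w k e * (- D ε w c w') =
          D ε w c k * D ε w e w' + D ε w k w' * D ε c w e := by
        rw [q3, q5] at pl; linarith
      rw [e1]
      exact add_nonneg (mul_nonneg q2.le q6) (mul_nonneg q4 hcwe.le)
    have := nonneg_of_mul_nonneg_right this q1
    rwa [D_swap]
  exact near_of_mem_hull h.right.near.symm hn (near_refl s e) (mem_convexHull_of_inTri hcwe hT)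

end Funnel

end Funnel

end RingPhase

namespace RingPhase

/-! ### From chains of sweeps to the sides of a funnel -/

section Chain

variable {P : Finset ℂ}

/-- The vertex `v` lies in the triangle `k p c`, off the sides at `k`. -/
structure Inside (ε : ℝ) (c p k v : ℂ) : Prop where
  tri : InTri ε k p c v
  pos : 0 < D ε k p v
  side : 0 < D ε c k v

/-- Since `p` lies between `c` and `d`, the ray from `k` to `d` comes before the ray to `p`; what is
past the latter is past the former. -/
theorem D_end_pos {ε : ℝ} {c d p k v : ℂ} (hp : p ∈ openSegment ℝ c d) (h : 0 < D ε k p c)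
    (hv : InTri ε k p c v) (hv' : 0 < D ε k p v) : 0 < D ε k d v := by
  obtain ⟨t, t0, t1, ht, hi⟩ := D_edge hp
  have hdc : 0 < D ε k d c := by
    have := (D_pos_edge hp (z := k) (δ := ε) (by rw [← D_rot]; exact h)).1
    rw [D_rot]; exact this
  have hkp : 0 ≤ D ε k d p := by
    rw [hi, D_right, mul_zero, add_zero]; exact mul_nonneg (by linarith) hdc.le
  have : 0 < D ε k p c * D ε k d v := by
    rw [D_bary ε k p c k d v, D_left]
    have := mul_pos hv' hdc
    have := mul_nonneg hv.2.2 hkp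
    linarith
  exact pos_of_mul_pos_right this h.le

/-- The triangles with the common side `p c` are nested, so membership propagates along the chain.
-/
theorem Inside.trans {ε : ℝ} {c p k u v : ℂ} (h : 0 < D ε k p c) (hu : 0 < D ε u p c)
    (h1 : Inside ε c p k u) (h2 : Inside ε c p u v) : Inside ε c p k v := by
  have hckp : 0 < D ε c k p := by rwa [D_rot]
  have hpck : 0 < D ε p c k := by rwa [← D_rot]
  refine ⟨⟨?_, ?_, ?_⟩, ?_, ?_⟩
  · exact D_nonneg_of_inTri hu h2.tri h1.tri.1 (D_right _ _ _).ge h.le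
  · exact h2.tri.2.1
  · exact D_nonneg_of_inTri hu h2.tri h1.tri.2.2 hckp.le (D_left _ _ _).ge
  · have : 0 < D ε u p c * D ε k p v := by
      rw [D_bary ε u p c k p v, D_right]
      have := mul_pos h2.pos h
      have := mul_nonneg h2.tri.2.1 h1.pos.le
      linarith
    exact pos_of_mul_pos_right this hu.le
  · have : 0 < D ε u p c * D ε c k v := by
      rw [D_bary ε u p c c k v, D_left]
      have := mul_pos h2.side hckp
      have := mul_nonneg h2.tri.2.1 h1.side.le
      linarith
    exact pos_of_mul_pos_right this hu.le

theorem IsFan.isInside (hP : GeneralPosition P) {A : SimpleGraph P} {ε : ℝ} {k c w : P} {p : ℂ}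
    (h : 0 < D ε k p c) (hw : IsFan A ε k p c w) (hwc : w ≠ c) : Inside ε c p k w := by
  refine ⟨hw.inTri, hw.pos, lt_of_le_of_ne hw.le_end (Ne.symm ?_)⟩
  refine D_ne_zero hP (ne_zero_of_D_pos h) ?_ hwc.symm hw.ne
  rintro rfl
  rw [D_left] at h
  exact lt_irrefl _ h

/-- Two sweeps leave `p` in opposite directions at `k`. Their first vertices span an angle below
`π`, because both lie within the triangle `k d c`. -/
theorem D_fan_fan {A : SimpleGraph P} {ε : ℝ} {c d k u w : P} {p : ℂ}
    (hp : p ∈ openSegment ℝ (c : ℂ) d) (h : 0 < D ε k p c) (hu : IsFan A ε k p c u)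
    (hw : IsFan A (-ε) k p d w) : 0 < D ε k w u := by
  obtain ⟨t, t0, t1, ht, hi⟩ := D_edge hp
  have g := (D_pos_edge hp (z := (k : ℂ)) (δ := ε) (by rw [← D_rot]; exact h)).2.2
  have hckp : 0 < D ε c k p := by rwa [D_rot]
  have hckd : 0 < D ε c k d := by
    rw [hi, D_left, mul_zero, zero_add] at hckp
    exact pos_of_mul_pos_right hckp t0.le
  have hckw : 0 < D ε k w c := by
    have e : D (-ε) k p d * D ε k w c = D (-ε) d k w * D ε c k p + D (-ε) k p w * D ε c k d := by
      simp only [D]; ring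
    have : 0 < D (-ε) k p d * D ε k w c := by
      rw [e]
      have := mul_pos hw.pos hckd
      have := mul_nonneg hw.le_end hckp.le
      linarith
    exact pos_of_mul_pos_right this g.le
  have h1 := hw.pos
  rw [D_neg, D_swap', neg_neg] at h1
  have h2 : 0 ≤ D ε k u c := by rw [← D_rot]; exact hu.le_end
  have pl := D_pluecker ε k w p u c
  have : 0 < D ε k w u * D ε k p c := by
    have e : D ε k w u * D ε k p c = D ε k w p * D ε k u c + D ε k w c * D ε k p u := by linarith
    rw [e]
    have := mul_pos hckw hu.pos
    have := mul_nonneg h1.le h2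
    linarith
  exact pos_of_mul_pos_left this h.le

/-- The side of a funnel given by a chain of sweeps. -/
theorem ChainView.funnelSide (hP : GeneralPosition P) {s : ℝ} {A : SimpleGraph P}
    (hA : IsPSLG A) {f : Set ℂ} (hf : IsFace A f) {ε : ℝ} {c d k u a : P} {p : ℂ}
    (hcd : A.Adj c d) (hp : p ∈ openSegment ℝ (c : ℂ) d) (h : ChainView A s f ε c p k)
    (hu : IsFan A ε k p c u) (hku : A.Adj k u) (hd : IsFan A (-ε) k p d d)
    (hkd : Free A (k : ℂ) d) (ha : Inside ε c p k a)
    (hua : u = a ∨ (0 < D ε u p c ∧ Inside ε c p u a)) : FunnelSide A s ε k c u a d := by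
  obtain ⟨t, t0, t1, ht, hi⟩ := D_edge hp
  have hp' : p ∈ openSegment ℝ (d : ℂ) c := by rwa [openSegment_symm]
  obtain ⟨t', t0', t1', ht', -⟩ := D_edge hp'
  have hε := ne_zero_of_D_pos h.pos
  have hpP := (bar_edge hA hcd hp).2.1
  have hfree := hf.free h.seg
  have hkd' : k ≠ d := hd.ne
  have hkc : k ≠ c := by rintro rfl; have := h.pos; rw [D_left] at this; exact lt_irrefl _ this
  have hkdc : 0 < D ε k d c := D_end_pos hp h.pos
    ⟨h.pos.le, (D_right _ _ _).ge, (D_left _ _ _).ge⟩ h.pos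
  have hkdp : 0 < D ε k d p := by
    rw [hi, D_right, mul_zero, add_zero]; exact mul_pos (by linarith) hkdc
  refine ⟨h.near, hku, hkd, hkdc, D_end_pos hp h.pos ha.tri ha.pos, ha.side,
    D_end_pos hp h.pos hu.inTri hu.pos, ⟨?_, hu.le_end⟩, ?_, ?_, ?_⟩
  · have := hu.inside
    rw [ht] at this
    exact nonneg_of_mul_nonneg_right this t0
  · rcases hua with e | ⟨e1, e2⟩
    · exact Or.inl e
    · exact Or.inr ⟨(D_end_pos hp e1 e2.tri e2.pos).le, e2.side.le⟩
  · intro v hv hvk hvd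
    have hpc : 0 ≤ D ε p c v := by rw [ht]; exact mul_nonneg t0.le hv.2.1
    -- The segment `k p` divides the triangle `k d c`: one part is swept up to `u`, the other up to
    -- `d` itself, and so contains no further vertex in its inside.
    rcases lt_trichotomy (D ε k p v) 0 with hlt | heq | hgt
    · exfalso
      have := hd.min v ⟨?_, ?_, ?_⟩ ?_
      · rw [D_neg] at this
        exact D_ne_zero hP hε hkd' (Ne.symm hvk) (Ne.symm hvd) (le_antisymm (by linarith) hv.1)
      · rw [D_neg]; linarith
      · rw [ht', D_neg, D_swap, neg_neg]; exact mul_nonneg t0'.le hv.2.1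
      · rw [D_neg, D_swap, neg_neg]; exact hv.1
      · rw [D_neg]; linarith
    · exfalso
      refine hfree.eq_of_collinear h.pos hpP heq (lt_of_le_of_ne hv.2.2 (Ne.symm ?_)) hpc
      refine D_ne_zero hP hε hkc.symm ?_ (Ne.symm hvk)
      rintro rfl
      exact h.pos.ne' heq
    · exact hu.min v ⟨hgt.le, hpc, hv.2.2⟩ hgt
  · intro x hx x1 x2
    rcases lt_trichotomy (D ε k p x) 0 with hlt | heq | hgt
    · refine hd.no_edge x hx ?_ ?_
      · rw [D_neg]; linarith
      · rw [D_neg, D_swap', neg_neg]; exact x1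
    · have e := eq_lineAt h.pos heq
      set l := D ε c k x / D ε k p c with hl
      have l0 : 0 < l := by
        rw [e, D_lineAt, D_left, mul_zero, zero_add] at x1
        exact pos_of_mul_pos_left x1 hkdp.le
      -- The parameter `1 / (1 + l)` on `k x` is `l / (1 + l)` on `k p`. Both are below one whatever
      -- the size of `l`, so this point lies inside the edge and inside the free segment.
      have hl1 : 0 < 1 + l := by linarith
      have h1 : 1 / (1 + l) < 1 := by rw [div_lt_one hl1]; linarith
      have hm := lineAt_mem (a := (k : ℂ)) (b := x) (t := 1 / (1 + l)) (by positivity) h1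
      refine hfree _ (mem_openSegment_of (t := l / (1 + l)) (by positivity)
        (by rw [div_lt_one hl1]; linarith) ?_ ?_) (openSegment_subset_drawing hx hm)
      · rw [e]; simp only [lineAt]; ring
      · rw [e]; simp only [lineAt]; ring
    · exact hu.no_edge x hx hgt x2

end Chain

end RingPhase

namespace RingPhase

/-! ### Views of a convex vertex along the boundary walk -/

section Views

variable {P : Finset ℂ} {s : ℝ} {A : SimpleGraph P} {f : Set ℂ} {σ : ℤ → P}

/-- The reflex chain from `k` to the convex position `c`, seen from a point `p` of the edge from
`c` to `c + 1`. -/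
structure ForwardView (A : SimpleGraph P) (s : ℝ) (f : Set ℂ) (σ : ℤ → P) (k c : ℤ) (p : ℂ) :
    Prop where
  lt : k < c
  mem : p ∈ openSegment ℝ (σ c : ℂ) (σ (c + 1))
  reflex : ∀ i, k < i → i < c → IsReflex σ i
  sees : SeesVertex f σ k (c + 1)
  corner : ∀ i, k ≤ i → i < c → InCorner σ i p
  view : ∀ i, k ≤ i → i < c → ChainView A s f 1 (σ c) p (σ i)
  fan : ∀ i, k ≤ i → i < c → IsFan A 1 (σ i) p (σ c) (σ (i + 1))

/-- The mirror image of `ForwardView`. -/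
structure BackwardView (A : SimpleGraph P) (s : ℝ) (f : Set ℂ) (σ : ℤ → P) (e b : ℤ) (p : ℂ) :
    Prop where
  lt : b < e
  mem : p ∈ openSegment ℝ (σ b : ℂ) (σ (b - 1))
  reflex : ∀ i, b < i → i < e → IsReflex σ i
  sees : SeesVertex f σ e (b - 1)
  view : ∀ i, b < i → i ≤ e → ChainView A s f (-1) (σ b) p (σ i)
  fan : ∀ i, b < i → i ≤ e → IsFan A (-1) (σ i) p (σ b) (σ (i - 1))

/-- The visible direction `p` starts in the corner of `k`. At each later position it is to the left
of the incoming edge, hence in the reflex corner, so the walk must follow the sweeps. -/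
theorem ForwardCond.exists_view (hP : GeneralPosition P) (hA : IsMaximalPSLG s A)
    (hf : IsFace A f) (hσ : ∀ i, IsCorner A σ i) {k c : ℤ} (hkc : k < c)
    (hr : ∀ i, k < i → i < c → IsReflex σ i) (h : ForwardCond s f σ k c) :
    ∃ p, ForwardView A s f σ k c p := by
  obtain ⟨hn, hv, p, hp, ⟨hpf, hpc⟩, ha⟩ := h
  have hcd := (hσ c).next
  have hpP := (bar_edge hA.1.1 hcd hp).2.1
  have hpos : 0 < D 1 (σ k : ℂ) p (σ c) := by
    rw [D_rot]; exact D_pos_of_ccwAngle_lt_pi (hpP _) (hpP _) ha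
  have key := chain_isFan hP hA hf hcd hp (fun t => σ (k + t)) (c - k).toNat
    (fun t x => InCorner σ (k + t) x) ⟨by simpa using hpf, by simpa using hpos,
      by simpa using hn.symm⟩ (by simpa [InCorner] using hpc) ?_ ?_ ?_
  · have key' : ∀ i, k ≤ i → i < c → InCorner σ i p ∧ ChainView A s f 1 (σ c) p (σ i) ∧
        IsFan A 1 (σ i) p (σ c) (σ (i + 1)) := by
      intro i h1 h2
      obtain ⟨t, rfl⟩ : ∃ t : ℕ, i = k + t := ⟨(i - k).toNat, by omega⟩
      obtain ⟨a1, a2, a3, -⟩ := key t (by omega)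
      refine ⟨a1, a2, ?_⟩
      have e : k + ((t + 1 : ℕ) : ℤ) = k + t + 1 := by push_cast; ring
      simp only [e] at a3
      exact a3
    exact ⟨p, hkc, hp, hr, hv, fun i h1 h2 => (key' i h1 h2).1, fun i h1 h2 => (key' i h1 h2).2.1,
      fun i h1 h2 => (key' i h1 h2).2.2⟩
  · intro t ht hi w hw hpw hb
    have := (hσ (k + t)).next_eq hP hi hw hpw hb
    have e : k + ((t + 1 : ℕ) : ℤ) = k + t + 1 := by push_cast; ring
    simp only [e]; exact this
  · intro t ht x hx
    have e : k + (t : ℤ) = k + ((t + 1 : ℕ) : ℤ) - 1 := by push_cast; ring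
    simp only [e] at hx
    exact InCorner.of_prev (hr _ (by omega) (by omega)) hx
  · intro t ht x hx hd
    have e : k + (t : ℤ) = k + ((t + 1 : ℕ) : ℤ) - 1 := by push_cast; ring
    simp only [e] at hd
    exact (hσ _).no_edge_prev (hr _ (by omega) (by omega)) hx hd

theorem BackwardCond.exists_view (hP : GeneralPosition P) (hA : IsMaximalPSLG s A)
    (hf : IsFace A f) (hσ : ∀ i, IsCorner A σ i) {e b : ℤ} (hbe : b < e)
    (hr : ∀ i, b < i → i < e → IsReflex σ i) (h : BackwardCond s f σ e b) :
    ∃ p, BackwardView A s f σ e b p := by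
  obtain ⟨hn, hv, p, hp, ⟨hpf, hpc⟩, ha⟩ := h
  rw [sub_add_cancel, openSegment_symm] at hp
  have hcd := (hσ b).prev
  have hpP := (bar_edge hA.1.1 hcd hp).2.1
  have hpos : 0 < D (-1) (σ e : ℂ) p (σ b) := by
    have h1 : 0 < D 1 p (σ (b - 1) : ℂ) (σ e) := D_pos_of_ccwAngle_lt_pi (hpP _) (hpP _) ha
    have := (D_pos_edge (by rwa [openSegment_symm]) (z := (σ e : ℂ)) (δ := 1)
      (by rw [D_one] at h1; rw [D_one]; exact h1)).2.2
    exact this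
  have key := chain_isFan hP hA hf hcd hp (fun t => σ (e - t)) (e - b).toNat
    (fun t x => InCorner σ (e - t) x) ⟨by simpa using hpf, by simpa using hpos,
      by simpa using hn.symm⟩ (by simpa [InCorner] using hpc) ?_ ?_ ?_
  · have key' : ∀ i, b < i → i ≤ e → ChainView A s f (-1) (σ b) p (σ i) ∧
        IsFan A (-1) (σ i) p (σ b) (σ (i - 1)) := by
      intro i h1 h2
      obtain ⟨t, rfl⟩ : ∃ t : ℕ, i = e - t := ⟨(e - i).toNat, by omega⟩
      obtain ⟨-, a2, a3, -⟩ := key t (by omega)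
      refine ⟨a2, ?_⟩
      have e' : e - ((t + 1 : ℕ) : ℤ) = e - t - 1 := by push_cast; ring
      simp only [e'] at a3
      exact a3
    exact ⟨p, hbe, hp, hr, hv, fun i h1 h2 => (key' i h1 h2).1,
      fun i h1 h2 => (key' i h1 h2).2⟩
  · intro t ht hi w hw hpw hb
    have := (hσ (e - t)).prev_eq hP hi hw (x := p) (by rwa [D_neg, D_swap', neg_neg] at hpw)
      (fun y hy y1 y2 => hb y hy (by rwa [D_neg, D_swap', neg_neg])
        (by rwa [D_neg, D_swap', neg_neg]))
    have e' : e - ((t + 1 : ℕ) : ℤ) = e - t - 1 := by push_cast; ring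
    simp only [e']; exact this
  · intro t ht x hx
    have e' : e - (t : ℤ) = e - ((t + 1 : ℕ) : ℤ) + 1 := by push_cast; ring
    simp only [e'] at hx
    exact InCorner.of_next (hσ _) (hr _ (by omega) (by omega)) (by rwa [D_neg, D_swap', neg_neg] at hx)
  · intro t ht x hx hd
    have e' : e - (t : ℤ) = e - ((t + 1 : ℕ) : ℤ) + 1 := by push_cast; ring
    simp only [e'] at hd
    exact (hσ _).no_edge_next (hr _ (by omega) (by omega)) hx (by rwa [D_neg, D_swap', neg_neg] at hd)

variable {k c e b : ℤ} {p : ℂ}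

theorem ForwardView.near (hA : IsMaximalPSLG s A) (hσ : ∀ i, IsCorner A σ i)
    (h : ForwardView A s f σ k c p) {i : ℤ} (h1 : k ≤ i) (h2 : i ≤ c + 1) :
    Near s (σ c : ℂ) (σ i) := by
  rcases lt_trichotomy i c with hi | rfl | hi
  · exact (h.view i h1 hi).near
  · exact near_refl _ _
  · obtain rfl : i = c + 1 := by omega
    exact near_of_adj hA (hσ c).next

theorem BackwardView.near (hA : IsMaximalPSLG s A) (hσ : ∀ i, IsCorner A σ i)
    (h : BackwardView A s f σ e b p) {i : ℤ} (h1 : b - 1 ≤ i) (h2 : i ≤ e) :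
    Near s (σ b : ℂ) (σ i) := by
  rcases lt_trichotomy i b with hi | rfl | hi
  · obtain rfl : i = b - 1 := by omega
    exact near_of_adj hA (hσ b).prev
  · exact near_refl _ _
  · exact (h.view i hi h2).near

/-- At `k` this is part of the visibility of the support vertex; later, the support vertex is to the
left of the incoming edge of a reflex position. -/
theorem ForwardView.corner_end (h : ForwardView A s f σ k c p) {i : ℤ} (h1 : k ≤ i) (h2 : i < c) :
    InCorner σ i (σ (c + 1)) := by
  rcases h1.eq_or_lt with rfl | h1
  · exact h.sees.1.2
  · have hf := h.fan (i - 1) (by omega) (by omega)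
    rw [sub_add_cancel] at hf
    have := D_end_pos h.mem (h.view (i - 1) (by omega) (by omega)).pos hf.inTri hf.pos
    rw [D_rot, D_rot] at this
    exact InCorner.of_prev (h.reflex i h1 h2) this

theorem BackwardView.corner_end (hσ : ∀ i, IsCorner A σ i) (h : BackwardView A s f σ e b p) {i : ℤ}
    (h1 : b < i) (h2 : i ≤ e) : InCorner σ i (σ (b - 1)) := by
  rcases h2.eq_or_lt with rfl | h2
  · exact h.sees.1.2
  · have hf := h.fan (i + 1) (by omega) (by omega)
    rw [add_sub_cancel_right] at hf
    have := D_end_pos h.mem (h.view (i + 1) (by omega) (by omega)).pos hf.inTri hf.pos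
    rw [D_neg, D_swap', neg_neg, ← D_rot, ← D_rot] at this
    exact InCorner.of_next (hσ i) (h.reflex i h1 h2) this

/-- An edge to the first vertex of the sweep from `p` to the support vertex would lie between the
latter and the next edge of the walk, inside the corner. Without such an edge the sweep ends at the
support vertex. -/
theorem ForwardView.sees_end (hP : GeneralPosition P) (hA : IsMaximalPSLG s A)
    (hf : IsFace A f) (hσ : ∀ i, IsCorner A σ i) (h : ForwardView A s f σ k c p) {i : ℤ}
    (h1 : k ≤ i) (h2 : i < c) : IsFan A (-1) (σ i) p (σ (c + 1)) (σ (c + 1)) ∧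
      openSegment ℝ (σ i : ℂ) (σ (c + 1)) ⊆ f := by
  have hv := h.view i h1 h2
  refine hv.sees_end hP hA hf (hσ c).next h.mem ?_
  intro w hw hadj
  have hd := h.corner_end h1 h2
  have hwd : w ≠ σ (c + 1) := by
    rintro rfl; exact (hσ i).outside _ hadj hd
  have hid : σ i ≠ σ (c + 1) := by
    intro e
    have g := (D_pos_edge h.mem (z := (σ i : ℂ)) (δ := 1) (by rw [← D_rot]; exact hv.pos)).2.2
    rw [← e, D_left] at g
    exact lt_irrefl _ g
  have hle := hw.le_end
  rw [D_neg, D_swap, neg_neg] at hle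
  refine (hσ i).no_edge_between_next hd (lt_of_le_of_ne hle (Ne.symm ?_))
    (D_fan_fan h.mem hv.pos (h.fan i h1 h2) hw) hadj
  exact D_ne_zero hP one_ne_zero hid hw.ne hwd.symm

theorem BackwardView.sees_end (hP : GeneralPosition P) (hA : IsMaximalPSLG s A)
    (hf : IsFace A f) (hσ : ∀ i, IsCorner A σ i) (h : BackwardView A s f σ e b p) {i : ℤ}
    (h1 : b < i) (h2 : i ≤ e) : IsFan A 1 (σ i) p (σ (b - 1)) (σ (b - 1)) ∧
      openSegment ℝ (σ i : ℂ) (σ (b - 1)) ⊆ f := by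
  have hv := h.view i h1 h2
  have key := hv.sees_end hP hA hf (hσ b).prev h.mem ?_
  · rwa [neg_neg] at key
  intro w hw hadj
  have hd := h.corner_end hσ h1 h2
  have hwd : w ≠ σ (b - 1) := by
    rintro rfl; exact (hσ i).outside _ hadj hd
  have hid : σ i ≠ σ (b - 1) := by
    intro e
    have g := (D_pos_edge h.mem (z := (σ i : ℂ)) (δ := -1) (by rw [← D_rot]; exact hv.pos)).2.2
    rw [← e, D_left] at g
    exact lt_irrefl _ g
  have hff := D_fan_fan h.mem hv.pos (h.fan i h1 h2) hw
  rw [D_neg, D_swap', neg_neg] at hff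
  have hle := hw.le_end
  rw [neg_neg, D_rot] at hle
  refine (hσ i).no_edge_between_prev hd hff (lt_of_le_of_ne hle (Ne.symm ?_)) hadj
  exact D_ne_zero hP one_ne_zero hw.ne hid hwd

end Views

end RingPhase

namespace RingPhase

/-! ### Joining a forward and a backward view -/

section Views

variable {P : Finset ℂ} {s : ℝ} {A : SimpleGraph P} {f : Set ℂ} {σ : ℤ → P}
  {k c e b : ℤ} {p q : ℂ}

theorem ChainView.ne {ε : ℝ} {c k : P} {p : ℂ} (h : ChainView A s f ε c p k) : k ≠ c := by
  rintro rfl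
  have := h.pos
  rw [D_left] at this
  exact lt_irrefl _ this

theorem ForwardView.inside (hP : GeneralPosition P) (h : ForwardView A s f σ k c p) {i : ℤ}
    (h1 : k ≤ i) (n : ℕ) (hn : i + n + 1 < c) : Inside 1 (σ c) p (σ i) (σ (i + n + 1)) := by
  induction n generalizing i with
  | zero =>
    have hn' : i + 1 < c := by simpa using hn
    simpa using (h.fan i h1 (by omega)).isInside hP (h.view i h1 (by omega)).pos
      (h.view (i + 1) (by omega) hn').ne
  | succ n ih =>
    have := ih (i := i + 1) (by omega) (by push_cast at hn; omega)
    rw [show i + ((n + 1 : ℕ) : ℤ) + 1 = i + 1 + n + 1 by push_cast; ring]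
    exact Inside.trans (h.view i h1 (by omega)).pos (h.view (i + 1) (by omega) (by omega)).pos
      ((h.fan i h1 (by omega)).isInside hP (h.view i h1 (by omega)).pos
        (h.view (i + 1) (by omega) (by omega)).ne) this

theorem BackwardView.inside (hP : GeneralPosition P) (h : BackwardView A s f σ e b p) {i : ℤ}
    (h1 : i ≤ e) (n : ℕ) (hn : b < i - n - 1) : Inside (-1) (σ b) p (σ i) (σ (i - n - 1)) := by
  induction n generalizing i with
  | zero =>
    have hn' : b < i - 1 := by simpa using hn
    simpa using (h.fan i (by omega) h1).isInside hP (h.view i (by omega) h1).pos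
      (h.view (i - 1) hn' (by omega)).ne
  | succ n ih =>
    have := ih (i := i - 1) (by omega) (by push_cast at hn; omega)
    rw [show i - ((n + 1 : ℕ) : ℤ) - 1 = i - 1 - n - 1 by push_cast; ring]
    exact Inside.trans (h.view i (by omega) h1).pos (h.view (i - 1) (by omega) (by omega)).pos
      ((h.fan i (by omega) h1).isInside hP (h.view i (by omega) h1).pos
        (h.view (i - 1) (by omega) (by omega)).ne) this

/-- The forward condition is inherited by the later vertices of the reflex chain. -/
theorem ForwardView.forwardCond (hP : GeneralPosition P) (hA : IsMaximalPSLG s A)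
    (hf : IsFace A f) (hσ : ∀ i, IsCorner A σ i) (h : ForwardView A s f σ k c p) {i : ℤ}
    (h1 : k ≤ i) (h2 : i < c) : ForwardCond s f σ i c := by
  have hv := h.view i h1 h2
  have hs := (h.sees_end hP hA hf hσ h1 h2).2
  refine ⟨hv.near.symm, ⟨⟨hs, h.corner_end h1 h2⟩, by rwa [openSegment_symm], ?_⟩, p, h.mem,
    ⟨hv.seg, h.corner i h1 h2⟩, ccwAngle_lt_pi_of_D_pos (by rw [← D_rot]; exact hv.pos)⟩
  rcases h1.eq_or_lt with rfl | h1
  · exact h.sees.2.2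
  -- At the support vertex, the direction to `σ i` lies between the edge to `σ c` and the direction
  -- to `σ k`, which is in the corner.
  refine InCorner.of_between_prev (hσ _) h.sees.2.2 ?_ ?_
  · rw [add_sub_cancel_right, ← D_rot]
    exact D_end_pos h.mem hv.pos ⟨hv.pos.le, (D_right _ _ _).ge, (D_left _ _ _).ge⟩ hv.pos
  · obtain ⟨n, rfl⟩ : ∃ n : ℕ, i = k + n + 1 := ⟨(i - k - 1).toNat, by omega⟩
    have hi := h.inside hP le_rfl n h2
    rw [← D_rot]
    exact D_end_pos h.mem (h.view k le_rfl h.lt).pos hi.tri hi.pos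

theorem ForwardView.isOneChain (hA : IsMaximalPSLG s A) (hσ : ∀ i, IsCorner A σ i)
    (h : ForwardView A s f σ k c p) (hc : IsConvex σ c) : IsOneChain s f σ k (c + 1) := by
  refine ⟨h.sees, c, h.lt, by omega, hc, ?_, fun i h1 h2 => h.near hA hσ h1 h2⟩
  intro i h1 h2 hi
  by_contra hne
  exact h.reflex i h1 (by omega) hi

theorem BackwardView.isOneChain (hA : IsMaximalPSLG s A) (hσ : ∀ i, IsCorner A σ i)
    (h : BackwardView A s f σ e b p) (hb : IsConvex σ b) : IsOneChain s f σ (b - 1) e := by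
  refine ⟨⟨h.sees.2, h.sees.1⟩, b, by omega, h.lt, hb, ?_, fun i h1 h2 => h.near hA hσ h1 h2⟩
  intro i h1 h2 hi
  by_contra hne
  exact h.reflex i (by omega) h2 hi

theorem exists_funnel_of_views (hP : GeneralPosition P) (hA : IsMaximalPSLG s A)
    (hf : IsFace A f) (hσ : ∀ i, IsCorner A σ i) (h : ForwardView A s f σ k c p)
    (h' : BackwardView A s f σ e c q) (hc : IsConvex σ c) (hk : k + 1 < c) (he : c + 1 < e) :
    ∃ x, Funnel A s 1 (σ k) (σ e) (σ c) (σ (k + 1)) (σ (e - 1)) (σ (c - 1)) (σ (c + 1)) x := by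
  have hin : ∀ i, k ≤ i → i + 1 < c → Inside 1 (σ c) p (σ i) (σ (c - 1)) := by
    intro i h1 h2
    have := h.inside hP h1 (c - i - 2).toNat (by omega)
    rwa [show i + ((c - i - 2).toNat : ℤ) + 1 = c - 1 by omega] at this
  have hin' : ∀ i, i ≤ e → c + 1 < i → Inside (-1) (σ c) q (σ i) (σ (c + 1)) := by
    intro i h1 h2
    have := h'.inside hP h1 (i - c - 2).toNat (by omega)
    rwa [show i - ((i - c - 2).toNat : ℤ) - 1 = c + 1 by omega] at this
  have s1 := h.sees_end hP hA hf hσ le_rfl h.lt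
  have s2 := h'.sees_end hP hA hf hσ h'.lt le_rfl
  refine exists_funnel
    ((h.view k le_rfl h.lt).funnelSide hP hA.1.1 hf (hσ c).next h.mem (h.fan k le_rfl h.lt)
      (hσ k).next s1.1 (hf.free s1.2) (hin k le_rfl hk) ?_)
    ((h'.view e h'.lt le_rfl).funnelSide hP hA.1.1 hf (hσ c).prev h'.mem (h'.fan e h'.lt le_rfl)
      (hσ e).prev (by rw [neg_neg]; exact s2.1) (hf.free s2.2) (hin' e le_rfl he) ?_)
    (D_pos_of_ccwAngle_lt_pi (hσ c).prev_ne (hσ c).next_ne hc)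
  · rcases eq_or_ne (k + 1) (c - 1) with e1 | e1
    · exact Or.inl (by rw [e1])
    · exact Or.inr ⟨(h.view (k + 1) (by omega) hk).pos, hin _ (by omega) (by omega)⟩
  · rcases eq_or_ne (e - 1) (c + 1) with e1 | e1
    · exact Or.inl (by rw [e1])
    · exact Or.inr ⟨(h'.view (e - 1) (by omega) (by omega)).pos, hin' _ (by omega) (by omega)⟩

/-- If one of the chains is a single edge, one of the given conditions already states the
visibility. Otherwise the pocket of the funnel is empty and its ends are not joined, so the face
extends from `k x` to `k e`. -/
theorem seesVertex_of_views (hP : GeneralPosition P) (hA : IsMaximalPSLG s A)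
    (hf : IsFace A f) (hσ : ∀ i, IsCorner A σ i) (h : ForwardView A s f σ k c p)
    (h' : BackwardView A s f σ e c q) (hc : IsConvex σ c) : SeesVertex f σ k e := by
  have hk := h.lt
  have he := h'.lt
  rcases eq_or_ne (k + 1) c with e1 | e1
  · have := h'.sees
    rw [← e1, add_sub_cancel_right] at this
    exact ⟨this.2, this.1⟩
  rcases eq_or_ne (c + 1) e with e2 | e2
  · rw [← e2]; exact h.sees
  obtain ⟨x, hx⟩ := exists_funnel_of_views hP hA hf hσ h h' hc (by omega) (by omega)
  obtain ⟨-, s2, -, s4⟩ := hx.signs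
  have hfan := hx.fan_eq hP hA
  have hfan' := hx.symm.fan_eq hP hA
  rw [neg_neg] at hfan'
  have hnot := hx.not_adj hA
  obtain ⟨t, t0, t1, ht, -⟩ := hx.exists_left
  obtain ⟨t', t0', t1', ht', -⟩ := hx.symm.exists_left
  have hseg : openSegment ℝ (σ k : ℂ) x ⊆ f := by
    intro z hz
    obtain ⟨r, r0, r1, hre, him⟩ := exists_of_mem_openSegment hz
    obtain ⟨l, l0, l1, hre', him'⟩ := exists_of_mem_openSegment hx.mem_left
    refine (h.sees_end hP hA hf hσ le_rfl h.lt).2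
      (mem_openSegment_of (t := r * l) (mul_pos r0 l0) (by nlinarith) ?_ ?_)
    · rw [hre, hre']; ring
    · rw [him, him']; ring
  have hke := hfan.openSegment_subset' hf (hfan.adj_or_free.resolve_left hnot) hseg
  refine ⟨⟨hke, ?_⟩, by rwa [openSegment_symm], ?_⟩
  -- The direction to the support vertex is turned to that of `e`; the incoming edge cannot be in
  -- between, since the pocket sweep meets no edge at `k`.
  · refine (h.corner_end le_rfl h.lt).turn_right hP (hσ k) ?_ ?_ ?_
    · rw [D_swap']; linarith
    · intro d1 d2
      refine hfan.no_edge _ (hσ k).prev ?_ ?_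
      · rw [ht, D_neg, D_swap', neg_neg]; exact mul_pos t0 d2
      · rw [D_neg, D_swap', neg_neg]; exact d1
    · intro e3; exact hnot (e3 ▸ (hσ k).prev)
  · refine (h'.corner_end hσ h'.lt le_rfl).turn_left hP (hσ e) s2 ?_ ?_
    · intro d1 d2
      refine hfan'.no_edge _ (hσ e).next ?_ d2
      rw [ht']; exact mul_pos t0' d1
    · intro e3; exact hnot (e3 ▸ (hσ e).next).symm

theorem isOneChain_of_views (hP : GeneralPosition P) (hA : IsMaximalPSLG s A)
    (hf : IsFace A f) (hσ : ∀ i, IsCorner A σ i) (h : ForwardView A s f σ k c p)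
    (h' : BackwardView A s f σ e c q) (hc : IsConvex σ c) : IsOneChain s f σ k e := by
  refine ⟨seesVertex_of_views hP hA hf hσ h h' hc, c, h.lt, h'.lt, hc, ?_, ?_⟩
  · intro i h1 h2 hi
    rcases lt_trichotomy i c with h3 | h3 | h3
    · exact absurd hi (h.reflex i h1 h3)
    · exact h3
    · exact absurd hi (h'.reflex i h3 h2)
  · intro i h1 h2
    rcases le_or_gt i c with h3 | h3
    · exact h.near hA hσ h1 (by omega)
    · exact h'.near hA hσ (by omega) h2

end Views

end RingPhase

namespace RingPhase

/-! ### Invariance under a period -/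

section Shift

variable {P : Finset ℂ} {s : ℝ} {f : Set ℂ} {σ : ℤ → P} {n : ℤ}

theorem cornerAngle_add (h : Function.Periodic σ n) (i : ℤ) :
    cornerAngle σ (i + n) = cornerAngle σ i := by
  unfold cornerAngle
  rw [show i + n - 1 = i - 1 + n by ring, show i + n + 1 = i + 1 + n by ring, h, h, h]

theorem isConvex_add (h : Function.Periodic σ n) (i : ℤ) :
    IsConvex σ (i + n) ↔ IsConvex σ i := by
  unfold IsConvex; rw [cornerAngle_add h]

theorem seesPoint_add (h : Function.Periodic σ n) (i : ℤ) (x : ℂ) :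
    SeesPoint f σ (i + n) x ↔ SeesPoint f σ i x := by
  unfold SeesPoint
  rw [cornerAngle_add h, show i + n - 1 = i - 1 + n by ring, h, h]

theorem seesVertex_add (h : Function.Periodic σ n) (i k : ℤ) :
    SeesVertex f σ (i + n) (k + n) ↔ SeesVertex f σ i k := by
  unfold SeesVertex
  rw [seesPoint_add h, seesPoint_add h, h, h]

theorem seesEdge_add (h : Function.Periodic σ n) (i k : ℤ) :
    SeesEdge f σ (i + n) (k + n) ↔ SeesEdge f σ i k := by
  unfold SeesEdge
  simp only [seesPoint_add h]
  rw [show k + n + 1 = k + 1 + n by ring, h, h, h]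

theorem forwardCond_add (h : Function.Periodic σ n) (k c : ℤ) :
    ForwardCond s f σ (k + n) (c + n) ↔ ForwardCond s f σ k c := by
  unfold ForwardCond
  rw [show c + n + 1 = c + 1 + n by ring, seesVertex_add h, seesEdge_add h, h, h]

theorem backwardCond_add (h : Function.Periodic σ n) (k b : ℤ) :
    BackwardCond s f σ (k + n) (b + n) ↔ BackwardCond s f σ k b := by
  unfold BackwardCond
  rw [show b + n - 1 = b - 1 + n by ring, seesVertex_add h, seesEdge_add h, h, h]

theorem IsOneChain.add (h : Function.Periodic σ n) {a b : ℤ} (hc : IsOneChain s f σ a b) :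
    IsOneChain s f σ (a + n) (b + n) := by
  obtain ⟨hv, c, h1, h2, h3, h4, h5⟩ := hc
  refine ⟨(seesVertex_add h _ _).2 hv, c + n, by omega, by omega, (isConvex_add h _).2 h3, ?_, ?_⟩
  · intro i i1 i2 i3
    have := h4 (i - n) (by omega) (by omega) ((isConvex_add h _).1 (by rwa [sub_add_cancel]))
    omega
  · intro i i1 i2
    have := h5 (i - n) (by omega) (by omega)
    rwa [← h (i - n), sub_add_cancel, ← h c] at this

end Shift

/-! ### The chains generated by Phase 1 -/

section Phase

variable {P : Finset ℂ} {s : ℝ} {A : SimpleGraph P} {f : Set ℂ} {m : ℕ} {σ : ℤ → P}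
  {j k c e : ℤ} {p : ℂ}

theorem IsBoundaryWalk.two_le (h : IsBoundaryWalk A f m σ) : 2 ≤ m := by
  have h0 := h.pos
  by_contra hlt
  obtain rfl : m = 1 := by omega
  exact (h.adj 0).ne (h.periodic 0).symm

/-- What follows the convex position `c` in a generated chain that has no further convex position
in its interior. -/
def IsTail (s : ℝ) (f : Set ℂ) (σ : ℤ → P) (c e : ℤ) : Prop :=
  e = c + 1 ∨ (c < e ∧ (∀ i, c < i → i ≤ e → IsReflex σ i) ∧ BackwardCond s f σ e c)

theorem IsTail.lt (h : IsTail s f σ c e) : c < e := by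
  rcases h with h | h
  · omega
  · exact h.1

theorem IsTail.add {n : ℤ} (hn : Function.Periodic σ n) (h : IsTail s f σ c e) :
    IsTail s f σ (c + n) (e + n) := by
  rcases h with h | ⟨h1, h2, h3⟩
  · left; omega
  · refine Or.inr ⟨by omega, fun i i1 i2 hi => h2 (i - n) (by omega) (by omega) ?_,
      (backwardCond_add hn _ _).2 h3⟩
    exact (isConvex_add hn _).1 (by rwa [sub_add_cancel])

theorem StepOne.reflex (h : StepOne s f σ k c) {i : ℤ} (h1 : k < i) (h2 : i < c) :
    IsReflex σ i := fun hi => absurd (h.1.2 ⟨h1, hi⟩) (not_le.2 h2)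

theorem StepOne.exists_view (hP : GeneralPosition P) (hA : IsMaximalPSLG s A)
    (hf : IsFace A f) (hσ : ∀ i, IsCorner A σ i) (h : StepOne s f σ k c) :
    ∃ p, ForwardView A s f σ k c p :=
  h.2.exists_view hP hA hf hσ h.1.1.1 fun _ => h.reflex

theorem StepOne.isOneChain (hP : GeneralPosition P) (hA : IsMaximalPSLG s A)
    (hf : IsFace A f) (hσ : ∀ i, IsCorner A σ i) (h : StepOne s f σ k c) :
    IsOneChain s f σ k (c + 1) := by
  obtain ⟨p, hp⟩ := h.exists_view hP hA hf hσ
  exact hp.isOneChain hA hσ h.1.1.2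

theorem StepOne.isOneChain_of_tail (hP : GeneralPosition P) (hA : IsMaximalPSLG s A)
    (hf : IsFace A f) (hσ : ∀ i, IsCorner A σ i) (h : StepOne s f σ k c)
    (ht : IsTail s f σ c e) : IsOneChain s f σ k e := by
  rcases ht with rfl | ⟨h1, h2, h3⟩
  · exact h.isOneChain hP hA hf hσ
  · obtain ⟨p, hp⟩ := h.exists_view hP hA hf hσ
    obtain ⟨q, hq⟩ := h3.exists_view hP hA hf hσ h1 fun i i1 i2 => h2 i i1 i2.le
    exact isOneChain_of_views hP hA hf hσ hp hq h.1.1.2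

/-- The backward convex position in Step 1(a) is `c` or `c + 1`. -/
theorem StepOneA.eq_or (hc : IsConvex σ c) {b : ℤ} (h : StepOneA s f σ (c + 1) b) :
    (b = c ∧ IsReflex σ (c + 1)) ∨ (b = c + 1 ∧ IsConvex σ (c + 1)) := by
  obtain ⟨-, ⟨⟨h1, h2⟩, h3⟩, -⟩ := h
  have hle := h3 ⟨(by omega : c < c + 1 + 1), hc⟩
  by_cases h4 : IsConvex σ (c + 1)
  · have := h3 ⟨(by omega : c + 1 < c + 1 + 1), h4⟩
    exact Or.inr ⟨by omega, h4⟩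
  · refine Or.inl ⟨?_, h4⟩
    have : b ≠ c + 1 := fun e => h4 (e ▸ h2)
    omega

theorem IsLastOfRun.isTail (h : IsLastOfRun s f σ (c + 1) c e) (hr : IsReflex σ (c + 1)) :
    IsTail s f σ c e := by
  obtain ⟨⟨h1, h2, h3⟩, -⟩ := h
  refine Or.inr ⟨by omega, fun i i1 i2 => ?_, h3⟩
  rcases eq_or_ne i (c + 1) with rfl | hi
  · exact hr
  · exact h2 i (by omega) i2

theorem StepOne.isTwoChain (hP : GeneralPosition P) (hA : IsMaximalPSLG s A)
    (hf : IsFace A f) (hσ : ∀ i, IsCorner A σ i) (h : StepOne s f σ k c)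
    (hc : IsConvex σ (c + 1)) (hce : c + 1 < e) (ht : IsOneChain s f σ c e) :
    IsTwoChain s f σ k e := by
  refine ⟨c, h.1.1.1, hce, h.1.1.2, hc, ?_, h.isOneChain hP hA hf hσ, ht⟩
  intro i h1 h2 hi
  rcases lt_trichotomy i c with h3 | h3 | h3
  · exact absurd hi (h.reflex h1 h3)
  · exact Or.inl h3
  · obtain ⟨-, c', -, -, -, h4, -⟩ := ht
    exact Or.inr ((h4 i h3 h2 hi).trans (h4 (c + 1) (by omega) hce hc).symm)

theorem OrdinaryChain.isChain (hP : GeneralPosition P) (hA : IsMaximalPSLG s A)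
    (hf : IsFace A f) (hσ : ∀ i, IsCorner A σ i) (h : OrdinaryChain s f m σ j k e) :
    IsOneChain s f σ k e ∨ IsTwoChain s f σ k e := by
  obtain ⟨c, h1, -, ⟨b, hb, hl⟩ | ⟨-, rfl⟩⟩ := h
  · rcases hb.eq_or h1.1.1.2 with ⟨rfl, hr⟩ | ⟨rfl, hc⟩
    · exact Or.inl (h1.isOneChain_of_tail hP hA hf hσ (hl.isTail hr))
    · obtain ⟨⟨l1, l2, l3⟩, -⟩ := hl
      obtain ⟨q, hq⟩ := l3.exists_view hP hA hf hσ (by omega)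
        fun i i1 i2 => l2 i (by omega) i2.le
      have := hq.isOneChain hA hσ hc
      rw [add_sub_cancel_right] at this
      exact Or.inr (h1.isTwoChain hP hA hf hσ hc (by omega) this)
  · exact Or.inl (h1.isOneChain hP hA hf hσ)

/-- A backward support vertex precedes a convex one by definition. If there is none, a reflex
position after any convex one is impossible, so by periodicity one convex position makes all of them
convex. -/
theorem IsStart.isConvex_succ (hm : 0 < m) (hper : Function.Periodic σ (m : ℤ))
    (hj : IsStart σ j) (hc : IsConvex σ c) : IsConvex σ (j + 1) := by
  rcases hj with ⟨k, -, hk⟩ | ⟨hno, rfl⟩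
  · exact hk.1.2
  · by_contra hr
    -- Going back `|c|` periods moves the convex position before position `1`.
    have hn : Function.Periodic σ (-(|c|) * (m : ℤ)) := hper.int_mul _
    have hc' := (isConvex_add hn c).2 hc
    have hlt : c + -(|c|) * (m : ℤ) < 0 + 1 := by
      have : |c| * 1 ≤ |c| * (m : ℤ) := by gcongr; omega
      have := le_abs_self c
      linarith
    obtain ⟨b, hb, hmax⟩ := Int.exists_greatest_of_bdd
      (P := fun i => i < 0 + 1 ∧ IsConvex σ i) ⟨1, fun z hz => by omega⟩ ⟨_, hlt, hc'⟩
    exact hno (b - 1) ⟨0 + 1, hr, by rw [sub_add_cancel]; exact ⟨hb, fun i hi => hmax i hi⟩⟩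

/-- A convex `j + 2` would come between `j + 1` and the reflex vertex that `j` supports; with no
backward support vertex at all, the condition cannot hold. This keeps a second convex position out
of the start chain. -/
theorem IsStart.eq_of_stepOneA (hj : IsStart σ j) (hc : IsConvex σ (j + 1)) {b : ℤ}
    (h : StepOneA s f σ (j + 1 + 1) b) : b = j + 1 ∧ IsReflex σ (j + 1 + 1) := by
  rcases h.eq_or hc with h1 | ⟨-, h2⟩
  · exact h1
  · exfalso
    rcases hj with ⟨k, hk, hk'⟩ | ⟨hno, rfl⟩
    · have hlt : j + 1 < k := hk'.1.1
      rcases eq_or_ne k (j + 1 + 1) with rfl | hne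
      · exact hk h2
      · have : j + 1 + 1 ≤ j + 1 := hk'.2 ⟨by omega, h2⟩
        omega
    · exact hno (b - 1) ⟨_, h.1, by rw [sub_add_cancel]; exact h.2.1⟩

theorem IsStart.ordinaryChain (hm : 0 < m) (hper : Function.Periodic σ (m : ℤ))
    (hj : IsStart σ j) (h : OrdinaryChain s f m σ j j e) :
    StepOne s f σ j (j + 1) ∧ IsTail s f σ (j + 1) e := by
  obtain ⟨c, h1, -, h2⟩ := h
  have hc := hj.isConvex_succ hm hper h1.1.1.2
  obtain rfl : c = j + 1 := by
    have h3 : c ≤ j + 1 := h1.1.2 ⟨by omega, hc⟩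
    have h4 : j < c := h1.1.1.1
    omega
  refine ⟨h1, ?_⟩
  rcases h2 with ⟨b, hb, hl⟩ | ⟨-, rfl⟩
  · obtain ⟨rfl, hr⟩ := hj.eq_of_stepOneA hc hb
    exact hl.isTail hr
  · exact Or.inl rfl

/-- As `j + 1 + m` is convex, the forward convex position is `j + m` or `j + 1 + m`. In the first
case the shifted start chain, if there is one, supplies the second half of a `2`-chain. In the
second case both views share one convex position. -/
theorem ClosingChain.isChain (hP : GeneralPosition P) (hA : IsMaximalPSLG s A)
    (hf : IsFace A f) (hσ : ∀ i, IsCorner A σ i) (hm : 0 < m)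
    (hper : Function.Periodic σ (m : ℤ)) (hj : IsStart σ j) (hk : k < j + m)
    (h : ClosingChain s f m σ j k e) : IsOneChain s f σ k e ∨ IsTwoChain s f σ k e := by
  obtain ⟨c, j', h1, h2, h3, rfl⟩ := h
  have hc := hj.isConvex_succ hm hper h1.1.1.2
  have hc' : IsConvex σ (j + 1 + m) := (isConvex_add hper _).2 hc
  have hle : c ≤ j + 1 + m := h1.1.2 ⟨by omega, hc'⟩
  have hor : c = j + m ∨ c = j + 1 + m := by omega
  rcases hor with rfl | rfl
  · rcases h3 with h3 | ⟨-, rfl⟩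
    · obtain ⟨g1, g2⟩ := hj.ordinaryChain hm hper h3
      have hlt := g2.lt
      exact Or.inr (h1.isTwoChain hP hA hf hσ (by rwa [add_right_comm]) (by omega)
        ((g1.isOneChain_of_tail hP hA hf hσ g2).add hper))
    · rw [add_right_comm]
      exact Or.inl (h1.isOneChain hP hA hf hσ)
  · left
    obtain ⟨p, hp⟩ := h1.exists_view hP hA hf hσ
    -- The position `j + m` lies on the reflex chain of `k` and inherits the forward condition, so
    -- the start vertex was processed and its chain has a tail to reuse.
    have hcond := hp.forwardCond hP hA hf hσ (i := j + m) hk.le (by omega)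
    rw [forwardCond_add hper] at hcond
    rcases h3 with h3 | ⟨h3, -⟩
    · exact h1.isOneChain_of_tail hP hA hf hσ ((hj.ordinaryChain hm hper h3).2.add hper)
    · refine absurd ⟨⟨⟨by omega, hc⟩, fun i hi => ?_⟩, hcond⟩ (h3 (j + 1))
      have : j < i := hi.1
      omega

theorem Generates.isOneChain_or_isTwoChain (hP : GeneralPosition P) (hA : IsMaximalPSLG s A)
    (hf : IsFace A f) (hσ : IsBoundaryWalk A f m σ) (hj : IsStart σ j)
    (h : Generates s f m σ j k e) : IsOneChain s f σ k e ∨ IsTwoChain s f σ k e := by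
  rcases h with ⟨-, hk, h | h⟩
  · exact h.isChain hP hA hf hσ.isCorner
  · exact h.isChain hP hA hf hσ.isCorner hσ.pos hσ.periodic hj hk

theorem Generates.isOneChain_start (hP : GeneralPosition P) (hA : IsMaximalPSLG s A)
    (hf : IsFace A f) (hσ : IsBoundaryWalk A f m σ) (hj : IsStart σ j)
    (h : Generates s f m σ j j e) : IsOneChain s f σ j e := by
  rcases h with ⟨-, -, h | ⟨c, -, h1, h2, -, -⟩⟩
  · obtain ⟨g1, g2⟩ := hj.ordinaryChain hσ.pos hσ.periodic h
    exact g1.isOneChain_of_tail hP hA hf hσ.isCorner g2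
  -- Step 1(c) cannot occur at the start: its forward convex position is at most `j + 1`, which is
  -- less than `j + m` because a boundary walk has length at least two.
  · have hc := hj.isConvex_succ hσ.pos hσ.periodic h1.1.1.2
    have : c ≤ j + 1 := h1.1.2 ⟨by omega, hc⟩
    have := hσ.two_le
    omega

theorem IsOneChain.near_of_convex {a b : ℤ} (h : IsOneChain s f σ a b) (h1 : a < c) (h2 : c < b)
    (hc : IsConvex σ c) {i : ℤ} (h3 : a ≤ i) (h4 : i ≤ b) : Near s (σ c : ℂ) (σ i) := by
  obtain ⟨-, c', -, -, -, hu, hn⟩ := h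
  rw [hu c h1 h2 hc]
  exact hn i h3 h4

theorem atMostCellsApart_of_near {u v x : ℂ} (h1 : Near s x u) (h2 : Near s x v) :
    AtMostCellsApart s 4 u v :=
  ⟨3, by omega, 2, rfl, mem_cellRing_of_near (mem_cellRing_of_near (r := 0) rfl h1.symm) h2⟩

/-- In a `2`-chain the route goes through the two convex vertices: three steps to a neighbouring
block, and the count of cells exceeds the number of steps by one. -/
theorem atMostCellsApart_of_near_of_near {u v x y : ℂ} (h1 : Near s x u) (hxy : Near s x y)
    (h2 : Near s y v) : AtMostCellsApart s 4 u v :=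
  ⟨4, le_rfl, 3, rfl, mem_cellRing_of_near
    (mem_cellRing_of_near (mem_cellRing_of_near (r := 0) rfl h1.symm) hxy) h2⟩

theorem IsOneChain.atMostCellsApart (h : IsOneChain s f σ k e) {i l : ℤ} (hi : k ≤ i)
    (hi' : i ≤ e) (hl : k ≤ l) (hl' : l ≤ e) : AtMostCellsApart s 4 (σ i : ℂ) (σ l) := by
  obtain ⟨-, c, -, -, -, -, hn⟩ := h
  exact atMostCellsApart_of_near (hn i hi hi') (hn l hl hl')

theorem IsTwoChain.atMostCellsApart (hA : IsMaximalPSLG s A) (hσ : ∀ i, IsCorner A σ i)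
    (h : IsTwoChain s f σ k e) {i l : ℤ} (hi : k ≤ i) (hi' : i ≤ e) (hl : k ≤ l) (hl' : l ≤ e) :
    AtMostCellsApart s 4 (σ i : ℂ) (σ l) := by
  obtain ⟨c, h1, h2, c1, c2, -, o1, o2⟩ := h
  have hn := near_of_adj hA (hσ c).next
  have n1 : ∀ {i}, k ≤ i → i ≤ c + 1 → Near s (σ c : ℂ) (σ i) :=
    o1.near_of_convex h1 (by omega) c1
  have n2 : ∀ {i}, c ≤ i → i ≤ e → Near s (σ (c + 1) : ℂ) (σ i) :=
    o2.near_of_convex (by omega) h2 c2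
  rcases le_total i c with a | a <;> rcases le_total l c with b | b
  · exact atMostCellsApart_of_near (n1 hi (by omega)) (n1 hl (by omega))
  · exact atMostCellsApart_of_near_of_near (n1 hi (by omega)) hn (n2 b hl')
  · exact atMostCellsApart_of_near_of_near (n2 a hi') hn.symm (n1 hl (by omega))
  · exact atMostCellsApart_of_near (n2 a hi') (n2 b hl')

end Phase

end RingPhase

theorem mainTheorem2 (P : Finset ℂ) (hP : RingPhase.GeneralPosition P)
    (γ : ℝ) (hγ : 0 < γ) (i : ℤ) (s : ℝ) (hs : s = γ * (3 : ℝ) ^ (i - 1))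
    (A : SimpleGraph P) (hA : RingPhase.IsMaximalPSLG s A)
    (f : Set ℂ) (hf : RingPhase.IsFace A f) (hft : ¬ RingPhase.IsTriangulated P f)
    (m : ℕ) (σ : ℤ → P) (hσ : RingPhase.IsBoundaryWalk A f m σ)
    (j : ℤ) (hj : RingPhase.IsStart σ j) :
    (∀ k e, RingPhase.Generates s f m σ j k e →
      RingPhase.IsOneChain s f σ k e ∨ RingPhase.IsTwoChain s f σ k e) ∧
    (∀ e, RingPhase.Generates s f m σ j j e → RingPhase.IsOneChain s f σ j e) ∧
    (∀ u v, RingPhase.InGeneratedChain s f m σ j u v →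
      RingPhase.AtMostCellsApart s 4 u v) := by
  refine ⟨fun k e h => h.isOneChain_or_isTwoChain hP hA hf hσ hj,
    fun e h => h.isOneChain_start hP hA hf hσ hj, ?_⟩
  rintro u v ⟨k, e, h, p, q, hp, hp', hq, hq', rfl, rfl⟩
  rcases h.isOneChain_or_isTwoChain hP hA hf hσ hj with h1 | h2
  · exact h1.atMostCellsApart hp hp' hq hq'
  · exact h2.atMostCellsApart hA hσ.isCorner hp hp' hq hq'
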